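/- Let $\lambda$ be a non-zero real number. For real $x$ let $$\psi(x)=\exp\left(-\frac14\int_{\mathbb R+i0}\frac{e^{-ixz}\,dz}{\sinh(\pi\lambda z)\sinh(\pi\lambda^{-1}z)\,z}\right),$$ where the contour is the real line shifted slightly upwards, so that of all singularities of the integrand that lie on or above the real line only $z=0$ is left below it. Let $\zeta=\exp\left(-\frac{i\pi}{12}(\lambda+\lambda^{-1})^2\right)$. On $L^2(\mathbb R^m)$ let $q_kf(x)=x_kf(x)$ and $p_kf=-2\pi i\,\partial f/\partial x_k$. Real polynomial expressions in these operators that are essentially self-adjoint on the Schwartz space are identified with their closures, and functions of them are understood in the sense of the functional calculus. Let $R$ be the bounded operator on $L^2(\mathbb R)$ that is given on $L^1(\mathbb R)\cap L^2(\mathbb R)$ by $$Rf(x)=\exp\left(\frac{ix^2}{4\pi}-\frac{i\pi}{12}\right)\int_{-\infty}^{\infty}f(y)\,e^{ixy/2\pi}\,\frac{dy}{2\pi},$$ and let $T$ be the operator on $L^2(\mathbb R^2)$ $$T=\exp\left(\frac{i}{2\pi}p_1q_2\right)\psi(q_1+p_2-q_2).$$ For an operator $b$ on $L^2(\mathbb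 R^k)$ and distinct $i_1,\dots,i_k\in\{1,\dots,m\}$ let $b_{i_1\dots i_k}$ be the operator on $L^2(\mathbb R^m)$ that acts as $b$ on the variables $x_{i_1},\dots,x_{i_k}$ (in this order) and identically on the others. For a permutation $\sigma$ of $\{1,\dots,m\}$ let $P_\sigma f(x_1,\dots,x_m)=f(x_{\sigma(1)},\dots,x_{\sigma(m)})$. Then: 1. $\psi(x)\psi(-x)=\exp\left(-\frac{i\pi}{12}(\lambda^2+\lambda^{-2})-\frac{ix^2}{4\pi}\right)$ for all $x\in\mathbb R$. 2. $R$ and $T$ are unitary, and $R^3=1$. 3. For every $m$ and all distinct $i,j\in\{1,\dots,m\}$ the operators $R_i$ and $T_{ij}$ on $L^2(\mathbb R^m)$ are unitary, and $$T_{ij}\,R_i\,T_{ji}\,R_i^{-1}=\zeta\,R_i\,P_{(ij)},\qquad T_{ij}=R_i^{-1}R_j\,T_{ji}\,R_iR_j^{-1}.$$ In particular $T_{12}R_1T_{21}R_1^{-1}=\zeta R_1P_{(12)}$ and $T_{12}=R_1^{-1}R_2T_{21}R_1R_2^{-1}$. -/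

import Mathlib

open MeasureTheory Complex
open scoped SchwartzMap ENNReal

noncomputable section

/-- The Hilbert space `L²(ℝᵐ)` of complex-valued functions, with respect to Lebesgue measure. -/
abbrev L2 (m : ℕ) : Type := Lp ℂ 2 (volume : Measure (Fin m → ℝ))

/-! ### The scalar functions -/

/-- The non-compact quantum dilogarithm
`ψ(x) = exp (-(1/4) ∫ exp(-i x z) / (sinh(π λ z) sinh(π λ⁻¹ z) z) dz)`
on the real line. The contour runs from `-∞` to `+∞` and leaves the singularity `z = 0` below it.
It is taken to be the horizontal line of height `min(|λ|, |λ|⁻¹) / 2`, half the distance from the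
real line to the other singularities, which are the points `i n λ` and `i n λ⁻¹`, `n ≠ 0`. -/
def qdilog (lam x : ℝ) : ℂ :=
  cexp (-(1 / 4) * ∫ t : ℝ,
    let z : ℂ := (t : ℂ) + ((min |lam| |lam|⁻¹ / 2 : ℝ) : ℂ) * I
    cexp (-I * x * z) / (sinh (Real.pi * lam * z) * sinh (Real.pi * lam⁻¹ * z) * z))

/-- `ζ = exp (-(iπ/12) (λ + λ⁻¹)²)`. -/
def zetaFactor (lam : ℝ) : ℂ :=
  cexp (-(I * Real.pi / 12) * (lam + lam⁻¹) ^ 2)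

/-! ### Positions and momenta on the Schwartz space -/

/-- The position operator `q_i f(x) = x_i f(x)` on the Schwartz space of `ℝᵐ`. -/
def qOp {m : ℕ} (i : Fin m) : Module.End ℂ 𝓢(Fin m → ℝ, ℂ) :=
  (SchwartzMap.smulLeftCLM ℂ (fun x : Fin m → ℝ => (x i : ℂ))).toLinearMap

/-- The momentum operator `p_i f = -2πi ∂f/∂x_i` on the Schwartz space of `ℝᵐ`. -/
def pOp {m : ℕ} (i : Fin m) : Module.End ℂ 𝓢(Fin m → ℝ, ℂ) :=
  (-(2 * Real.pi * I) : ℂ) •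
    (LineDeriv.lineDerivOpCLM ℂ 𝓢(Fin m → ℝ, ℂ) (Pi.single i 1 : Fin m → ℝ)).toLinearMap

theorem qOp_apply {m : ℕ} (i : Fin m) (f : 𝓢(Fin m → ℝ, ℂ)) (x : Fin m → ℝ) :
    qOp i f x = x i * f x := by
  have h : Function.HasTemperateGrowth (fun x : Fin m → ℝ => (x i : ℂ)) :=
    (Complex.ofRealCLM.comp
      (ContinuousLinearMap.proj (R := ℝ) (φ := fun _ : Fin m => ℝ) i)).hasTemperateGrowth
  simp [qOp, SchwartzMap.smulLeftCLM_apply_apply h]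

theorem pOp_apply {m : ℕ} (i : Fin m) (f : 𝓢(Fin m → ℝ, ℂ)) (x : Fin m → ℝ) :
    pOp i f x = -(2 * Real.pi * I) * lineDeriv ℝ f x (Pi.single i 1) := by
  simp [pOp, SchwartzMap.lineDerivOp_apply]

/-! ### Functions of a self-adjoint operator -/

/-- Let `A` be an operator in `L²(ℝᵐ)` with the Schwartz space as its domain. `IsFunctionOf φ A B`
says that the closure of `A` is unitarily equivalent to the (self-adjoint, maximally defined)
operator of multiplication by a real measurable function `h` on some `L²(X, μ)`, and that under the
same unitary equivalence the bounded operator `B` is the multiplication by `φ ∘ h`.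

By the spectral theorem the first part holds exactly if `A` is essentially self-adjoint, and then
`B` is the operator `φ(A)` of the Borel functional calculus (independently of the choices). -/
def IsFunctionOf {m : ℕ} (φ : ℝ → ℂ) (A : Module.End ℂ 𝓢(Fin m → ℝ, ℂ)) (B : L2 m →L[ℂ] L2 m) :
    Prop :=
  ∃ (X : Type) (_ : MeasurableSpace X) (μ : Measure X) (U : L2 m ≃ₗᵢ[ℂ] Lp ℂ 2 μ) (h : X → ℝ),
    Measurable h ∧
    closure (Set.range fun f : 𝓢(Fin m → ℝ, ℂ) => ((f.toLp 2, (A f).toLp 2) : L2 m × L2 m)) =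
      {fg | ∀ᵐ s ∂μ, U fg.2 s = h s * U fg.1 s} ∧
    ∀ f : L2 m, ∀ᵐ s ∂μ, U (B f) s = φ (h s) * U f s

/-- The operator `φ(A)`, for an operator `A` that is essentially self-adjoint on the Schwartz space
and for a bounded Borel function `φ` on `ℝ`. -/
def functionOf {m : ℕ} (φ : ℝ → ℂ) (A : Module.End ℂ 𝓢(Fin m → ℝ, ℂ)) : L2 m →L[ℂ] L2 m :=
  Classical.epsilon (IsFunctionOf φ A)

/-! ### Operators acting on some of the variables -/

/-- The function `y ↦ f(x')`, where `x'` is the point `x` with the coordinates numbered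
`ι 0, …, ι (k - 1)` replaced by `y 0, …, y (k - 1)`, as an element of `L²(ℝᵏ)`. For `f` in `L²(ℝᵐ)`
and `ι` injective it is square integrable for almost every `x`. -/
def sliceLp {k m : ℕ} (ι : Fin k → Fin m) (f : (Fin m → ℝ) → ℂ) (x : Fin m → ℝ) : L2 k :=
  open Classical in
  if h : MemLp (fun y : Fin k → ℝ => f (Function.extend ι y x)) 2 volume then h.toLp else 0

/-- `B` is the operator on `L²(ℝᵐ)` that acts on the variables numbered `ι 0, …, ι (k - 1)` as the
operator `b` on `L²(ℝᵏ)` does, and identically on the others: `B f`, as a function of these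
variables with the others fixed, is the image under `b` of `f` as a function of these variables. -/
def IsActingOn {k m : ℕ} (ι : Fin k → Fin m) (b : L2 k →L[ℂ] L2 k) (B : L2 m →L[ℂ] L2 m) : Prop :=
  ∀ f : L2 m, ∀ᵐ x : Fin m → ℝ, ∀ᵐ y : Fin k → ℝ,
    B f (Function.extend ι y x) = b (sliceLp ι f x) y

/-- The operator `b_{i₁ … i_k}` on `L²(ℝᵐ)`, for an operator `b` on `L²(ℝᵏ)` and distinct indices
`i₁ = ι 0, …, i_k = ι (k - 1)`. -/
def actOn {k m : ℕ} (ι : Fin k → Fin m) (b : L2 k →L[ℂ] L2 k) : L2 m →L[ℂ] L2 m :=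
  Classical.epsilon (IsActingOn ι b)

theorem measurePreserving_comp_perm {m : ℕ} (σ : Equiv.Perm (Fin m)) :
    MeasurePreserving (fun x : Fin m → ℝ => fun i => x (σ i)) volume volume := by
  have h := volume_measurePreserving_piCongrLeft (fun _ : Fin m => ℝ) σ.symm
  convert h using 1
  funext x i
  have := Equiv.piCongrLeft_apply_apply (fun _ : Fin m => ℝ) σ.symm x (σ i)
  rw [MeasurableEquiv.coe_piCongrLeft]
  simpa using this.symm

/-- The permutation operator `P_σ f(…, x_i, …) = f(…, x_{σ(i)}, …)` on `L²(ℝᵐ)`. -/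
def permOp {m : ℕ} (σ : Equiv.Perm (Fin m)) : L2 m →L[ℂ] L2 m :=
  (Lp.compMeasurePreservingₗᵢ ℂ _ (measurePreserving_comp_perm σ)).toContinuousLinearMap

/-! ### The operators `R` and `T` -/

/-- `R` is given on the dense subspace `L¹(ℝ) ∩ L²(ℝ)` of `L²(ℝ)` by
`R f(x) = exp(i x²/4π - iπ/12) ∫ f(y) exp(i x y/2π) dy/2π`. -/
def IsRotation (R : L2 1 →L[ℂ] L2 1) : Prop :=
  ∀ f : L2 1, Integrable f volume → ∀ᵐ x : Fin 1 → ℝ,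
    R f x = cexp (I * (x 0) ^ 2 / (4 * Real.pi) - I * Real.pi / 12) *
      ∫ y : Fin 1 → ℝ, f y * cexp (I * x 0 * y 0 / (2 * Real.pi)) / (2 * Real.pi)

/-- The operator `R` on `L²(ℝ)`. -/
def rotOp : L2 1 →L[ℂ] L2 1 := Classical.epsilon IsRotation

/-- The operator `T = exp(i p₁ q₂ / 2π) ψ(q₁ + p₂ - q₂)` on `L²(ℝ²)`. (The two variables, numbered
`1, 2` in this formula, are numbered `0, 1` in the code.) -/
def tOp (lam : ℝ) : L2 2 →L[ℂ] L2 2 :=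
  functionOf (fun s => cexp (I / (2 * Real.pi) * s)) (pOp 0 * qOp 1) *
    functionOf (qdilog lam) (qOp 0 + pOp 1 - qOp 1)

end

noncomputable section

set_option linter.unusedSectionVars false

/-! ### Multiplication operators -/

section Multiplication

variable {X : Type*} [MeasurableSpace X] {μ : Measure X}

/-! Write `F` for the Fourier transform with kernel `exp(ixy/2π)`, `K` for multiplication by
`exp(ix²/4π)`, so that `R` is a phase times `KF`. Conjugation by `R` is a linear substitution of
order three in `q`, `p` with `q ↦ p - q`. Hence `ψ(q₁ + p₂ - q₂) = R₂ Φ R₂⁻¹`, where `Φ` multiplies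
by `ψ(x₁ + x₂)`, and `exp(ip₁q₂/2π)` is the shear `S f(x₁, x₂) = f(x₁ + x₂, x₂)`. Both are justified
for the functional calculus by an explicit diagonalisation through the operator `metaU`, which
preserves the Schwartz space, together with a uniqueness theorem for the calculus.

The decisive identity is `R₁ S R₂ = C Q` with `Q = R₁R₂` and `C` the multiplication by
`exp(-ix₁x₂/2π)`; its right side is symmetric in the two variables. Thus `T₁₂ = R₁⁻¹ C Q Φ R₂⁻¹` and
`T₂₁ = R₂⁻¹ C Q Φ R₁⁻¹`, and the relation expressing `T₁₂` by `T₂₁` is read off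
(`transU_inversion`).

For the other relation (`transU_symmetry`), `R³ = 1` reduces `T₁₂ R₁ T₂₁ R₁⁻¹` to `R₁⁻¹ C Q Φ (Q C
Q) Φ R₁`. Passing `Φ` through `Q C Q` reverses the sign of the argument
(`rotBoth_crossU_rotBoth_mul_sumU`), so that only `ψ(s)ψ(-s)` survives. By the inversion formula
this is a constant times an inverse chirp `E`, whence all dependence on `ψ` beyond that constant
disappears. What remains is the braid relation for `C Q E Q C` (`rotBoth_braid`), an identity
between shears, reflections and Fourier transforms.

That `R³ = 1` is checked on Gaussians, whose width parameter runs through a cycle of length three.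
The inversion formula holds because the sum of the two integrands is odd in `z`: its integral over
the raised line is `-iπ` times the residue at `0`, half of a full turn. Oddness under conjugation
makes the exponent of `ψ` imaginary, so `|ψ| = 1`, which gives unitarity of `T`.

Finally, letting operators act on selected variables is a group homomorphism compatible with
composition of index maps, so everything on `L²(ℝᵐ)` follows from the case of two variables. -/

theorem memLp_mul_of_norm_le {φ : X → ℂ} {C : ℝ} (hm : AEStronglyMeasurable φ μ)
    (hC : ∀ x, ‖φ x‖ ≤ C) (f : Lp ℂ 2 μ) : MemLp (fun x => φ x * f x) 2 μ := by
  refine MemLp.of_le_mul (c := C) (Lp.memLp f) (hm.mul (Lp.aestronglyMeasurable f)) ?_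
  filter_upwards with x
  rw [norm_mul]
  exact mul_le_mul_of_nonneg_right (hC x) (norm_nonneg _)

/-- Multiplication by a bounded function, as a bounded operator on `L²(μ)`. -/
def mulLp (μ : Measure X) (φ : X → ℂ) (C : ℝ) (hm : Measurable φ) (hC : ∀ x, ‖φ x‖ ≤ C) :
    Lp ℂ 2 μ →L[ℂ] Lp ℂ 2 μ :=
  LinearMap.mkContinuous
    { toFun := fun f => (memLp_mul_of_norm_le hm.aestronglyMeasurable hC f).toLp
      map_add' := fun f g => by
        apply Lp.ext
        filter_upwards [(memLp_mul_of_norm_le hm.aestronglyMeasurable hC (f + g)).coeFn_toLp,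
          (memLp_mul_of_norm_le hm.aestronglyMeasurable hC f).coeFn_toLp,
          (memLp_mul_of_norm_le hm.aestronglyMeasurable hC g).coeFn_toLp,
          Lp.coeFn_add f g, Lp.coeFn_add (memLp_mul_of_norm_le hm.aestronglyMeasurable hC f).toLp
            (memLp_mul_of_norm_le hm.aestronglyMeasurable hC g).toLp] with x h1 h2 h3 h4 h5
        rw [h5, Pi.add_apply, h1, h2, h3, h4, Pi.add_apply, mul_add]
      map_smul' := fun c f => by
        apply Lp.ext
        filter_upwards [(memLp_mul_of_norm_le hm.aestronglyMeasurable hC (c • f)).coeFn_toLp,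
          (memLp_mul_of_norm_le hm.aestronglyMeasurable hC f).coeFn_toLp,
          Lp.coeFn_smul c f, Lp.coeFn_smul c
            (memLp_mul_of_norm_le hm.aestronglyMeasurable hC f).toLp] with x h1 h2 h3 h4
        rw [RingHom.id_apply, h4, Pi.smul_apply, h1, h2, h3, Pi.smul_apply, smul_eq_mul,
          smul_eq_mul, mul_left_comm] }
    C fun f => by
      refine Lp.norm_le_mul_norm_of_ae_le_mul ?_
      filter_upwards [(memLp_mul_of_norm_le hm.aestronglyMeasurable hC f).coeFn_toLp] with x h1
      rw [LinearMap.coe_mk, AddHom.coe_mk, h1, norm_mul]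
      exact mul_le_mul_of_nonneg_right (hC x) (norm_nonneg _)

theorem mulLp_ae {φ : X → ℂ} {C : ℝ} (hm : Measurable φ) (hC : ∀ x, ‖φ x‖ ≤ C) (f : Lp ℂ 2 μ) :
    ∀ᵐ x ∂μ, mulLp μ φ C hm hC f x = φ x * f x :=
  (memLp_mul_of_norm_le hm.aestronglyMeasurable hC f).coeFn_toLp

/-- Multiplication by a unimodular function, as a unitary operator on `L²(μ)`. -/
def mulU (μ : Measure X) (φ : X → ℂ) (hm : Measurable φ) (h1 : ∀ x, ‖φ x‖ = 1) :
    Lp ℂ 2 μ ≃ₗᵢ[ℂ] Lp ℂ 2 μ where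
  toLinearEquiv := LinearEquiv.ofLinearMap
    (mulLp μ φ 1 hm fun x => (h1 x).le).toLinearMap
    (mulLp μ (fun x => (φ x)⁻¹) 1 hm.inv fun x => by rw [norm_inv, h1, inv_one]).toLinearMap
    (by
      refine LinearMap.ext fun f => Lp.ext ?_
      filter_upwards [mulLp_ae hm (fun x => (h1 x).le)
          (mulLp μ (fun x => (φ x)⁻¹) 1 hm.inv (fun x => by rw [norm_inv, h1, inv_one]) f),
        mulLp_ae hm.inv (fun x => by rw [Pi.inv_apply, norm_inv, h1, inv_one]) f] with x h2 h3
      have h0 : φ x ≠ 0 := fun h => by simpa [h] using h1 x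
      refine h2.trans ?_
      refine (congrArg _ h3).trans ?_
      simp [h0])
    (by
      refine LinearMap.ext fun f => Lp.ext ?_
      filter_upwards [mulLp_ae hm (fun x => (h1 x).le) f,
        mulLp_ae hm.inv (fun x => by rw [Pi.inv_apply, norm_inv, h1, inv_one])
          (mulLp μ φ 1 hm (fun x => (h1 x).le) f)] with x h2 h3
      have h0 : φ x ≠ 0 := fun h => by simpa [h] using h1 x
      refine h3.trans ?_
      rw [h2]
      simp [h0])
  norm_map' f := by
    refine le_antisymm (Lp.norm_le_norm_of_ae_le ?_) (Lp.norm_le_norm_of_ae_le ?_) <;>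
    filter_upwards [mulLp_ae hm (fun x => (h1 x).le) f] with x h2
    · refine (congrArg _ h2).le.trans ?_
      rw [norm_mul, h1, one_mul]
    · refine le_trans ?_ (congrArg _ h2).ge
      rw [norm_mul, h1, one_mul]

theorem mulU_ae {φ : X → ℂ} (hm : Measurable φ) (h1 : ∀ x, ‖φ x‖ = 1) (f : Lp ℂ 2 μ) :
    ∀ᵐ x ∂μ, mulU μ φ hm h1 f x = φ x * f x :=
  mulLp_ae hm (fun x => (h1 x).le) f

theorem mulU_congr {φ χ : X → ℂ} (hm : Measurable φ) (h1 : ∀ x, ‖φ x‖ = 1) (h : φ = χ) :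
    mulU μ φ hm h1 = mulU μ χ (h ▸ hm) (h ▸ h1) := by
  subst h; rfl

theorem mulU_mul {φ χ : X → ℂ} (hφ : Measurable φ) (h1 : ∀ x, ‖φ x‖ = 1) (hχ : Measurable χ)
    (h2 : ∀ x, ‖χ x‖ = 1) :
    mulU μ φ hφ h1 * mulU μ χ hχ h2 =
      mulU μ (fun x => φ x * χ x) (hφ.mul hχ) (fun x => by rw [norm_mul, h1, h2, one_mul]) := by
  ext1 f
  apply Lp.ext
  filter_upwards [mulU_ae hφ h1 (mulU μ χ hχ h2 f), mulU_ae hχ h2 f,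
    mulU_ae (hφ.mul hχ) (fun x => by rw [Pi.mul_apply, norm_mul, h1, h2, one_mul]) f] with x a b c
  refine a.trans ?_
  rw [b, ← mul_assoc]
  exact c.symm

theorem mulU_comm {φ χ : X → ℂ} (hφ : Measurable φ) (h1 : ∀ x, ‖φ x‖ = 1) (hχ : Measurable χ)
    (h2 : ∀ x, ‖χ x‖ = 1) :
    mulU μ φ hφ h1 * mulU μ χ hχ h2 = mulU μ χ hχ h2 * mulU μ φ hφ h1 := by
  rw [mulU_mul, mulU_mul]
  exact mulU_congr _ _ (funext fun x => mul_comm _ _)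

/-- A scalar of modulus one, as a unitary operator on `L²(μ)`. -/
def scalarU (μ : Measure X) (c : ℂ) (hc : ‖c‖ = 1) : Lp ℂ 2 μ ≃ₗᵢ[ℂ] Lp ℂ 2 μ :=
  mulU μ (fun _ => c) measurable_const fun _ => hc

theorem scalarU_apply {c : ℂ} (hc : ‖c‖ = 1) (f : Lp ℂ 2 μ) : scalarU μ c hc f = c • f := by
  apply Lp.ext
  filter_upwards [mulU_ae (φ := fun _ : X => c) measurable_const (fun _ => hc) f,
    Lp.coeFn_smul c f] with x h1 h2
  exact h1.trans h2.symm

theorem scalarU_comm {c : ℂ} (hc : ‖c‖ = 1) (V : Lp ℂ 2 μ ≃ₗᵢ[ℂ] Lp ℂ 2 μ) :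
    scalarU μ c hc * V = V * scalarU μ c hc := by
  ext1 f
  simp [LinearIsometryEquiv.coe_mul, scalarU_apply]

end Multiplication

/-! ### Uniqueness of functions of an operator -/

section SpectralMeasure

variable {X : Type*} [MeasurableSpace X] {μ : Measure X}

/-- The spectral measure of `u ∈ L²(μ)` for the operator of multiplication by `h`. -/
def spectralMeasure (h : X → ℝ) (u : Lp ℂ 2 μ) : Measure ℝ :=
  (μ.withDensity fun s => ((‖u s‖₊ ^ 2 : NNReal) : ℝ≥0∞)).map h

theorem isFiniteMeasure_spectralMeasure (h : X → ℝ) (u : Lp ℂ 2 μ) :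
    IsFiniteMeasure (spectralMeasure h u) := by
  have : IsFiniteMeasure (μ.withDensity fun s => ((‖u s‖₊ ^ 2 : NNReal) : ℝ≥0∞)) := by
    apply isFiniteMeasure_withDensity
    have := (Lp.memLp u).eLpNorm_lt_top
    rw [eLpNorm_lt_top_iff_lintegral_rpow_enorm_lt_top (by norm_num) (by norm_num)] at this
    refine (lt_of_le_of_lt (le_of_eq ?_) this).ne
    refine lintegral_congr fun s => ?_
    simp [enorm]
  exact Measure.isFiniteMeasure_map _ h

/-- Pushing the density `|u|²` forward along `h` turns `⟨u, φ(h) u⟩` into an integral over the line,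
so all functions of the operator are seen through one measure for each vector. -/
theorem integral_spectralMeasure {h : X → ℝ} (hh : Measurable h) {φ : ℝ → ℂ} (hφ : Measurable φ)
    {u v : Lp ℂ 2 μ} (huv : ∀ᵐ s ∂μ, v s = φ (h s) * u s) :
    ∫ t, φ t ∂(spectralMeasure h u) = inner ℂ u v := by
  rw [spectralMeasure, integral_map hh.aemeasurable hφ.aestronglyMeasurable,
    integral_withDensity_eq_integral_smul₀
      ((Lp.aestronglyMeasurable u).nnnorm.aemeasurable.pow_const 2), L2.inner_def]
  refine integral_congr_ae ?_
  filter_upwards [huv] with s hs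
  rw [hs, NNReal.smul_def, RCLike.inner_apply, mul_assoc, Complex.mul_conj, Complex.real_smul,
    Complex.normSq_eq_norm_sq, mul_comm]
  simp

end SpectralMeasure

section Uniqueness

open BoundedContinuousFunction

variable {H : Type*} [NormedAddCommGroup H] [InnerProductSpace ℂ H]
  {X : Type*} [MeasurableSpace X] {μ : Measure X} {X' : Type*} [MeasurableSpace X'] {μ' : Measure X'}

/-- `B` is the multiplication by `φ ∘ h` in the representation `U`. -/
def IsMulBy (U : H ≃ₗᵢ[ℂ] Lp ℂ 2 μ) (h : X → ℝ) (φ : ℝ → ℂ) (B : H →L[ℂ] H) : Prop :=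
  ∀ f, ∀ᵐ s ∂μ, U (B f) s = φ (h s) * U f s

namespace IsMulBy

variable {U : H ≃ₗᵢ[ℂ] Lp ℂ 2 μ} {h : X → ℝ} {φ χ : ℝ → ℂ} {B D : H →L[ℂ] H}

theorem mul (h1 : IsMulBy U h φ B) (h2 : IsMulBy U h χ D) :
    IsMulBy U h (fun s => φ s * χ s) (B * D) := fun f => by
  filter_upwards [h1 (D f), h2 f] with s a b
  rw [mul_apply_eq_comp, a, b, mul_assoc]

theorem add (h1 : IsMulBy U h φ B) (h2 : IsMulBy U h χ D) :
    IsMulBy U h (fun s => φ s + χ s) (B + D) := fun f => by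
  filter_upwards [h1 f, h2 f, Lp.coeFn_add (U (B f)) (U (D f))] with s a b c
  rw [_root_.add_apply, map_add, c, Pi.add_apply, a, b, add_mul]

theorem const (c : ℂ) : IsMulBy U h (fun _ => c) (c • (1 : H →L[ℂ] H)) := fun f => by
  filter_upwards [Lp.coeFn_smul c (U f)] with s a
  simpa using a

theorem star [CompleteSpace H] (hh : Measurable h) (hφ : Measurable φ) (h1 : IsMulBy U h φ B) :
    IsMulBy U h (fun s => starRingEnd ℂ (φ s)) (ContinuousLinearMap.adjoint B) := fun f => by
  have key : ∀ v : Lp ℂ 2 μ, (∀ᵐ s ∂μ, v s = starRingEnd ℂ (φ (h s)) * U f s) →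
      U (ContinuousLinearMap.adjoint B f) = v := by
    intro v hv
    refine ext_inner_right ℂ fun w => ?_
    obtain ⟨g, rfl⟩ := U.surjective w
    rw [U.inner_map_map, ContinuousLinearMap.adjoint_inner_left, ← U.inner_map_map, L2.inner_def,
      L2.inner_def]
    refine integral_congr_ae ?_
    filter_upwards [hv, h1 g] with s a b
    rw [a, b]
    simp only [RCLike.inner_apply, map_mul, Complex.conj_conj]
    ring
  have hmem : MemLp (fun s => starRingEnd ℂ (φ (h s)) * U f s) 2 μ := by
    refine MemLp.of_le (Lp.memLp (U (B f))) ?_ ?_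
    · exact (Complex.continuous_conj.measurable.comp (hφ.comp hh)).aestronglyMeasurable.mul
        (Lp.aestronglyMeasurable _)
    · filter_upwards [h1 f] with s a
      rw [a]
      simp
  rw [key _ hmem.coeFn_toLp]
  exact hmem.coeFn_toLp

theorem inner_eq (hh : Measurable h) (hφ : Measurable φ) (h1 : IsMulBy U h φ B) (f : H) :
    inner ℂ f (B f) = ∫ t, φ t ∂(spectralMeasure h (U f)) := by
  rw [integral_spectralMeasure hh hφ (h1 f), U.inner_map_map]

end IsMulBy

theorem measurable_inv_add_I : Measurable fun s : ℝ => ((s : ℂ) + I)⁻¹ :=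
  (Complex.measurable_ofReal.add_const I).inv

theorem ofReal_add_I_ne_zero (s : ℝ) : (s : ℂ) + I ≠ 0 := fun h => by
  simpa using congrArg Complex.im h

theorem norm_resolvent_le (s : ℝ) : ‖((s : ℂ) + I)⁻¹‖ ≤ 1 := by
  rw [norm_inv]
  refine inv_le_one_of_one_le₀ ?_
  have := Complex.abs_im_le_norm ((s : ℂ) + I)
  simpa using this

/-- The resolvent `s ↦ (s + i)⁻¹` as a bounded continuous function. -/
def resolventBCF : ℝ →ᵇ ℂ :=
  BoundedContinuousFunction.ofNormedAddCommGroup (fun s : ℝ => ((s : ℂ) + I)⁻¹)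
    ((Complex.continuous_ofReal.add continuous_const).inv₀ ofReal_add_I_ne_zero) 1 norm_resolvent_le

variable {U : H ≃ₗᵢ[ℂ] Lp ℂ 2 μ} {h : X → ℝ} {U' : H ≃ₗᵢ[ℂ] Lp ℂ 2 μ'} {h' : X' → ℝ}

/-- Two multiplication representations of the same operator have a common resolvent. -/
theorem exists_common_resolvent (hh : Measurable h)
    (hgraph : ∀ f g : H, (∀ᵐ s ∂μ, U g s = h s * U f s) → ∀ᵐ s ∂μ', U' g s = h' s * U' f s) :
    ∃ B : H →L[ℂ] H, IsMulBy U h resolventBCF B ∧ IsMulBy U' h' resolventBCF B := by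
  let M := mulLp μ (fun s => ((h s : ℂ) + I)⁻¹) 1 (measurable_inv_add_I.comp hh)
    fun s => norm_resolvent_le _
  let B : H →L[ℂ] H := U.symm.toContinuousLinearEquiv.toContinuousLinearMap ∘L M ∘L
    U.toContinuousLinearEquiv.toContinuousLinearMap
  have hB : ∀ f, ∀ᵐ s ∂μ, U (B f) s = ((h s : ℂ) + I)⁻¹ * U f s := fun f => by
    have : U (B f) = M (U f) := by simp [B]
    rw [this]
    exact mulLp_ae _ _ _
  -- Since `(A + i) B f = f`, the pair `(B f, f - i B f)` lies in the first graph. Being also in the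
  -- second, it forces `B` to be the resolvent there too.
  refine ⟨B, hB, fun f => ?_⟩
  have h1 : ∀ᵐ s ∂μ, U (f - I • B f) s = h s * U (B f) s := by
    rw [map_sub, map_smul]
    filter_upwards [hB f, Lp.coeFn_sub (U f) (I • U (B f)), Lp.coeFn_smul I (U (B f))] with s a b c
    rw [b, Pi.sub_apply, c, Pi.smul_apply, a, smul_eq_mul]
    field_simp [ofReal_add_I_ne_zero (h s)]
    ring
  have h2 := hgraph _ _ h1
  rw [map_sub, map_smul] at h2
  filter_upwards [h2, Lp.coeFn_sub (U' f) (I • U' (B f)), Lp.coeFn_smul I (U' (B f))] with s a b c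
  rw [b, Pi.sub_apply, c, Pi.smul_apply, smul_eq_mul] at a
  change _ = ((h' s : ℂ) + I)⁻¹ * _
  rw [eq_inv_mul_iff_mul_eq₀ (ofReal_add_I_ne_zero _)]
  linear_combination -a

/-- The bounded continuous functions represented by one common operator in both pictures form a star
algebra. It contains the resolvent, which is injective on the line, so it separates points and
therefore separates finite measures. -/
theorem spectralMeasure_eq [CompleteSpace H] (hh : Measurable h) (hh' : Measurable h')
    (hgraph : ∀ f g : H, (∀ᵐ s ∂μ, U g s = h s * U f s) → ∀ᵐ s ∂μ', U' g s = h' s * U' f s)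
    (f : H) : spectralMeasure h (U f) = spectralMeasure h' (U' f) := by
  have := isFiniteMeasure_spectralMeasure h (U f)
  have := isFiniteMeasure_spectralMeasure h' (U' f)
  let A : StarSubalgebra ℂ (ℝ →ᵇ ℂ) :=
    { carrier := {g | ∃ B : H →L[ℂ] H, IsMulBy U h g B ∧ IsMulBy U' h' g B}
      mul_mem' := fun ⟨B, hB⟩ ⟨D, hD⟩ => ⟨B * D, hB.1.mul hD.1, hB.2.mul hD.2⟩
      add_mem' := fun ⟨B, hB⟩ ⟨D, hD⟩ => ⟨B + D, hB.1.add hD.1, hB.2.add hD.2⟩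
      algebraMap_mem' := fun c => ⟨c • 1, IsMulBy.const c, IsMulBy.const c⟩
      star_mem' := fun {g} ⟨B, hB⟩ => ⟨ContinuousLinearMap.adjoint B,
        hB.1.star hh g.continuous.measurable, hB.2.star hh' g.continuous.measurable⟩ }
  refine ext_of_forall_mem_subalgebra_integral_eq_of_pseudoEMetric_complete_countable (A := A)
    (𝕜 := ℂ) ?_ ?_
  · intro x y hxy
    refine ⟨_, ⟨_, ⟨resolventBCF, exists_common_resolvent hh hgraph, rfl⟩, rfl⟩, ?_⟩
    intro heq
    apply hxy
    have heq' : ((x : ℂ) + I)⁻¹ = ((y : ℂ) + I)⁻¹ := heq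
    simpa using heq'
  · rintro g ⟨B, hB1, hB2⟩
    rw [← hB1.inner_eq hh g.continuous.measurable, ← hB2.inner_eq hh' g.continuous.measurable]

/-- Equal spectral measures give equal quadratic forms, and over `ℂ` these determine the operator.
Only measurability of `φ` enters, not continuity. -/
theorem IsMulBy.unique [CompleteSpace H] (hh : Measurable h) (hh' : Measurable h')
    (hgraph : ∀ f g : H, (∀ᵐ s ∂μ, U g s = h s * U f s) → ∀ᵐ s ∂μ', U' g s = h' s * U' f s)
    {φ : ℝ → ℂ} (hφ : Measurable φ) {B D : H →L[ℂ] H} (hB : IsMulBy U h φ B)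
    (hD : IsMulBy U' h' φ D) : B = D := by
  apply ContinuousLinearMap.coe_injective
  rw [← ext_inner_map]
  intro f
  rw [← inner_conj_symm, ← inner_conj_symm ((D : H →ₗ[ℂ] H) f)]
  congr 1
  change inner ℂ f (B f) = inner ℂ f (D f)
  rw [hB.inner_eq hh hφ, hD.inner_eq hh' hφ, spectralMeasure_eq hh hh' hgraph f]

end Uniqueness

theorem IsFunctionOf.unique {m : ℕ} {φ : ℝ → ℂ} (hφ : Measurable φ)
    {A : Module.End ℂ 𝓢(Fin m → ℝ, ℂ)} {B D : L2 m →L[ℂ] L2 m} (hB : IsFunctionOf φ A B)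
    (hD : IsFunctionOf φ A D) : B = D := by
  obtain ⟨X, _, μ, U, h, hh, hcl, hB⟩ := hB
  obtain ⟨X', _, μ', U', h', hh', hcl', hD⟩ := hD
  refine IsMulBy.unique hh hh' (fun f g hfg => ?_) hφ hB hD
  have : (f, g) ∈ {fg : L2 m × L2 m | ∀ᵐ s ∂μ, U fg.2 s = h s * U fg.1 s} := hfg
  rw [← hcl, hcl'] at this
  exact this

/-- Uniqueness makes the arbitrary choice of `Classical.epsilon` harmless: any explicit candidate is
the value. -/
theorem functionOf_eq {m : ℕ} {φ : ℝ → ℂ} (hφ : Measurable φ)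
    {A : Module.End ℂ 𝓢(Fin m → ℝ, ℂ)} {B : L2 m →L[ℂ] L2 m} (hB : IsFunctionOf φ A B) :
    functionOf φ A = B :=
  (Classical.epsilon_spec (p := IsFunctionOf φ A) ⟨B, hB⟩).unique hφ hB

/-! ### Existence of functions of an operator -/

section Existence

variable {X : Type*} [MeasurableSpace X] {μ : Measure X}

theorem norm_ofReal_mul_resolvent_le (s : ℝ) : ‖(s : ℂ) * ((s : ℂ) + I)⁻¹‖ ≤ 1 := by
  rw [norm_mul, norm_inv, ← div_eq_mul_inv]
  refine div_le_one_of_le₀ ?_ (norm_nonneg _)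
  have := Complex.abs_re_le_norm ((s : ℂ) + I)
  simpa using this

/-- Dividing `g = h f` by `h + i` rewrites the unbounded relation as an equality between two bounded
multiplication operators. -/
theorem isClosed_graph_mul {H : Type*} [NormedAddCommGroup H] [InnerProductSpace ℂ H]
    (U : H ≃ₗᵢ[ℂ] Lp ℂ 2 μ) {h : X → ℝ} (hh : Measurable h) :
    IsClosed {fg : H × H | ∀ᵐ s ∂μ, U fg.2 s = h s * U fg.1 s} := by
  let M := mulLp μ (fun s => ((h s : ℂ) + I)⁻¹) 1 (measurable_inv_add_I.comp hh)
    fun s => norm_resolvent_le _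
  let N := mulLp μ (fun s => (h s : ℂ) * ((h s : ℂ) + I)⁻¹) 1
    ((Complex.measurable_ofReal.comp hh).mul (measurable_inv_add_I.comp hh))
    fun s => norm_ofReal_mul_resolvent_le _
  have : {fg : H × H | ∀ᵐ s ∂μ, U fg.2 s = h s * U fg.1 s} =
      {fg : H × H | M (U fg.2) = N (U fg.1)} := by
    ext ⟨f, g⟩
    have hM := mulLp_ae (measurable_inv_add_I.comp hh) (fun s => norm_resolvent_le _) (U g)
    have hN := mulLp_ae ((Complex.measurable_ofReal.comp hh).mul (measurable_inv_add_I.comp hh))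
      (fun s => norm_ofReal_mul_resolvent_le _) (U f)
    constructor
    · intro hfg
      apply Lp.ext
      filter_upwards [hM, hN, hfg] with s a b c
      refine a.trans ?_
      refine Eq.trans ?_ b.symm
      simp only [Function.comp_apply, Pi.mul_apply] at *
      rw [c]
      ring
    · intro hfg
      have hfg' : ∀ᵐ s ∂μ, M (U g) s = N (U f) s := by
        rw [show M (U g) = N (U f) from hfg]; exact Filter.Eventually.of_forall fun _ => rfl
      filter_upwards [hM, hN, hfg'] with s a b c
      have d := (a.symm.trans c).trans b
      simp only [Function.comp_apply, Pi.mul_apply] at d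
      field_simp [ofReal_add_I_ne_zero (h s)] at d
      exact d
  rw [this]
  exact isClosed_eq (M.continuous.comp (U.continuous.comp continuous_snd))
    (N.continuous.comp (U.continuous.comp continuous_fst))

/-- A vector `(a, b)` orthogonal to all pairs `(u, h u)` with `u` Schwartz satisfies `ā + h b̄ = 0`
as a distribution, hence almost everywhere; compactly supported smooth `u` suffice. -/
theorem ae_eq_zero_of_forall_schwartz {m : ℕ} {h : (Fin m → ℝ) → ℝ} (hh : Continuous h)
    {a b : L2 m} (hab : ∀ u w : 𝓢(Fin m → ℝ, ℂ), (∀ x, w x = h x * u x) →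
      inner ℂ a (u.toLp 2) + inner ℂ b (w.toLp 2) = 0)
    (hw : ∀ u : 𝓢(Fin m → ℝ, ℂ), ∃ w : 𝓢(Fin m → ℝ, ℂ), ∀ x, w x = h x * u x) :
    ∀ᵐ s, starRingEnd ℂ (a s) + h s * starRingEnd ℂ (b s) = 0 := by
  have hint : ∀ {w z : L2 m}, Integrable (fun s => inner ℂ (w s) (z s)) volume :=
    fun {w z} => L2.integrable_inner w z
  have hloc : ∀ w : L2 m, LocallyIntegrable (fun s => starRingEnd ℂ (w s)) volume := fun w =>
    ((Lp.memLp w).star).locallyIntegrable one_le_two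
  refine ae_eq_zero_of_integral_contDiff_smul_eq_zero ((hloc _).add ?_) ?_
  · rw [locallyIntegrable_iff]
    intro k hk
    exact ((hloc b).integrableOn_isCompact hk).continuousOn_mul
      (Complex.continuous_ofReal.comp hh).continuousOn hk
  · intro φ hφ hφc
    let u : 𝓢(Fin m → ℝ, ℂ) := HasCompactSupport.toSchwartzMap (f := fun x => (φ x : ℂ))
      (hφc.comp_left (g := Complex.ofReal) rfl) (Complex.ofRealCLM.contDiff.comp hφ)
    obtain ⟨w, hw⟩ := hw u
    have hu := hab u w hw
    rw [L2.inner_def, L2.inner_def, ← integral_add hint hint] at hu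
    rw [← hu]
    refine integral_congr_ae ?_
    filter_upwards [SchwartzMap.coeFn_toLp u 2, SchwartzMap.coeFn_toLp w 2] with s h3 h4
    rw [h3, h4, hw]
    have : u s = (φ s : ℂ) := rfl
    simp only [RCLike.inner_apply, this, Complex.real_smul]
    ring

/-- The double orthogonal complement is the closure. The argument runs in the Hilbert sum `WithLp
2`, because the plain product carries the sup norm; the topologies agree. -/
theorem mem_closure_range_prod {D H : Type*} [AddCommGroup D] [Module ℂ D] [NormedAddCommGroup H]
    [InnerProductSpace ℂ H] [CompleteSpace H] (S T : D →ₗ[ℂ] H) (f g : H)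
    (hfg : ∀ a b : H, (∀ d, inner ℂ a (S d) + inner ℂ b (T d) = 0) →
      inner ℂ a f + inner ℂ b g = 0) :
    (f, g) ∈ closure (Set.range fun d => (S d, T d)) := by
  let W : D →ₗ[ℂ] WithLp 2 (H × H) :=
    (WithLp.linearEquiv 2 ℂ (H × H)).symm.toLinearMap ∘ₗ (S.prod T)
  have key : WithLp.toLp 2 (f, g) ∈ (LinearMap.range W).topologicalClosure := by
    rw [← Submodule.orthogonal_orthogonal_eq_closure, Submodule.mem_orthogonal]
    intro ab hab
    rw [Submodule.mem_orthogonal'] at hab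
    rw [WithLp.prod_inner_apply]
    refine hfg ab.fst ab.snd fun d => ?_
    have := hab (W d) ⟨d, rfl⟩
    rwa [WithLp.prod_inner_apply] at this
  refine map_mem_closure (f := WithLp.ofLp) (WithLp.prod_continuous_ofLp 2 _ _) key ?_
  rintro _ ⟨w, rfl⟩
  exact ⟨w, rfl⟩

/-- This is the essential self-adjointness: since `v` maps the Schwartz space onto itself, a vector
orthogonal to the graph of `A` satisfies `conj (V a) + h conj (V b) = 0`, and so is orthogonal to
the maximal graph as well. -/
theorem graph_mul_subset_closure {m : ℕ} (V : L2 m ≃ₗᵢ[ℂ] L2 m)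
    (v : 𝓢(Fin m → ℝ, ℂ) ≃ₗ[ℂ] 𝓢(Fin m → ℝ, ℂ)) (hv : ∀ f, V (f.toLp 2) = (v f).toLp 2)
    {A : Module.End ℂ 𝓢(Fin m → ℝ, ℂ)} {h : (Fin m → ℝ) → ℝ} (hh : Continuous h)
    (hA : ∀ f x, v (A f) x = h x * v f x) :
    {fg : L2 m × L2 m | ∀ᵐ s, V fg.2 s = h s * V fg.1 s} ⊆
      closure (Set.range fun f : 𝓢(Fin m → ℝ, ℂ) =>
        ((f.toLp 2, (A f).toLp 2) : L2 m × L2 m)) := by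
  rintro ⟨f, g⟩ hfg
  let S : 𝓢(Fin m → ℝ, ℂ) →ₗ[ℂ] L2 m := (SchwartzMap.toLpCLM ℂ ℂ 2 volume).toLinearMap
  refine mem_closure_range_prod S (S ∘ₗ A) f g fun a b hab => ?_
  have h0 := ae_eq_zero_of_forall_schwartz hh (a := V a) (b := V b) (fun u w huw => by
      have hw : w = v (A (v.symm u)) := by
        ext x
        rw [huw, hA, v.apply_symm_apply]
      have hu : inner ℂ a ((v.symm u).toLp 2) + inner ℂ b ((A (v.symm u)).toLp 2) = 0 :=
        hab (v.symm u)
      rw [← V.inner_map_map a, ← V.inner_map_map b, hv (v.symm u), hv (A (v.symm u)),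
        v.apply_symm_apply] at hu
      rw [hw]
      exact hu)
    fun u => ⟨v (A (v.symm u)), fun x => by rw [hA, v.apply_symm_apply]⟩
  rw [← V.inner_map_map a, ← V.inner_map_map b, L2.inner_def, L2.inner_def,
    ← integral_add (L2.integrable_inner _ _) (L2.integrable_inner _ _)]
  refine integral_eq_zero_of_ae ?_
  filter_upwards [h0, hfg] with s h1 h2
  change V g s = _ * V f s at h2
  simp only [RCLike.inner_apply, h2, Pi.zero_apply]
  linear_combination (V f s) * h1

theorem isFunctionOf_of_lift {m : ℕ} (V : L2 m ≃ₗᵢ[ℂ] L2 m)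
    (v : 𝓢(Fin m → ℝ, ℂ) ≃ₗ[ℂ] 𝓢(Fin m → ℝ, ℂ)) (hv : ∀ f, V (f.toLp 2) = (v f).toLp 2)
    {A : Module.End ℂ 𝓢(Fin m → ℝ, ℂ)} {h : (Fin m → ℝ) → ℝ} (hh : Continuous h)
    (hA : ∀ f x, v (A f) x = h x * v f x) {φ : ℝ → ℂ} {B : L2 m →L[ℂ] L2 m}
    (hB : IsMulBy V h φ B) : IsFunctionOf φ A B := by
  refine ⟨_, _, volume, V, h, hh.measurable, subset_antisymm ?_ ?_, hB⟩
  · refine closure_minimal ?_ (isClosed_graph_mul V hh.measurable)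
    rintro _ ⟨f, rfl⟩
    change ∀ᵐ s, V ((A f).toLp 2) s = h s * V (f.toLp 2) s
    rw [hv, hv]
    filter_upwards [SchwartzMap.coeFn_toLp (v (A f)) 2, SchwartzMap.coeFn_toLp (v f) 2]
      with s h1 h2
    rw [h1, h2, hA]
  · exact graph_mul_subset_closure V v hv hh hA

end Existence

/-! ### Slices of square integrable functions on a product -/

section Slices

theorem Lp_enorm_sq {X : Type*} [MeasurableSpace X] {μ : Measure X} (f : Lp ℂ 2 μ) :
    ‖f‖ₑ ^ 2 = ∫⁻ x, ‖f x‖ₑ ^ 2 ∂μ := by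
  have := eLpNorm_nnreal_pow_eq_lintegral (f := f) (μ := μ) (p := 2) (by norm_num)
  simpa [Lp.enorm_def] using this

variable {W Y : Type*} [MeasurableSpace W] [MeasurableSpace Y] {ν : Measure W} {μ : Measure Y}

open Classical in
/-- The slice `y ↦ f (w, y)` as an element of `L²`. -/
def slice (μ : Measure Y) (f : W × Y → ℂ) (w : W) : Lp ℂ 2 μ :=
  if h : MemLp (fun y => f (w, y)) 2 μ then h.toLp else 0

theorem slice_ae {f : W × Y → ℂ} {w : W} (h : MemLp (fun y => f (w, y)) 2 μ) :
    ∀ᵐ y ∂μ, slice μ f w y = f (w, y) := by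
  rw [slice, dif_pos h]
  exact h.coeFn_toLp

variable [SFinite ν] [SFinite μ]

theorem memLp_slice (f : Lp ℂ 2 (ν.prod μ)) : ∀ᵐ w ∂ν, MemLp (fun y => f (w, y)) 2 μ := by
  have hm := Lp.stronglyMeasurable f
  have h := (memLp_two_iff_integrable_sq_norm hm.aestronglyMeasurable).1 (Lp.memLp f)
  filter_upwards [h.prod_right_ae] with w hw
  exact (memLp_two_iff_integrable_sq_norm
    (hm.comp_measurable measurable_prodMk_left).aestronglyMeasurable).2 hw

theorem slice_ae_ae (f : Lp ℂ 2 (ν.prod μ)) : ∀ᵐ w ∂ν, ∀ᵐ y ∂μ, slice μ f w y = f (w, y) := by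
  filter_upwards [memLp_slice f] with w hw
  exact slice_ae hw

theorem slice_congr {f : Lp ℂ 2 (ν.prod μ)} {g : W → Lp ℂ 2 μ}
    (h : ∀ᵐ w ∂ν, ∀ᵐ y ∂μ, f (w, y) = g w y) : ∀ᵐ w ∂ν, slice μ f w = g w := by
  filter_upwards [h, slice_ae_ae f] with w h1 h2
  apply Lp.ext
  filter_upwards [h1, h2] with y a b
  rw [b, a]

theorem slice_add (f g : Lp ℂ 2 (ν.prod μ)) :
    ∀ᵐ w ∂ν, slice μ (f + g : Lp ℂ 2 (ν.prod μ)) w = slice μ f w + slice μ g w := by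
  apply slice_congr
  filter_upwards [slice_ae_ae f, slice_ae_ae g, Measure.ae_ae_of_ae_prod (Lp.coeFn_add f g)]
    with w h1 h2 h3
  filter_upwards [h1, h2, h3, Lp.coeFn_add (slice μ f w) (slice μ g w)] with y a b c d
  rw [c, d, Pi.add_apply, Pi.add_apply, a, b]

theorem slice_smul (c : ℂ) (f : Lp ℂ 2 (ν.prod μ)) :
    ∀ᵐ w ∂ν, slice μ (c • f : Lp ℂ 2 (ν.prod μ)) w = c • slice μ f w := by
  apply slice_congr
  filter_upwards [slice_ae_ae f, Measure.ae_ae_of_ae_prod (Lp.coeFn_smul c f)] with w h1 h3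
  filter_upwards [h1, h3, Lp.coeFn_smul c (slice μ f w)] with y a b d
  rw [b, d, Pi.smul_apply, Pi.smul_apply, a]

theorem slice_sub (f g : Lp ℂ 2 (ν.prod μ)) :
    ∀ᵐ w ∂ν, slice μ (f - g : Lp ℂ 2 (ν.prod μ)) w = slice μ f w - slice μ g w := by
  apply slice_congr
  filter_upwards [slice_ae_ae f, slice_ae_ae g, Measure.ae_ae_of_ae_prod (Lp.coeFn_sub f g)]
    with w h1 h2 h3
  filter_upwards [h1, h2, h3, Lp.coeFn_sub (slice μ f w) (slice μ g w)] with y a b c d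
  rw [c, d, Pi.sub_apply, Pi.sub_apply, a, b]

/-- The squared norm of the slices, as a measurable function. -/
def sliceNormSq (μ : Measure Y) (f : W × Y → ℂ) (w : W) : ℝ≥0∞ := ∫⁻ y, ‖f (w, y)‖ₑ ^ 2 ∂μ

theorem measurable_sliceNormSq (f : Lp ℂ 2 (ν.prod μ)) : Measurable (sliceNormSq μ f) :=
  Measurable.lintegral_prod_right' (f := fun p : W × Y => ‖f p‖ₑ ^ 2)
    ((Lp.stronglyMeasurable f).enorm.pow_const 2)

theorem enorm_slice_sq (f : Lp ℂ 2 (ν.prod μ)) :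
    ∀ᵐ w ∂ν, ‖slice μ f w‖ₑ ^ 2 = sliceNormSq μ f w := by
  filter_upwards [slice_ae_ae f] with w hw
  rw [Lp_enorm_sq]
  refine lintegral_congr_ae ?_
  filter_upwards [hw] with y hy
  rw [hy]

theorem lintegral_sliceNormSq (f : Lp ℂ 2 (ν.prod μ)) :
    ∫⁻ w, sliceNormSq μ f w ∂ν = ‖f‖ₑ ^ 2 := by
  rw [Lp_enorm_sq, lintegral_prod _ ((Lp.stronglyMeasurable f).enorm.pow_const 2).aemeasurable]
  rfl

/-- The relation `F w = b (f w)` between slices of `f` and `F`. -/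
def SliceRel (b : Lp ℂ 2 μ →L[ℂ] Lp ℂ 2 μ) (f F : Lp ℂ 2 (ν.prod μ)) : Prop :=
  ∀ᵐ w ∂ν, slice μ F w = b (slice μ f w)

variable {b : Lp ℂ 2 μ →L[ℂ] Lp ℂ 2 μ} {f F g K : Lp ℂ 2 (ν.prod μ)}

theorem SliceRel.add (h1 : SliceRel b f F) (h2 : SliceRel b g K) : SliceRel b (f + g) (F + K) := by
  filter_upwards [h1, h2, slice_add f g, slice_add F K] with w a c d e
  rw [d, e, a, c, map_add]

theorem SliceRel.sub (h1 : SliceRel b f F) (h2 : SliceRel b g K) : SliceRel b (f - g) (F - K) := by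
  filter_upwards [h1, h2, slice_sub f g, slice_sub F K] with w a c d e
  rw [d, e, a, c, map_sub]

theorem SliceRel.smul (c : ℂ) (h1 : SliceRel b f F) : SliceRel b (c • f) (c • F) := by
  filter_upwards [h1, slice_smul c f, slice_smul c F] with w a d e
  rw [d, e, a, map_smul]

/-- The bound for `b` holds on almost every slice and is integrated. It yields both uniqueness of
`F` and the Cauchy estimate behind its existence. -/
theorem SliceRel.enorm_le (h : SliceRel b f F) : ‖F‖ₑ ≤ ‖b‖ₑ * ‖f‖ₑ := by
  have : ‖F‖ₑ ^ 2 ≤ (‖b‖ₑ * ‖f‖ₑ) ^ 2 := by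
    rw [mul_pow, ← lintegral_sliceNormSq, ← lintegral_sliceNormSq,
      ← lintegral_const_mul _ (measurable_sliceNormSq f)]
    refine lintegral_mono_ae ?_
    filter_upwards [h, enorm_slice_sq f, enorm_slice_sq F] with w h1 h2 h3
    rw [← h2, ← h3, h1, ← mul_pow]
    gcongr
    exact b.le_opENorm _
  exact (ENNReal.pow_le_pow_left_iff two_ne_zero).1 this

theorem SliceRel.norm_le (h : SliceRel b f F) : ‖F‖ ≤ ‖b‖ * ‖f‖ := by
  have := ENNReal.toReal_mono (by finiteness) h.enorm_le
  simpa using this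

/-- The countable infimum of the majorants has integral zero; this replaces the passage to an almost
everywhere convergent subsequence. -/
theorem ae_eq_zero_of_forall_le {u : W → ℝ≥0∞} (A : ℕ → W → ℝ≥0∞) (hA : ∀ n, Measurable (A n))
    (h : ∀ n, ∀ᵐ w ∂ν, u w ≤ A n w)
    (hlim : Filter.Tendsto (fun n => ∫⁻ w, A n w ∂ν) Filter.atTop (nhds 0)) :
    ∀ᵐ w ∂ν, u w = 0 := by
  have h0 : ∫⁻ w, ⨅ n, A n w ∂ν = 0 := by
    refine le_antisymm (ge_of_tendsto' hlim fun n => ?_) zero_le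
    exact lintegral_mono fun w => iInf_le _ n
  rw [lintegral_eq_zero_iff (.iInf hA)] at h0
  filter_upwards [h0, ae_all_iff.2 h] with w h1 h2
  exact le_antisymm ((le_iInf h2).trans h1.le) zero_le

theorem SliceRel.of_tendsto {fs Fs : ℕ → Lp ℂ 2 (ν.prod μ)} (h : ∀ n, SliceRel b (fs n) (Fs n))
    (hf : Filter.Tendsto fs Filter.atTop (nhds f)) (hF : Filter.Tendsto Fs Filter.atTop (nhds F)) :
    SliceRel b f F := by
  have key : ∀ᵐ w ∂ν, ‖slice μ F w - b (slice μ f w)‖ₑ ^ 2 = 0 := by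
    refine ae_eq_zero_of_forall_le (fun n w => 2 * (sliceNormSq μ (F - Fs n : Lp ℂ 2 (ν.prod μ)) w
      + ‖b‖ₑ ^ 2 * sliceNormSq μ (fs n - f : Lp ℂ 2 (ν.prod μ)) w)) (fun n => ?_) (fun n => ?_) ?_
    · exact ((measurable_sliceNormSq _).add ((measurable_sliceNormSq _).const_mul _)).const_mul _
    · filter_upwards [h n, slice_sub F (Fs n), slice_sub (fs n) f, enorm_slice_sq (F - Fs n),
        enorm_slice_sq (fs n - f)] with w h1 h2 h3 h4 h5
      have e : slice μ F w - b (slice μ f w) = slice μ (F - Fs n : Lp ℂ 2 (ν.prod μ)) w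
          + b (slice μ (fs n - f : Lp ℂ 2 (ν.prod μ)) w) := by
        rw [h2, h3, map_sub, h1]; abel
      rw [← h4, ← h5, ← mul_pow, e]
      calc ‖slice μ (F - Fs n : Lp ℂ 2 (ν.prod μ)) w
            + b (slice μ (fs n - f : Lp ℂ 2 (ν.prod μ)) w)‖ₑ ^ 2
          ≤ (‖slice μ (F - Fs n : Lp ℂ 2 (ν.prod μ)) w‖ₑ
            + ‖b‖ₑ * ‖slice μ (fs n - f : Lp ℂ 2 (ν.prod μ)) w‖ₑ) ^ 2 := by
            gcongr
            exact (enorm_add_le _ _).trans (add_le_add le_rfl (b.le_opENorm _))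
        _ ≤ _ := by
            have := ENNReal.rpow_add_le_mul_rpow_add_rpow
              ‖slice μ (F - Fs n : Lp ℂ 2 (ν.prod μ)) w‖ₑ
              (‖b‖ₑ * ‖slice μ (fs n - f : Lp ℂ 2 (ν.prod μ)) w‖ₑ) (p := 2) (by norm_num)
            norm_num at this
            exact this
    · have e : ∀ n, ∫⁻ w, 2 * (sliceNormSq μ (F - Fs n : Lp ℂ 2 (ν.prod μ)) w
          + ‖b‖ₑ ^ 2 * sliceNormSq μ (fs n - f : Lp ℂ 2 (ν.prod μ)) w) ∂ν
          = 2 * (‖F - Fs n‖ₑ ^ 2 + ‖b‖ₑ ^ 2 * ‖fs n - f‖ₑ ^ 2) := fun n => by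
        rw [lintegral_const_mul, lintegral_add_left (measurable_sliceNormSq _),
          lintegral_const_mul _ (measurable_sliceNormSq _), lintegral_sliceNormSq,
          lintegral_sliceNormSq]
        exact (measurable_sliceNormSq _).add ((measurable_sliceNormSq _).const_mul _)
      simp_rw [e]
      have l1 : Filter.Tendsto (fun n => ‖F - Fs n‖ₑ) Filter.atTop (nhds 0) := by
        have := (tendsto_const_nhds (x := F)).sub hF
        simpa using this.enorm
      have l2 : Filter.Tendsto (fun n => ‖fs n - f‖ₑ) Filter.atTop (nhds 0) := by
        have := hf.sub (tendsto_const_nhds (x := f))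
        simpa using this.enorm
      have := ENNReal.Tendsto.const_mul (a := 2) ((ENNReal.Tendsto.pow (n := 2) l1).add
        (ENNReal.Tendsto.const_mul (a := ‖b‖ₑ ^ 2) (ENNReal.Tendsto.pow (n := 2) l2) (Or.inr (by finiteness))))
        (Or.inr (by finiteness))
      simpa using this
  filter_upwards [key] with w hw
  simpa [sub_eq_zero] using hw

end Slices

/-! ### Density of rectangles -/

section Density

variable {W Y : Type*} [MeasurableSpace W] [MeasurableSpace Y] {ν : Measure W} {μ : Measure Y}
  [SigmaFinite ν] [SigmaFinite μ]

theorem prod_rect_ne_top {s : Set W} {t : Set Y} (hs : ν s ≠ ∞) (ht : μ t ≠ ∞) :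
    (ν.prod μ) (s ×ˢ t) ≠ ∞ := by
  rw [Measure.prod_prod]
  exact ENNReal.mul_ne_top hs ht

/-- Rectangles are a π-system generating the product σ-algebra. The induction is run inside an
exhaustion by rectangles of finite measure, where complements stay integrable, and the exhaustion is
removed by a limit. -/
theorem ae_eq_zero_of_setIntegral_rect (g : Lp ℂ 2 (ν.prod μ))
    (h : ∀ (s : Set W) (t : Set Y), MeasurableSet s → MeasurableSet t → ν s ≠ ∞ → μ t ≠ ∞ →
      ∫ p in s ×ˢ t, g p ∂(ν.prod μ) = 0) : g = 0 := by
  have hint : ∀ A : Set (W × Y), (ν.prod μ) A ≠ ∞ → IntegrableOn g A (ν.prod μ) := fun A hA =>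
    integrableOn_Lp_of_measure_ne_top g one_le_two hA
  let Q : ℕ → Set (W × Y) := fun n => spanningSets ν n ×ˢ spanningSets μ n
  have hQm : ∀ n, MeasurableSet (Q n) := fun n =>
    (measurableSet_spanningSets ν n).prod (measurableSet_spanningSets μ n)
  have hQ : ∀ n, (ν.prod μ) (Q n) ≠ ∞ := fun n =>
    prod_rect_ne_top (measure_spanningSets_lt_top ν n).ne (measure_spanningSets_lt_top μ n).ne
  have hQmono : Monotone Q := fun a b hab =>
    Set.prod_mono (monotone_spanningSets ν hab) (monotone_spanningSets μ hab)
  have hQU : ⋃ n, Q n = Set.univ := by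
    rw [Set.iUnion_prod_of_monotone (monotone_spanningSets ν) (monotone_spanningSets μ),
      iUnion_spanningSets, iUnion_spanningSets, Set.univ_prod_univ]
  have step : ∀ n, ∀ A, MeasurableSet A → ∫ p in Q n ∩ A, g p ∂(ν.prod μ) = 0 := by
    intro n
    refine MeasurableSpace.induction_on_inter generateFrom_prod.symm isPiSystem_prod ?_ ?_ ?_ ?_
    · simp
    · rintro _ ⟨s, hs, t, ht, rfl⟩
      simp only [Q]
      rw [Set.prod_inter_prod]
      exact h _ _ ((measurableSet_spanningSets ν n).inter hs)
        ((measurableSet_spanningSets μ n).inter ht)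
        (measure_ne_top_of_subset Set.inter_subset_left (measure_spanningSets_lt_top ν n).ne)
        (measure_ne_top_of_subset Set.inter_subset_left (measure_spanningSets_lt_top μ n).ne)
    · intro A hA h0
      have h1 := integral_inter_add_sdiff hA (hint _ (hQ n))
      rw [h0, zero_add, h _ _ (measurableSet_spanningSets ν n) (measurableSet_spanningSets μ n)
        (measure_spanningSets_lt_top ν n).ne (measure_spanningSets_lt_top μ n).ne] at h1
      rwa [← Set.sdiff_eq]
    · intro A hd hA h0
      rw [Set.inter_iUnion, integral_iUnion (fun i => (hQm n).inter (hA i))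
        (fun i j hij => (hd hij).mono Set.inter_subset_right Set.inter_subset_right)
        ((hint _ (hQ n)).mono_set (Set.iUnion_subset fun i => Set.inter_subset_left))]
      simp [h0]
  refine Lp.ext ?_
  refine (Lp.ae_eq_zero_of_forall_setIntegral_eq_zero g two_ne_zero ENNReal.ofNat_ne_top
    (fun A _ hA => hint A hA.ne) fun A hA hA' => ?_).trans (Lp.coeFn_zero _ _ _).symm
  have hU : ⋃ n, Q n ∩ A = A := by rw [← Set.iUnion_inter, hQU, Set.univ_inter]
  have := tendsto_setIntegral_of_monotone (f := g) (μ := ν.prod μ) (s := fun n => Q n ∩ A)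
    (fun n => (hQm n).inter hA) (fun a b hab => Set.inter_subset_inter_left _ (hQmono hab))
    (by rw [hU]; exact hint A hA'.ne)
  rw [hU] at this
  simp_rw [step _ A hA] at this
  exact tendsto_nhds_unique this tendsto_const_nhds

/-- A closed subspace that contains the indicators of rectangles is everything. -/
theorem eq_top_of_rect_mem {D : Submodule ℂ (Lp ℂ 2 (ν.prod μ))} (hD : IsClosed (D : Set (Lp ℂ 2 (ν.prod μ))))
    (h : ∀ (s : Set W) (t : Set Y) (hs : MeasurableSet s) (ht : MeasurableSet t) (hs' : ν s ≠ ∞)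
      (ht' : μ t ≠ ∞),
      indicatorConstLp 2 (hs.prod ht) (prod_rect_ne_top hs' ht') (1 : ℂ) ∈ D) : D = ⊤ := by
  have : CompleteSpace D := hD.completeSpace_coe
  rw [← Submodule.orthogonal_eq_bot_iff, Submodule.eq_bot_iff]
  intro g hg
  refine ae_eq_zero_of_setIntegral_rect g fun s t hs ht hs' ht' => ?_
  rw [← L2.inner_indicatorConstLp_one (hs.prod ht) (prod_rect_ne_top hs' ht')]
  exact (Submodule.mem_orthogonal _ _).1 hg _ (h s t hs ht hs' ht')

end Density

/-! ### Operators acting on one factor of a product -/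

section ProductOperators

variable {W Y : Type*} [MeasurableSpace W] [MeasurableSpace Y] {ν : Measure W} {μ : Measure Y}
  [SigmaFinite ν] [SigmaFinite μ]

theorem memLp_tensor {f : W → ℂ} {g : Y → ℂ} (hf : MemLp f 2 ν) (hg : MemLp g 2 μ) :
    MemLp (fun p : W × Y => f p.1 * g p.2) 2 (ν.prod μ) := by
  have hm : AEStronglyMeasurable (fun p : W × Y => f p.1 * g p.2) (ν.prod μ) :=
    hf.1.comp_fst.mul hg.1.comp_snd
  rw [memLp_two_iff_integrable_sq_norm hm]
  have h1 := (memLp_two_iff_integrable_sq_norm hf.1).1 hf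
  have h2 := (memLp_two_iff_integrable_sq_norm hg.1).1 hg
  refine (h1.mul_prod h2).congr ?_
  filter_upwards with p
  rw [norm_mul, mul_pow]

/-- The tensor product of two square integrable functions. -/
def tensorLp (f : Lp ℂ 2 ν) (g : Lp ℂ 2 μ) : Lp ℂ 2 (ν.prod μ) :=
  (memLp_tensor (Lp.memLp f) (Lp.memLp g)).toLp

theorem tensorLp_ae (f : Lp ℂ 2 ν) (g : Lp ℂ 2 μ) :
    ∀ᵐ p ∂(ν.prod μ), tensorLp f g p = f p.1 * g p.2 :=
  (memLp_tensor (Lp.memLp f) (Lp.memLp g)).coeFn_toLp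

theorem slice_tensorLp (f : Lp ℂ 2 ν) (g : Lp ℂ 2 μ) :
    ∀ᵐ w ∂ν, slice μ (tensorLp f g) w = f w • g := by
  apply slice_congr (g := fun w => f w • g)
  filter_upwards [Measure.ae_ae_of_ae_prod (tensorLp_ae f g)] with w hw
  filter_upwards [hw, Lp.coeFn_smul (f w) g] with y h1 h2
  rw [h1, h2]
  rfl

theorem sliceRel_tensorLp (b : Lp ℂ 2 μ →L[ℂ] Lp ℂ 2 μ) (f : Lp ℂ 2 ν) (g : Lp ℂ 2 μ) :
    SliceRel b (tensorLp f g) (tensorLp f (b g)) := by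
  filter_upwards [slice_tensorLp f g, slice_tensorLp f (b g)] with w h1 h2
  rw [h1, h2, map_smul]

theorem indicator_rect_eq_tensorLp {s : Set W} {t : Set Y} (hs : MeasurableSet s)
    (ht : MeasurableSet t) (hs' : ν s ≠ ∞) (ht' : μ t ≠ ∞) :
    indicatorConstLp 2 (hs.prod ht) (prod_rect_ne_top hs' ht') (1 : ℂ) =
      tensorLp (indicatorConstLp 2 hs hs' (1 : ℂ)) (indicatorConstLp 2 ht ht' (1 : ℂ)) := by
  apply Lp.ext
  have h1 : ∀ᵐ p ∂(ν.prod μ), indicatorConstLp 2 hs hs' (1 : ℂ) p.1 = s.indicator (fun _ => 1) p.1 :=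
    Measure.quasiMeasurePreserving_fst.ae indicatorConstLp_coeFn
  have h2 : ∀ᵐ p ∂(ν.prod μ), indicatorConstLp 2 ht ht' (1 : ℂ) p.2 = t.indicator (fun _ => 1) p.2 :=
    Measure.quasiMeasurePreserving_snd.ae indicatorConstLp_coeFn
  filter_upwards [h1, h2, tensorLp_ae (indicatorConstLp 2 hs hs' (1 : ℂ))
    (indicatorConstLp 2 ht ht' (1 : ℂ)), indicatorConstLp_coeFn (p := 2) (hs := hs.prod ht)
    (hμs := prod_rect_ne_top hs' ht') (c := (1 : ℂ))] with p a b c d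
  rw [c, d, a, b]
  by_cases h3 : p.1 ∈ s <;> by_cases h4 : p.2 ∈ t <;> simp [h3, h4]

theorem integrable_indicatorConstLp_one {X : Type*} [MeasurableSpace X] {μ : Measure X} {s : Set X}
    (hs : MeasurableSet s) (hs' : μ s ≠ ∞) :
    Integrable (indicatorConstLp 2 hs hs' (1 : ℂ)) μ :=
  (integrable_congr indicatorConstLp_coeFn).2
    ((integrable_indicator_iff hs).2 (integrableOn_const hs'))

/-- A closed subspace that contains all tensor products of integrable functions is everything. -/
theorem eq_top_of_tensorLp_mem {D : Submodule ℂ (Lp ℂ 2 (ν.prod μ))}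
    (hD : IsClosed (D : Set (Lp ℂ 2 (ν.prod μ)))) (h : ∀ (f : Lp ℂ 2 ν) (g : Lp ℂ 2 μ), Integrable f ν → Integrable g μ → tensorLp f g ∈ D) :
    D = ⊤ :=
  eq_top_of_rect_mem hD fun s t hs ht hs' ht' => by
    rw [indicator_rect_eq_tensorLp hs ht hs' ht']
    exact h _ _ (integrable_indicatorConstLp_one hs hs') (integrable_indicatorConstLp_one ht ht')

/-- The `f` admitting a partner `F` form a subspace that contains the tensor products; it is closed
because the norm bound makes partners of a convergent sequence Cauchy. -/
theorem exists_sliceRel (b : Lp ℂ 2 μ →L[ℂ] Lp ℂ 2 μ) (f : Lp ℂ 2 (ν.prod μ)) :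
    ∃ F, SliceRel b f F := by
  let D : Submodule ℂ (Lp ℂ 2 (ν.prod μ)) :=
    { carrier := {f | ∃ F, SliceRel b f F}
      add_mem' := fun ⟨F, hF⟩ ⟨K, hK⟩ => ⟨F + K, hF.add hK⟩
      zero_mem' := ⟨0, by simpa using (sliceRel_tensorLp b (0 : Lp ℂ 2 ν) 0).smul 0⟩
      smul_mem' := fun c _ ⟨F, hF⟩ => ⟨c • F, hF.smul c⟩ }
  have hD : IsClosed (D : Set (Lp ℂ 2 (ν.prod μ))) := by
    refine isClosed_of_closure_subset fun f hf => ?_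
    obtain ⟨fs, hfs, hlim⟩ := mem_closure_iff_seq_limit.1 hf
    choose Fs hFs using hfs
    have hc : CauchySeq Fs := by
      rw [Metric.cauchySeq_iff']
      intro ε hε
      obtain ⟨N, hN⟩ := Metric.cauchySeq_iff'.1 hlim.cauchySeq (ε / (‖b‖ + 1)) (by positivity)
      refine ⟨N, fun n hn => ?_⟩
      have h1 := ((hFs n).sub (hFs N)).norm_le
      have h2 := hN n hn
      rw [dist_eq_norm] at h2 ⊢
      rw [lt_div_iff₀ (by positivity)] at h2
      nlinarith [norm_nonneg (fs n - fs N), norm_nonneg b]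
    obtain ⟨F, hF⟩ := cauchySeq_tendsto_of_complete hc
    exact ⟨F, SliceRel.of_tendsto hFs hlim hF⟩
  have : f ∈ D := by
    rw [eq_top_of_tensorLp_mem hD fun f g _ _ => ⟨_, sliceRel_tensorLp b f g⟩]
    trivial
  exact this

theorem SliceRel.unique {b : Lp ℂ 2 μ →L[ℂ] Lp ℂ 2 μ} {f F K : Lp ℂ 2 (ν.prod μ)}
    (hF : SliceRel b f F) (hK : SliceRel b f K) : F = K := by
  have := (hF.sub hK).norm_le
  rw [sub_self, norm_zero, mul_zero] at this
  exact sub_eq_zero.1 (norm_eq_zero.1 (le_antisymm this (norm_nonneg _)))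

/-- The operator `1 ⊗ b` on `L²(ν × μ)`. -/
def sliceOp (ν : Measure W) [SigmaFinite ν] (b : Lp ℂ 2 μ →L[ℂ] Lp ℂ 2 μ) :
    Lp ℂ 2 (ν.prod μ) →L[ℂ] Lp ℂ 2 (ν.prod μ) :=
  LinearMap.mkContinuous
    { toFun := fun f => (exists_sliceRel b f).choose
      map_add' := fun f g => (exists_sliceRel b (f + g)).choose_spec.unique
        ((exists_sliceRel b f).choose_spec.add (exists_sliceRel b g).choose_spec)
      map_smul' := fun c f => (exists_sliceRel b (c • f)).choose_spec.unique
        ((exists_sliceRel b f).choose_spec.smul c) }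
    ‖b‖ fun f => (exists_sliceRel b f).choose_spec.norm_le

theorem sliceRel_sliceOp (b : Lp ℂ 2 μ →L[ℂ] Lp ℂ 2 μ) (f : Lp ℂ 2 (ν.prod μ)) :
    SliceRel b f (sliceOp ν b f) :=
  (exists_sliceRel b f).choose_spec

end ProductOperators

/-! ### Changes of variables -/

section ChangeOfVariables

variable {X Y : Type*} [MeasurableSpace X] [MeasurableSpace Y] {μ : Measure X} {ν : Measure Y}

/-- The unitary operator `f ↦ f ∘ e` given by a measure preserving equivalence. -/
def compU (e : X ≃ᵐ Y) (he : MeasurePreserving e μ ν) : Lp ℂ 2 ν ≃ₗᵢ[ℂ] Lp ℂ 2 μ where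
  toLinearEquiv := LinearEquiv.ofLinearMap
    (Lp.compMeasurePreservingₗᵢ ℂ e he).toLinearMap
    (Lp.compMeasurePreservingₗᵢ ℂ e.symm (he.symm e)).toLinearMap
    (by
      refine LinearMap.ext fun f => Lp.ext ?_
      have h1 := Lp.coeFn_compMeasurePreserving
        (Lp.compMeasurePreserving e.symm (he.symm e) f) he
      have h2 := he.quasiMeasurePreserving.ae
        (Lp.coeFn_compMeasurePreserving f (he.symm e))
      filter_upwards [h1, h2] with x a b
      refine a.trans (b.trans ?_)
      simp)
    (by
      refine LinearMap.ext fun f => Lp.ext ?_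
      have h1 := Lp.coeFn_compMeasurePreserving
        (Lp.compMeasurePreserving e he f) (he.symm e)
      have h2 := (he.symm e).quasiMeasurePreserving.ae
        (Lp.coeFn_compMeasurePreserving f he)
      filter_upwards [h1, h2] with x a b
      refine a.trans (b.trans ?_)
      simp)
  norm_map' f := Lp.norm_compMeasurePreserving f he

theorem compU_ae (e : X ≃ᵐ Y) (he : MeasurePreserving e μ ν) (f : Lp ℂ 2 ν) :
    ∀ᵐ x ∂μ, compU e he f x = f (e x) :=
  Lp.coeFn_compMeasurePreserving f he

theorem compU_symm_ae (e : X ≃ᵐ Y) (he : MeasurePreserving e μ ν) (f : Lp ℂ 2 μ) :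
    ∀ᵐ y ∂ν, (compU e he).symm f y = f (e.symm y) :=
  Lp.coeFn_compMeasurePreserving f (he.symm e)

end ChangeOfVariables

/-! ### Splitting the variables -/

section Splitting

variable {k m : ℕ} {ι : Fin k → Fin m}

/-- The values of the variables that are not in the range of `ι`. -/
abbrev RestVars (ι : Fin k → Fin m) : Type := {l : Fin m // ¬ l ∈ Set.range ι} → ℝ

/-- The variables that are not in the range of `ι`, and those in the range. -/
def splitVars (hι : Function.Injective ι) : (Fin m → ℝ) ≃ᵐ RestVars ι × (Fin k → ℝ) :=
  ((MeasurableEquiv.piEquivPiSubtypeProd (fun _ : Fin m => ℝ) (· ∈ Set.range ι)).trans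
    MeasurableEquiv.prodComm).trans
    (MeasurableEquiv.prodCongr (MeasurableEquiv.refl _)
      (MeasurableEquiv.piCongrLeft (fun _ => ℝ) (Equiv.ofInjective ι hι).symm))

theorem splitVars_fst (hι : Function.Injective ι) (x : Fin m → ℝ) :
    (splitVars hι x).1 = fun l : {l : Fin m // ¬ l ∈ Set.range ι} => x l.1 := rfl

theorem splitVars_snd (hι : Function.Injective ι) (x : Fin m → ℝ) :
    (splitVars hι x).2 = x ∘ ι := by
  funext j
  have := Equiv.piCongrLeft_apply_apply (fun _ : Fin k => ℝ) (Equiv.ofInjective ι hι).symm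
    (fun l => x l) ⟨ι j, j, rfl⟩
  rw [Equiv.ofInjective_symm_apply] at this
  exact this

theorem measurePreserving_splitVars (hι : Function.Injective ι) :
    MeasurePreserving (splitVars hι) := by
  have h1 := volume_preserving_piEquivPiSubtypeProd (fun _ : Fin m => ℝ) (· ∈ Set.range ι)
  rw [Measure.volume_eq_prod] at h1
  have h2 := @volume_measurePreserving_piCongrLeft (Fin k) _ _ (Subtype.fintype (· ∈ Set.range ι))
    (fun _ => ℝ) (Equiv.ofInjective ι hι).symm _ _
  exact ((MeasurePreserving.id volume).prod h2).comp (Measure.measurePreserving_swap.comp h1)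

/-- The bridge between replacing coordinates by `Function.extend` and moving along one factor of a
product, where Fubini applies. -/
theorem extend_eq_splitVars_symm (hι : Function.Injective ι) (y : Fin k → ℝ) (x : Fin m → ℝ) :
    Function.extend ι y x = (splitVars hι).symm ((splitVars hι x).1, y) := by
  rw [← MeasurableEquiv.symm_apply_eq, MeasurableEquiv.symm_symm]
  refine Prod.ext ?_ ?_
  · rw [splitVars_fst, splitVars_fst]
    funext l
    rw [Function.extend_apply' _ _ _ fun h => l.2 h]
  · rw [splitVars_snd]
    funext j
    exact hι.extend_apply _ _ _

theorem ae_fst_splitVars_iff (hι : Function.Injective ι) {Q : RestVars ι → Prop} :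
    (∀ᵐ x, Q (splitVars hι x).1) ↔ ∀ᵐ w, Q w := by
  constructor
  · intro h
    have h1 : ∀ᵐ p : RestVars ι × (Fin k → ℝ), Q p.1 := by
      filter_upwards [((measurePreserving_splitVars hι).symm _).quasiMeasurePreserving.ae h]
        with p hp
      simpa using hp
    -- The property does not involve `y`, and Lebesgue measure on `ℝᵏ` is nonzero, so one `y` that
    -- is not exceptional is enough.
    filter_upwards [Measure.ae_ae_of_ae_prod h1] with w hw
    exact hw.exists.choose_spec
  · exact fun h => (measurePreserving_splitVars hι).quasiMeasurePreserving.ae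
      (Measure.quasiMeasurePreserving_fst.ae h)

theorem ae_ae_extend (hι : Function.Injective ι) {P : (Fin m → ℝ) → Prop} (h : ∀ᵐ x, P x) :
    ∀ᵐ x : Fin m → ℝ, ∀ᵐ y : Fin k → ℝ, P (Function.extend ι y x) := by
  have h1 : ∀ᵐ p : RestVars ι × (Fin k → ℝ), P ((splitVars hι).symm p) :=
    ((measurePreserving_splitVars hι).symm _).quasiMeasurePreserving.ae h
  filter_upwards [(ae_fst_splitVars_iff hι).2 (Measure.ae_ae_of_ae_prod h1)] with x hx
  filter_upwards [hx] with y hy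
  rwa [extend_eq_splitVars_symm hι]

theorem ae_of_ae_ae_extend (hι : Function.Injective ι) {P : (Fin m → ℝ) → Prop}
    (hP : MeasurableSet {x | P x})
    (h : ∀ᵐ x : Fin m → ℝ, ∀ᵐ y : Fin k → ℝ, P (Function.extend ι y x)) : ∀ᵐ x, P x := by
  simp_rw [extend_eq_splitVars_symm hι] at h
  have h1 := (ae_fst_splitVars_iff hι (Q := fun w => ∀ᵐ y, P ((splitVars hι).symm (w, y)))).1 h
  have h2 : ∀ᵐ p : RestVars ι × (Fin k → ℝ), P ((splitVars hι).symm p) :=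
    (Measure.ae_prod_iff_ae_ae ((splitVars hι).symm.measurable hP)).2 h1
  filter_upwards [(measurePreserving_splitVars hι).quasiMeasurePreserving.ae h2] with x hx
  simpa using hx

/-- `L²(ℝᵐ)` as the space of square integrable functions on a product. -/
def splitU (hι : Function.Injective ι) :
    L2 m ≃ₗᵢ[ℂ] Lp ℂ 2 ((volume : Measure (RestVars ι)).prod (volume : Measure (Fin k → ℝ))) :=
  (compU (splitVars hι) (measurePreserving_splitVars hι)).symm

theorem splitU_ae (hι : Function.Injective ι) (f : L2 m) :
    ∀ᵐ p : RestVars ι × (Fin k → ℝ), splitU hι f p = f ((splitVars hι).symm p) :=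
  compU_symm_ae _ _ f

theorem sliceLp_eq_slice (hι : Function.Injective ι) (f : (Fin m → ℝ) → ℂ) (x : Fin m → ℝ) :
    sliceLp ι f x = slice volume (fun p => f ((splitVars hι).symm p)) (splitVars hι x).1 := by
  have key : ∀ g g' : (Fin k → ℝ) → ℂ, g = g' → (open Classical in
      (if h : MemLp g 2 volume then h.toLp else 0 : L2 k)) = open Classical in
      if h : MemLp g' 2 volume then h.toLp else 0 := by
    rintro g _ rfl
    rfl
  exact key _ _ (funext fun y => by rw [extend_eq_splitVars_symm hι])

theorem memLp_extend (hι : Function.Injective ι) (f : L2 m) :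
    ∀ᵐ x : Fin m → ℝ, MemLp (fun y : Fin k → ℝ => f (Function.extend ι y x)) 2 := by
  have h : ∀ᵐ w : RestVars ι, MemLp (fun y => f ((splitVars hι).symm (w, y))) 2 := by
    filter_upwards [memLp_slice (splitU hι f), Measure.ae_ae_of_ae_prod (splitU_ae hι f)]
      with w h1 h2
    exact h1.ae_eq h2
  filter_upwards [(ae_fst_splitVars_iff hι).2 h] with x hx
  simpa only [extend_eq_splitVars_symm hι] using hx

theorem sliceLp_ae (hι : Function.Injective ι) (f : L2 m) :
    ∀ᵐ x : Fin m → ℝ, ∀ᵐ y : Fin k → ℝ, sliceLp ι f x y = f (Function.extend ι y x) := by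
  filter_upwards [memLp_extend hι f] with x hx
  rw [sliceLp, dif_pos hx]
  exact hx.coeFn_toLp

theorem sliceLp_splitU (hι : Function.Injective ι) (f : L2 m) :
    ∀ᵐ x : Fin m → ℝ, sliceLp ι f x = slice volume (splitU hι f) (splitVars hι x).1 := by
  have h : ∀ᵐ w : RestVars ι, slice volume (splitU hι f) w =
      slice volume (fun p => f ((splitVars hι).symm p)) w := by
    apply slice_congr
    filter_upwards [memLp_slice (splitU hι f), Measure.ae_ae_of_ae_prod (splitU_ae hι f)]
      with w h1 h2
    filter_upwards [h2, slice_ae (f := fun p => f ((splitVars hι).symm p)) (h1.ae_eq h2)]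
      with y h3 h4
    rw [h3, h4]
  filter_upwards [(ae_fst_splitVars_iff hι).2 h] with x hx
  rw [hx, sliceLp_eq_slice hι]

theorem sliceLp_eq_of_ae {f : (Fin m → ℝ) → ℂ} {x : Fin m → ℝ} {g : L2 k}
    (h : ∀ᵐ y, f (Function.extend ι y x) = g y) : sliceLp ι f x = g := by
  have hm : MemLp (fun y => f (Function.extend ι y x)) 2 :=
    (Lp.memLp g).ae_eq (h.mono fun _ h => h.symm)
  rw [sliceLp, dif_pos hm]
  apply Lp.ext
  filter_upwards [hm.coeFn_toLp, h] with y h1 h2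
  rw [h1, h2]

theorem Lp_eq_of_ae_ae_extend (hι : Function.Injective ι) {f g : L2 m}
    (h : ∀ᵐ x : Fin m → ℝ, ∀ᵐ y : Fin k → ℝ, f (Function.extend ι y x) = g (Function.extend ι y x)) :
    f = g :=
  Lp.ext (ae_of_ae_ae_extend hι (measurableSet_eq_fun (Lp.stronglyMeasurable f).measurable
    (Lp.stronglyMeasurable g).measurable) h)

end Splitting

/-! ### Operators acting on some of the variables -/

section ActOn

variable {k m : ℕ} {ι : Fin k → Fin m} {b : L2 k →L[ℂ] L2 k}

theorem IsActingOn.unique (hι : Function.Injective ι) {B D : L2 m →L[ℂ] L2 m}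
    (hB : IsActingOn ι b B) (hD : IsActingOn ι b D) : B = D := by
  ext1 f
  apply Lp_eq_of_ae_ae_extend hι
  filter_upwards [hB f, hD f] with x h1 h2
  filter_upwards [h1, h2] with y h3 h4
  rw [h3, h4]

theorem exists_isActingOn (hι : Function.Injective ι) (b : L2 k →L[ℂ] L2 k) :
    ∃ B : L2 m →L[ℂ] L2 m, IsActingOn ι b B := by
  refine ⟨(splitU hι).symm.toContinuousLinearEquiv.toContinuousLinearMap ∘L sliceOp volume b ∘L
    (splitU hι).toContinuousLinearEquiv.toContinuousLinearMap, fun f => ?_⟩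
  set F := (((splitU hι).symm.toContinuousLinearEquiv.toContinuousLinearMap ∘L sliceOp volume b ∘L
    (splitU hι).toContinuousLinearEquiv.toContinuousLinearMap : L2 m →L[ℂ] L2 m) f) with hF
  have hF' : splitU hι F = sliceOp volume b (splitU hι f) := by simp [hF]
  have h1 := sliceRel_sliceOp b (splitU hι f)
  rw [← hF'] at h1
  filter_upwards [sliceLp_splitU hι f, sliceLp_splitU hι F, (ae_fst_splitVars_iff hι).2 h1,
    sliceLp_ae hι F] with x h1 h2 h3 h4
  rw [h1, ← h3, ← h2]
  filter_upwards [h4] with y hy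
  exact hy.symm

theorem isActingOn_actOn (hι : Function.Injective ι) (b : L2 k →L[ℂ] L2 k) :
    IsActingOn ι b (actOn ι b : L2 m →L[ℂ] L2 m) :=
  Classical.epsilon_spec (exists_isActingOn hι b)

theorem IsActingOn.actOn_eq (hι : Function.Injective ι) {B : L2 m →L[ℂ] L2 m}
    (hB : IsActingOn ι b B) : actOn ι b = B :=
  (isActingOn_actOn hι b).unique hι hB

theorem sliceLp_actOn (hι : Function.Injective ι) (b : L2 k →L[ℂ] L2 k) (f : L2 m) :
    ∀ᵐ x : Fin m → ℝ, sliceLp ι (actOn ι b f) x = b (sliceLp ι f x) := by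
  filter_upwards [isActingOn_actOn hι b f] with x h
  exact sliceLp_eq_of_ae h

theorem actOn_mul (hι : Function.Injective ι) (a b : L2 k →L[ℂ] L2 k) :
    (actOn ι (a * b) : L2 m →L[ℂ] L2 m) = actOn ι a * actOn ι b := by
  refine IsActingOn.actOn_eq hι fun f => ?_
  filter_upwards [isActingOn_actOn hι a (actOn ι b f), sliceLp_actOn hι b f] with x h1 h2
  filter_upwards [h1] with y h3
  rw [mul_apply_eq_comp, h3, h2, mul_apply_eq_comp]

theorem actOn_one (hι : Function.Injective ι) : (actOn ι (1 : L2 k →L[ℂ] L2 k) : L2 m →L[ℂ] L2 m) = 1 := by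
  refine IsActingOn.actOn_eq hι fun f => ?_
  filter_upwards [sliceLp_ae hι f] with x h1
  filter_upwards [h1] with y h3
  exact h3.symm

theorem extend_extend {n : ℕ} {κ : Fin n → Fin k} (hι : Function.Injective ι)
    (hκ : Function.Injective κ) (z : Fin n → ℝ) (y : Fin k → ℝ) (x : Fin m → ℝ) :
    Function.extend ι (Function.extend κ z y) x =
      Function.extend (ι ∘ κ) z (Function.extend ι y x) := by
  funext l
  by_cases h : ∃ j, ι j = l
  · obtain ⟨j, rfl⟩ := h
    rw [hι.extend_apply]
    by_cases h' : ∃ i, κ i = j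
    · obtain ⟨i, rfl⟩ := h'
      rw [hκ.extend_apply]
      exact ((hι.comp hκ).extend_apply _ _ i).symm
    · rw [Function.extend_apply' _ _ _ h', Function.extend_apply', hι.extend_apply]
      rintro ⟨i, hi⟩
      exact h' ⟨i, hι hi⟩
  · rw [Function.extend_apply' _ _ _ h, Function.extend_apply', Function.extend_apply' _ _ _ h]
    rintro ⟨i, hi⟩
    exact h ⟨_, hi⟩

/-- A slice of a slice is a slice along the composed index map. This transports operators from one
to two to `m` variables. -/
theorem actOn_actOn {n : ℕ} {κ : Fin n → Fin k} (hι : Function.Injective ι)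
    (hκ : Function.Injective κ) (b : L2 n →L[ℂ] L2 n) :
    (actOn ι (actOn κ b) : L2 m →L[ℂ] L2 m) = actOn (ι ∘ κ) b := by
  ext1 f
  have hικ := hι.comp hκ
  have hE : MeasurableSet {x | (actOn ι (actOn κ b) f : L2 m) x = (actOn (ι ∘ κ) b f : L2 m) x} :=
    measurableSet_eq_fun (Lp.stronglyMeasurable _).measurable (Lp.stronglyMeasurable _).measurable
  refine Lp.ext (ae_of_ae_ae_extend hι hE ?_)
  filter_upwards [isActingOn_actOn hι (actOn κ b) f, sliceLp_ae hι f,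
    ae_ae_extend hι (isActingOn_actOn hικ b f)] with x h1 h2 h3
  refine ae_of_ae_ae_extend hκ ?_ ?_
  · have hm : Measurable fun y : Fin k → ℝ => Function.extend ι y x := by
      simp_rw [extend_eq_splitVars_symm hι]
      exact (splitVars hι).symm.measurable.comp measurable_prodMk_left
    exact hm hE
  · filter_upwards [isActingOn_actOn hκ b (sliceLp ι f x), ae_ae_extend hκ h1,
      ae_ae_extend hκ h2, h3, sliceLp_ae hκ (sliceLp ι f x)] with y h4 h5 h6 h7 h8
    filter_upwards [h4, h5, h7] with z h9 h10 h11
    rw [h10, h9, extend_extend hι hκ, h11]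
    congr 3
    symm
    apply sliceLp_eq_of_ae
    filter_upwards [h6, h8] with z h12 h13
    rw [h13, h12, extend_extend hι hκ]

end ActOn

/-! ### Unitary operators -/

section UnitaryOperators

variable {m k n : ℕ}

/-- A unitary operator as a bounded operator. -/
def opU : (L2 m ≃ₗᵢ[ℂ] L2 m) →* (L2 m →L[ℂ] L2 m) where
  toFun V := V.toContinuousLinearEquiv.toContinuousLinearMap
  map_one' := rfl
  map_mul' _ _ := rfl

@[simp] theorem opU_apply (V : L2 m ≃ₗᵢ[ℂ] L2 m) (f : L2 m) : opU V f = V f := rfl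

theorem unitary_mul_apply (V W : L2 m ≃ₗᵢ[ℂ] L2 m) (f : L2 m) : (V * W) f = V (W f) := rfl

theorem opU_injective : Function.Injective (opU (m := m)) := fun V W h => by
  ext1 f
  exact DFunLike.congr_fun h f

theorem opU_mem_unitary (V : L2 m ≃ₗᵢ[ℂ] L2 m) : opU V ∈ unitary (L2 m →L[ℂ] L2 m) :=
  (Unitary.linearIsometryEquiv.symm V).2

theorem inverse_opU (V : L2 m ≃ₗᵢ[ℂ] L2 m) : Ring.inverse (opU V) = opU V⁻¹ := by
  have : opU V = ((Units.map opU (toUnits V) : (L2 m →L[ℂ] L2 m)ˣ) :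
    L2 m →L[ℂ] L2 m) := rfl
  rw [this, Ring.inverse_unit]
  rfl

theorem norm_actOn_le {ι : Fin k → Fin m} (hι : Function.Injective ι) (b : L2 k →L[ℂ] L2 k)
    (f : L2 m) : ‖(actOn ι b : L2 m →L[ℂ] L2 m) f‖ ≤ ‖b‖ * ‖f‖ := by
  have h : SliceRel b (splitU hι f) (splitU hι (actOn ι b f)) := by
    refine (ae_fst_splitVars_iff hι).1 ?_
    filter_upwards [sliceLp_splitU hι f, sliceLp_splitU hι (actOn ι b f), sliceLp_actOn hι b f]
      with x h1 h2 h3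
    rw [← h1, ← h2, h3]
  simpa using h.norm_le

/-- The unitary operator on `L²(ℝᵐ)` that acts as `V` on the variables `ι 0, …, ι (k - 1)`. -/
def actU {ι : Fin k → Fin m} (hι : Function.Injective ι) :
    (L2 k ≃ₗᵢ[ℂ] L2 k) →* (L2 m ≃ₗᵢ[ℂ] L2 m) where
  toFun V :=
    { toLinearEquiv := LinearEquiv.ofLinearMap
        (actOn ι (opU V) : L2 m →L[ℂ] L2 m).toLinearMap
        (actOn ι (opU V⁻¹) : L2 m →L[ℂ] L2 m).toLinearMap
        (by
          have := actOn_mul (m := m) hι (opU V) (opU V⁻¹)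
          rw [← map_mul, mul_inv_cancel, map_one, actOn_one hι] at this
          exact congrArg ContinuousLinearMap.toLinearMap this.symm)
        (by
          have := actOn_mul (m := m) hι (opU V⁻¹) (opU V)
          rw [← map_mul, inv_mul_cancel, map_one, actOn_one hι] at this
          exact congrArg ContinuousLinearMap.toLinearMap this.symm)
      norm_map' := fun f => by
        have hle : ∀ (W : L2 k ≃ₗᵢ[ℂ] L2 k) (g : L2 m),
            ‖(actOn ι (opU W) : L2 m →L[ℂ] L2 m) g‖ ≤ ‖g‖ := fun W g =>
          (norm_actOn_le hι (opU W) g).trans (mul_le_of_le_one_left (norm_nonneg _)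
            (ContinuousLinearMap.opNorm_le_bound _ zero_le_one fun h => by simp))
        refine le_antisymm (hle V f) ?_
        have h1 := hle V⁻¹ (actOn ι (opU V) f)
        have h2 := actOn_mul (m := m) hι (opU V⁻¹) (opU V)
        rw [← map_mul, inv_mul_cancel, map_one, actOn_one hι] at h2
        have h3 := DFunLike.congr_fun h2 f
        rw [mul_apply_eq_comp] at h3
        rw [← h3] at h1
        exact h1 }
  map_one' := by
    apply opU_injective
    exact actOn_one hι
  map_mul' V W := by
    apply opU_injective
    exact (congrArg (actOn ι) (map_mul opU V W)).trans (actOn_mul hι (opU V) (opU W))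

theorem opU_actU {ι : Fin k → Fin m} (hι : Function.Injective ι) (V : L2 k ≃ₗᵢ[ℂ] L2 k) :
    opU (actU hι V) = actOn ι (opU V) := rfl

theorem actU_eq_of_isActingOn {ι : Fin k → Fin m} (hι : Function.Injective ι)
    {V : L2 k ≃ₗᵢ[ℂ] L2 k} {W : L2 m ≃ₗᵢ[ℂ] L2 m} (h : IsActingOn ι (opU V) (opU W)) :
    actU hι V = W :=
  opU_injective (h.actOn_eq hι)

theorem actU_actU {ι : Fin k → Fin m} {κ : Fin n → Fin k} (hι : Function.Injective ι)
    (hκ : Function.Injective κ) (V : L2 n ≃ₗᵢ[ℂ] L2 n) :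
    actU hι (actU hκ V) = actU (hι.comp hκ) V :=
  opU_injective (actOn_actOn hι hκ (opU V))

theorem actU_mulU {ι : Fin k → Fin m} (hι : Function.Injective ι) {φ : (Fin k → ℝ) → ℂ}
    (hm : Measurable φ) (h1 : ∀ x, ‖φ x‖ = 1) :
    actU hι (mulU volume φ hm h1) = mulU volume (fun x => φ (x ∘ ι))
      (hm.comp (measurable_pi_lambda _ fun _ => measurable_pi_apply _)) (fun _ => h1 _) := by
  refine actU_eq_of_isActingOn hι fun f => ?_
  filter_upwards [ae_ae_extend hι (mulU_ae (φ := fun x => φ (x ∘ ι))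
      (hm.comp (measurable_pi_lambda _ fun _ => measurable_pi_apply _)) (fun _ => h1 _) f),
    sliceLp_ae hι f] with x h2 h3
  filter_upwards [h2, h3, mulU_ae hm h1 (sliceLp ι f x)] with y a b c
  refine a.trans (Eq.trans ?_ c.symm)
  rw [b]
  congr 2
  funext j
  exact hι.extend_apply _ _ _

theorem actU_scalarU {ι : Fin k → Fin m} (hι : Function.Injective ι) {c : ℂ} (hc : ‖c‖ = 1) :
    actU hι (scalarU volume c hc) = scalarU volume c hc :=
  actU_mulU hι measurable_const fun _ => hc

/-- Permutation of the variables. -/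
def permEquiv (σ : Equiv.Perm (Fin m)) : (Fin m → ℝ) ≃ᵐ (Fin m → ℝ) where
  toFun x i := x (σ i)
  invFun x i := x (σ.symm i)
  left_inv x := by simp
  right_inv x := by simp
  measurable_toFun := measurable_pi_lambda _ fun _ => measurable_pi_apply _
  measurable_invFun := measurable_pi_lambda _ fun _ => measurable_pi_apply _

/-- The permutation operator as a unitary operator. -/
def permU (σ : Equiv.Perm (Fin m)) : L2 m ≃ₗᵢ[ℂ] L2 m :=
  compU (permEquiv σ) (measurePreserving_comp_perm σ)

theorem opU_permU (σ : Equiv.Perm (Fin m)) : opU (permU σ) = permOp σ := rfl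

theorem permU_ae (σ : Equiv.Perm (Fin m)) (f : L2 m) : ∀ᵐ x, permU σ f x = f fun i => x (σ i) :=
  compU_ae _ _ f

theorem actU_permU_swap {i j : Fin m} (hι : Function.Injective ![i, j]) :
    actU hι (permU (Equiv.swap 0 1)) = permU (Equiv.swap i j) := by
  refine actU_eq_of_isActingOn hι fun f => ?_
  filter_upwards [ae_ae_extend hι (permU_ae (Equiv.swap i j) f), sliceLp_ae hι f] with x h2 h3
  filter_upwards [h2, permU_ae (Equiv.swap 0 1) (sliceLp ![i, j] f x),
    (measurePreserving_comp_perm (Equiv.swap 0 1)).quasiMeasurePreserving.ae h3] with y a b c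
  refine a.trans (Eq.trans ?_ b.symm)
  rw [c]
  congr 1
  funext l
  by_cases h : ∃ s, ![i, j] s = l
  · obtain ⟨s, rfl⟩ := h
    have e : Equiv.swap i j (![i, j] s) = ![i, j] (Equiv.swap 0 1 s) := by
      fin_cases s <;> simp
    rw [e, hι.extend_apply, hι.extend_apply]
  · have hi : l ≠ i := fun hl => h ⟨0, by simp [hl]⟩
    have hj : l ≠ j := fun hl => h ⟨1, by simp [hl]⟩
    rw [Equiv.swap_apply_of_ne_of_ne hi hj, Function.extend_apply' _ _ _ h,
      Function.extend_apply' _ _ _ h]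

theorem permU_mul (σ τ : Equiv.Perm (Fin m)) : permU σ * permU τ = permU (σ * τ) := by
  ext1 f
  apply Lp.ext
  filter_upwards [permU_ae σ (permU τ f),
    (measurePreserving_comp_perm σ).quasiMeasurePreserving.ae (permU_ae τ f),
    permU_ae (σ * τ) f] with x a b c
  exact a.trans (b.trans c.symm)

theorem permU_one : permU (1 : Equiv.Perm (Fin m)) = 1 := by
  ext1 f
  apply Lp.ext
  exact permU_ae 1 f

/-- With all variables involved nothing is left to freeze: every slice is the same permuted
function. -/
theorem actU_perm (σ : Equiv.Perm (Fin m)) (V : L2 m ≃ₗᵢ[ℂ] L2 m) :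
    actU σ.injective V = permU σ * V * permU σ⁻¹ := by
  refine actU_eq_of_isActingOn σ.injective fun f => ?_
  have hext : ∀ y x : Fin m → ℝ, Function.extend σ y x = fun l => y (σ⁻¹ l) := fun y x => by
    funext l
    have := σ.injective.extend_apply y x (σ⁻¹ l)
    rwa [← Equiv.Perm.mul_apply, mul_inv_cancel, Equiv.Perm.one_apply] at this
  have hs : ∀ x, sliceLp σ f x = permU σ⁻¹ f := fun x => by
    apply sliceLp_eq_of_ae
    filter_upwards [permU_ae σ⁻¹ f] with y hy
    rw [hy, hext]
  refine Filter.Eventually.of_forall fun x => ?_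
  rw [hs]
  simp_rw [hext]
  have h := (measurePreserving_comp_perm σ⁻¹).quasiMeasurePreserving.ae
    (permU_ae σ (V (permU σ⁻¹ f)))
  filter_upwards [h] with y hy
  refine hy.trans ?_
  simp [opU_apply]

end UnitaryOperators

/-! ### Tensor products of functions of one variable -/

section Tensor

theorem measurePreserving_finTwo : MeasurePreserving
    ((MeasurableEquiv.finTwoArrow (α := ℝ)).trans (MeasurableEquiv.prodCongr
      (MeasurableEquiv.funUnique (Fin 1) ℝ).symm (MeasurableEquiv.funUnique (Fin 1) ℝ).symm)) :=
  (((volume_preserving_funUnique (Fin 1) ℝ).symm _).prod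
    ((volume_preserving_funUnique (Fin 1) ℝ).symm _)).comp (volume_preserving_finTwoArrow ℝ)

/-- The function `f(x₁) g(x₂)` of two variables. -/
def tens (f g : L2 1) : L2 2 := compU _ measurePreserving_finTwo (tensorLp f g)

theorem tens_ae (f g : L2 1) : ∀ᵐ x, tens f g x = f (fun _ => x 0) * g (fun _ => x 1) := by
  filter_upwards [compU_ae _ measurePreserving_finTwo (tensorLp f g),
    measurePreserving_finTwo.quasiMeasurePreserving.ae (tensorLp_ae f g)] with x a b
  exact a.trans b

/-- Tensor products span a dense subspace; integrable factors suffice, and for those the Fourier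
transform is given by its integral. -/
theorem ext_tens {B D : L2 2 →L[ℂ] L2 2} (h : ∀ f g : L2 1, Integrable f → Integrable g →
    B (tens f g) = D (tens f g)) : B = D := by
  let E := compU _ measurePreserving_finTwo
  let S : Submodule ℂ (L2 2) := LinearMap.ker (B - D).toLinearMap
  let S' := S.comap E.toLinearEquiv.toLinearMap
  have hS : IsClosed (S : Set (L2 2)) := (B - D).isClosed_ker
  have hS' : S' = ⊤ := eq_top_of_tensorLp_mem (hS.preimage E.continuous) fun f g hf hg => by
    change B (tens f g) - D (tens f g) = 0
    rw [h f g hf hg, sub_self]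
  ext1 f
  have hf : E.symm f ∈ S' := hS' ▸ trivial
  have : B (E (E.symm f)) - D (E (E.symm f)) = 0 := hf
  rw [E.apply_symm_apply] at this
  exact sub_eq_zero.1 this

theorem ext_tensU {V W : L2 2 ≃ₗᵢ[ℂ] L2 2} (h : ∀ f g : L2 1, Integrable f → Integrable g →
    V (tens f g) = W (tens f g)) : V = W :=
  opU_injective (ext_tens h)

theorem injective_vec1 {m : ℕ} (i : Fin m) : Function.Injective ![i] :=
  Function.injective_of_subsingleton _

/-- The factor `r` is constant along each slice, so it passes through `b` as a scalar. -/
theorem actOn_eq_of_tensor {k m : ℕ} {ι : Fin k → Fin m} (hι : Function.Injective ι)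
    (b : L2 k →L[ℂ] L2 k) {r : (Fin m → ℝ) → ℂ} (hr : ∀ x y, r (Function.extend ι y x) = r x)
    {G : L2 k} {F K : L2 m} (hF : ∀ᵐ x, F x = r x * G (x ∘ ι))
    (hK : ∀ᵐ x, K x = r x * b G (x ∘ ι)) : actOn ι b F = K := by
  apply Lp_eq_of_ae_ae_extend hι
  have hc : ∀ (x : Fin m → ℝ) (y : Fin k → ℝ), Function.extend ι y x ∘ ι = y := fun x y => funext fun j => hι.extend_apply _ _ _
  filter_upwards [isActingOn_actOn hι b F, ae_ae_extend hι hF, ae_ae_extend hι hK] with x h1 h2 h3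
  have hs : sliceLp ι F x = r x • G := by
    apply sliceLp_eq_of_ae
    filter_upwards [h2, Lp.coeFn_smul (r x) G] with y a b
    rw [a, hr, hc, b]
    rfl
  rw [hs, map_smul] at h1
  filter_upwards [h1, h3, Lp.coeFn_smul (r x) (b G)] with y a b c
  rw [a, b, hr, hc, c]
  rfl

theorem extend_vec_zero (y : Fin 1 → ℝ) (x : Fin 2 → ℝ) :
    Function.extend ![(0 : Fin 2)] y x = ![y 0, x 1] := by
  funext l
  fin_cases l
  · exact (injective_vec1 (0 : Fin 2)).extend_apply y x 0
  · exact Function.extend_apply' _ _ _ (by simp)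

theorem comp_vec1 {m : ℕ} (x : Fin m → ℝ) (i : Fin m) : x ∘ ![i] = fun _ => x i := by
  funext l
  fin_cases l
  rfl

theorem actOn_zero_tens (b : L2 1 →L[ℂ] L2 1) (f g : L2 1) :
    actOn ![(0 : Fin 2)] b (tens f g) = tens (b f) g := by
  refine actOn_eq_of_tensor (injective_vec1 _) b (r := fun x => g fun _ => x 1) (G := f)
    (fun x y => ?_) ?_ ?_
  · simp
  · filter_upwards [tens_ae f g] with x hx
    rw [hx, comp_vec1, mul_comm]
  · filter_upwards [tens_ae (b f) g] with x hx
    rw [hx, comp_vec1, mul_comm]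

theorem actOn_one_tens (b : L2 1 →L[ℂ] L2 1) (f g : L2 1) :
    actOn ![(1 : Fin 2)] b (tens f g) = tens f (b g) := by
  refine actOn_eq_of_tensor (injective_vec1 _) b (r := fun x => f fun _ => x 0) (G := g)
    (fun x y => ?_) ?_ ?_
  · simp
  · filter_upwards [tens_ae f g] with x hx
    rw [hx, comp_vec1]
  · filter_upwards [tens_ae f (b g)] with x hx
    rw [hx, comp_vec1]

/-- The operator `V` acting on the first variable. -/
def actFst : (L2 1 ≃ₗᵢ[ℂ] L2 1) →* (L2 2 ≃ₗᵢ[ℂ] L2 2) := actU (injective_vec1 0)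

/-- The operator `V` acting on the second variable. -/
def actSnd : (L2 1 ≃ₗᵢ[ℂ] L2 1) →* (L2 2 ≃ₗᵢ[ℂ] L2 2) := actU (injective_vec1 1)

theorem actFst_tens (V : L2 1 ≃ₗᵢ[ℂ] L2 1) (f g : L2 1) : actFst V (tens f g) = tens (V f) g :=
  actOn_zero_tens (opU V) f g

theorem actSnd_tens (V : L2 1 ≃ₗᵢ[ℂ] L2 1) (f g : L2 1) : actSnd V (tens f g) = tens f (V g) :=
  actOn_one_tens (opU V) f g

theorem actFst_actSnd_comm (V W : L2 1 ≃ₗᵢ[ℂ] L2 1) :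
    actFst V * actSnd W = actSnd W * actFst V :=
  ext_tensU fun f g _ _ => by
    simp only [unitary_mul_apply, actFst_tens, actSnd_tens]

/-- The exchange of the two variables. -/
def swapU : L2 2 ≃ₗᵢ[ℂ] L2 2 := permU (Equiv.swap 0 1)

theorem swapU_mul_self : swapU * swapU = 1 := by
  rw [swapU, permU_mul, Equiv.swap_mul_self, permU_one]

theorem swapU_inv : swapU⁻¹ = swapU := inv_eq_of_mul_eq_one_left swapU_mul_self

theorem actU_vec_one_zero (h : Function.Injective ![(1 : Fin 2), 0]) (V : L2 2 ≃ₗᵢ[ℂ] L2 2) :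
    actU h V = swapU * V * swapU := by
  have e : ![(1 : Fin 2), 0] = ⇑(Equiv.swap (0 : Fin 2) 1) := by
    funext l; fin_cases l <;> simp
  have := actU_perm (Equiv.swap (0 : Fin 2) 1) V
  rw [Equiv.swap_inv] at this
  rw [swapU, ← this]
  congr 1
  · simp only [e]

theorem swapU_actFst (V : L2 1 ≃ₗᵢ[ℂ] L2 1) : swapU * actFst V * swapU = actSnd V := by
  have h : Function.Injective ![(1 : Fin 2), 0] := by decide
  rw [← actU_vec_one_zero h, actFst, actU_actU]
  have e : ![(1 : Fin 2), 0] ∘ ![0] = ![1] := by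
    funext l; fin_cases l; rfl
  unfold actSnd
  congr 1
  simp only [e]

theorem swapU_actSnd (V : L2 1 ≃ₗᵢ[ℂ] L2 1) : swapU * actSnd V * swapU = actFst V := by
  rw [← swapU_actFst]
  simp only [mul_assoc, swapU_mul_self, mul_one]
  rw [← mul_assoc, swapU_mul_self, one_mul]

end Tensor

/-! ### The Fourier transform -/

section Fourier

open FourierTransform

variable {m : ℕ}

/-- Composition with a continuous linear equivalence, on Schwartz spaces. -/
def compS {D E : Type*} [NormedAddCommGroup D] [NormedSpace ℝ D] [NormedAddCommGroup E]
    [NormedSpace ℝ E] (g : D ≃L[ℝ] E) : 𝓢(E, ℂ) ≃ₗ[ℂ] 𝓢(D, ℂ) :=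
  LinearEquiv.ofLinearMap (SchwartzMap.compCLMOfContinuousLinearEquiv ℂ g).toLinearMap
    (SchwartzMap.compCLMOfContinuousLinearEquiv ℂ g.symm).toLinearMap
    (by ext f x; simp) (by ext f x; simp)

theorem compS_apply {D E : Type*} [NormedAddCommGroup D] [NormedSpace ℝ D] [NormedAddCommGroup E]
    [NormedSpace ℝ E] (g : D ≃L[ℝ] E) (f : 𝓢(E, ℂ)) (x : D) : compS g f x = f (g x) := rfl

theorem four_pi_sq_inv_ne_zero : ((4 * Real.pi ^ 2)⁻¹ : ℝ) ≠ 0 := by positivity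

theorem two_pi_pow_inv_ne_zero : (((2 * Real.pi : ℝ) : ℂ) ^ m)⁻¹ ≠ 0 := by
  have : (2 * Real.pi : ℝ) ≠ 0 := by positivity
  exact inv_ne_zero (pow_ne_zero _ (by exact_mod_cast this))

/-- The map `x ↦ x / 4π²` into the Euclidean space. -/
def dilation (m : ℕ) : (Fin m → ℝ) ≃L[ℝ] EuclideanSpace ℝ (Fin m) :=
  (ContinuousLinearEquiv.smulLeft (Units.mk0 _ four_pi_sq_inv_ne_zero)).trans
    (EuclideanSpace.equiv (Fin m) ℝ).symm

theorem dilation_apply (x : Fin m → ℝ) :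
    dilation m x = WithLp.toLp 2 ((4 * Real.pi ^ 2)⁻¹ • x) := rfl

/-- The Fourier transform `f ↦ (2π)⁻ᵐ ∫ f(y) exp(i x·y / 2π) dy` on the Schwartz space. -/
def fourierS (m : ℕ) : 𝓢(Fin m → ℝ, ℂ) ≃ₗ[ℂ] 𝓢(Fin m → ℝ, ℂ) :=
  (compS (EuclideanSpace.equiv (Fin m) ℝ)).trans <|
    (fourierEquiv ℂ 𝓢(EuclideanSpace ℝ (Fin m), ℂ)).symm.trans <|
      (compS (dilation m)).trans <| LinearEquiv.smulOfNeZero ℂ _ _ (two_pi_pow_inv_ne_zero (m := m))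

theorem fourierS_eq (f : 𝓢(Fin m → ℝ, ℂ)) : fourierS m f = (((2 * Real.pi : ℝ) : ℂ) ^ m)⁻¹ •
    compS (dilation m) (𝓕⁻ (compS (EuclideanSpace.equiv (Fin m) ℝ) f)) := rfl

/-- The kernel `exp(i x·y / 2π)`. -/
def fKernel (x y : Fin m → ℝ) : ℂ := cexp (I * ((x ⬝ᵥ y : ℝ) : ℂ) / (2 * Real.pi))

theorem fKernel_comm (x y : Fin m → ℝ) : fKernel x y = fKernel y x := by
  rw [fKernel, fKernel, dotProduct_comm]

theorem norm_fKernel (x y : Fin m → ℝ) : ‖fKernel x y‖ = 1 := by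
  rw [fKernel, show I * ((x ⬝ᵥ y : ℝ) : ℂ) / (2 * Real.pi) =
    (((x ⬝ᵥ y) / (2 * Real.pi) : ℝ) : ℂ) * I by push_cast; ring]
  exact Complex.norm_exp_ofReal_mul_I _

theorem continuous_fKernel : Continuous fun p : (Fin m → ℝ) × (Fin m → ℝ) => fKernel p.1 p.2 := by
  unfold fKernel
  have : Continuous fun p : (Fin m → ℝ) × (Fin m → ℝ) => p.1 ⬝ᵥ p.2 :=
    continuous_fst.dotProduct continuous_snd
  fun_prop

/-- The integral defining the Fourier transform. -/
def fIntegral (f : (Fin m → ℝ) → ℂ) (x : Fin m → ℝ) : ℂ :=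
  (((2 * Real.pi : ℝ) : ℂ) ^ m)⁻¹ * ∫ y, f y * fKernel x y

theorem integral_ofLp {E : Type*} [NormedAddCommGroup E] [NormedSpace ℝ E]
    (g : (Fin m → ℝ) → E) : ∫ v : EuclideanSpace ℝ (Fin m), g v.ofLp = ∫ x, g x :=
  (EuclideanSpace.volume_preserving_symm_measurableEquiv_toLp (Fin m)).integral_comp' g

theorem fourierS_apply (f : 𝓢(Fin m → ℝ, ℂ)) (x : Fin m → ℝ) : fourierS m f x = fIntegral f x := by
  rw [fourierS_eq, _root_.smul_apply, compS_apply, SchwartzMap.fourierInv_coe,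
    Real.fourierInv_eq', smul_eq_mul, fIntegral, ← integral_ofLp (fun y => f y * fKernel x y)]
  congr 1
  refine integral_congr_ae (Filter.Eventually.of_forall fun v => ?_)
  simp only [smul_eq_mul]
  rw [mul_comm]
  congr 1
  rw [fKernel, dilation_apply]
  congr 1
  -- The dilation by `1/4π²` converts the kernel `exp(2πi⟨v, ·⟩)` into `exp(ix·v/2π)`.
  have : inner ℝ v (WithLp.toLp 2 ((4 * Real.pi ^ 2)⁻¹ • x)) =
      (4 * Real.pi ^ 2)⁻¹ * (x ⬝ᵥ v.ofLp) := by
    rw [EuclideanSpace.inner_eq_star_dotProduct]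
    simp
  rw [this]
  have hpi : (Real.pi : ℂ) ≠ 0 := by exact_mod_cast Real.pi_ne_zero
  push_cast
  field_simp
  ring

theorem norm_toLp_fourierS (f : 𝓢(Fin m → ℝ, ℂ)) :
    ‖(fourierS m f).toLp 2 (volume : Measure (Fin m → ℝ))‖ =
      ‖f.toLp 2 (volume : Measure (Fin m → ℝ))‖ := by
  have key : ∫ x, ‖fourierS m f x‖ ^ 2 = ∫ x, ‖f x‖ ^ 2 := by
    set g := 𝓕⁻ (compS (EuclideanSpace.equiv (Fin m) ℝ) f) with hg
    have h1 : ∫ x, ‖f x‖ ^ 2 = ∫ v, ‖g v‖ ^ 2 := by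
      have := SchwartzMap.integral_norm_sq_fourier g
      rw [hg, fourier_fourierInv_eq] at this
      rw [← this, ← integral_ofLp (fun x => ‖f x‖ ^ 2)]
      rfl
    have h2 : ∀ x, ‖fourierS m f x‖ ^ 2 = (((2 * Real.pi) ^ m)⁻¹) ^ 2 *
        (fun y => ‖g (WithLp.toLp 2 y)‖ ^ 2) ((4 * Real.pi ^ 2)⁻¹ • x) := fun x => by
      rw [fourierS_eq, _root_.smul_apply, compS_apply, dilation_apply, norm_smul, mul_pow, norm_inv,
        norm_pow, Complex.norm_real, Real.norm_of_nonneg (by positivity)]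
    simp_rw [h2]
    rw [integral_const_mul, Measure.integral_comp_smul volume (fun y => ‖g (WithLp.toLp 2 y)‖ ^ 2), h1,
      ← integral_ofLp (fun y => ‖g (WithLp.toLp 2 y)‖ ^ 2), smul_eq_mul, ← mul_assoc,
      abs_of_nonneg (by positivity)]
    convert one_mul _
    -- The Jacobian `(4π²)ᵐ` of the dilation cancels the square of the normalising factor `(2π)⁻ᵐ`.
    rw [Module.finrank_fin_fun, inv_pow, inv_pow _ m, inv_inv, ← pow_mul, mul_comm m 2, pow_mul, ← inv_pow,
      ← mul_pow]
    rw [show ((2 * Real.pi) ^ 2)⁻¹ * (4 * Real.pi ^ 2) = 1 by field_simp; norm_num, one_pow]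
  rw [SchwartzMap.norm_toLp' two_ne_zero ENNReal.ofNat_ne_top,
    SchwartzMap.norm_toLp' two_ne_zero ENNReal.ofNat_ne_top]
  simpa using congrArg (fun t : ℝ => t ^ (2 : ℝ)⁻¹) key

theorem denseRange_toLp : DenseRange (SchwartzMap.toLpCLM ℂ ℂ 2 (volume : Measure (Fin m → ℝ))) :=
  SchwartzMap.denseRange_toLpCLM ENNReal.ofNat_ne_top

/-- The extension to `L²` of an isometric operator on the Schwartz space. -/
def extendS (v : 𝓢(Fin m → ℝ, ℂ) ≃ₗ[ℂ] 𝓢(Fin m → ℝ, ℂ))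
    (hv : ∀ f, ‖(v f).toLp 2 (volume : Measure (Fin m → ℝ))‖ =
      ‖f.toLp 2 (volume : Measure (Fin m → ℝ))‖) : L2 m ≃ₗᵢ[ℂ] L2 m :=
  v.extendOfIsometry (SchwartzMap.toLpCLM ℂ ℂ 2 volume).toLinearMap
    (SchwartzMap.toLpCLM ℂ ℂ 2 volume).toLinearMap denseRange_toLp denseRange_toLp hv

theorem extendS_toLp (v : 𝓢(Fin m → ℝ, ℂ) ≃ₗ[ℂ] 𝓢(Fin m → ℝ, ℂ))
    (hv : ∀ f, ‖(v f).toLp 2 (volume : Measure (Fin m → ℝ))‖ =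
      ‖f.toLp 2 (volume : Measure (Fin m → ℝ))‖) (f : 𝓢(Fin m → ℝ, ℂ)) :
    extendS v hv (f.toLp 2) = (v f).toLp 2 :=
  LinearEquiv.extendOfIsometry_eq _ _ _ _ _ _ _

/-- The Fourier transform `f ↦ (2π)⁻ᵐ ∫ f(y) exp(i x·y / 2π) dy` on `L²(ℝᵐ)`. -/
def fourierU (m : ℕ) : L2 m ≃ₗᵢ[ℂ] L2 m := extendS (fourierS m) norm_toLp_fourierS

theorem fourierU_toLp (f : 𝓢(Fin m → ℝ, ℂ)) : fourierU m (f.toLp 2) = (fourierS m f).toLp 2 :=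
  extendS_toLp _ _ f

theorem integrable_mul_fKernel {f : (Fin m → ℝ) → ℂ} (hf : Integrable f) (x : Fin m → ℝ) :
    Integrable fun y => f y * fKernel x y := by
  refine hf.mul_bdd (c := 1) ?_ (Filter.Eventually.of_forall fun y => (norm_fKernel x y).le)
  exact (continuous_fKernel.comp (Continuous.prodMk_right x)).aestronglyMeasurable

theorem continuous_fIntegral {f : (Fin m → ℝ) → ℂ} (hf : Integrable f) :
    Continuous (fIntegral f) := by
  refine continuous_const.mul (continuous_of_dominated (bound := fun y => ‖f y‖)
    (fun x => (integrable_mul_fKernel hf x).1)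
    (fun x => Filter.Eventually.of_forall fun y => ?_) hf.norm
    (Filter.Eventually.of_forall fun y => ?_))
  · rw [norm_mul, norm_fKernel, mul_one]
  · have : Continuous fun x : Fin m → ℝ => fKernel x y := by
      have h : Continuous fun x : Fin m → ℝ => x ⬝ᵥ y := continuous_id.dotProduct continuous_const
      unfold fKernel
      fun_prop
    exact this.const_mul (f y)

theorem integral_fIntegral_mul {f g : (Fin m → ℝ) → ℂ} (hf : Integrable f) (hg : Integrable g) :
    ∫ x, fIntegral f x * g x = ∫ y, f y * fIntegral g y := by
  have h : Integrable (fun p : (Fin m → ℝ) × (Fin m → ℝ) => f p.2 * g p.1 * fKernel p.1 p.2) := by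
    refine Integrable.mul_bdd (c := 1) ?_ continuous_fKernel.aestronglyMeasurable
      (Filter.Eventually.of_forall fun p => (norm_fKernel p.1 p.2).le)
    refine (hg.mul_prod hf).congr (Filter.Eventually.of_forall fun p => mul_comm _ _)
  have h1 := integral_integral_swap (f := fun x y => f y * g x * fKernel x y) h
  have e1 : ∀ x, fIntegral f x * g x =
      (((2 * Real.pi : ℝ) : ℂ) ^ m)⁻¹ * ∫ y, f y * g x * fKernel x y := fun x => by
    rw [fIntegral, mul_assoc, ← integral_mul_const]
    congr 2
    funext y
    ring
  have e2 : ∀ y, f y * fIntegral g y =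
      (((2 * Real.pi : ℝ) : ℂ) ^ m)⁻¹ * ∫ x, f y * g x * fKernel x y := fun y => by
    rw [fIntegral, mul_left_comm, ← integral_const_mul]
    congr 2
    funext x
    rw [fKernel_comm]
    ring
  simp_rw [e1, e2, integral_const_mul, h1]

theorem conj_schwartz (g : 𝓢(Fin m → ℝ, ℂ)) : ∃ h : 𝓢(Fin m → ℝ, ℂ), ∀ x, h x = starRingEnd ℂ (g x) :=
  ⟨SchwartzMap.postcompCLM (𝕜 := ℝ) Complex.conjCLE.toContinuousLinearMap g, fun _ => rfl⟩

/-- The symmetry of the kernel gives the identity for Schwartz `f`. Writing the bilinear pairings as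
inner products with a conjugate makes them continuous in `f`, and density finishes. -/
theorem integral_fourierU_mul (f : L2 m) (g : 𝓢(Fin m → ℝ, ℂ)) :
    ∫ x, fourierU m f x * g x = ∫ x, f x * fourierS m g x := by
  obtain ⟨g', hg'⟩ := conj_schwartz g
  obtain ⟨k', hk'⟩ := conj_schwartz (fourierS m g)
  have e : ∀ (u u' : 𝓢(Fin m → ℝ, ℂ)) (_ : ∀ x, u' x = starRingEnd ℂ (u x)) (f : L2 m),
      ∫ x, f x * u x = inner ℂ (u'.toLp 2) f := fun u u' hu f => by
    rw [L2.inner_def]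
    refine integral_congr_ae ?_
    filter_upwards [u'.coeFn_toLp 2] with x hx
    rw [hx, hu, RCLike.inner_apply, Complex.conj_conj]
  rw [e g g' hg', e _ k' hk']
  refine denseRange_toLp.induction_on (p := fun f => inner ℂ (g'.toLp 2) (fourierU m f) =
    inner ℂ (k'.toLp 2) f) f (isClosed_eq ?_ ?_) fun w => ?_
  · exact continuous_const.inner (fourierU m).continuous
  · exact continuous_const.inner continuous_id
  · rw [SchwartzMap.toLpCLM_apply, fourierU_toLp, ← e g g' hg', ← e _ k' hk']
    have h1 : ∫ x, (fourierS m w).toLp 2 volume x * g x = ∫ x, fourierS m w x * g x := by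
      refine integral_congr_ae ?_
      filter_upwards [(fourierS m w).coeFn_toLp 2] with x hx
      rw [hx]
    have h2 : ∫ x, w.toLp 2 volume x * fourierS m g x = ∫ x, w x * fourierS m g x := by
      refine integral_congr_ae ?_
      filter_upwards [w.coeFn_toLp 2] with x hx
      rw [hx]
    rw [h1, h2]
    simp_rw [fourierS_apply]
    exact integral_fIntegral_mul w.integrable g.integrable

/-- Both sides pair equally with every test function, by duality on the one hand and Fubini on the
other. This links the extension by density to the integral in the definition of `R`. -/
theorem fourierU_ae {f : L2 m} (hf : Integrable f) : ∀ᵐ x, fourierU m f x = fIntegral f x := by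
  refine ae_eq_of_integral_contDiff_smul_eq
    ((Lp.memLp (fourierU m f)).locallyIntegrable one_le_two)
    (continuous_fIntegral hf).locallyIntegrable fun φ hφ hφc => ?_
  let u : 𝓢(Fin m → ℝ, ℂ) := HasCompactSupport.toSchwartzMap (f := fun x => (φ x : ℂ))
    (hφc.comp_left (g := Complex.ofReal) rfl) (Complex.ofRealCLM.contDiff.comp hφ)
  have hu : ∀ x, u x = φ x := fun _ => rfl
  have e : ∀ w : (Fin m → ℝ) → ℂ, ∫ x, φ x • w x = ∫ x, w x * u x := fun w => by
    simp_rw [hu, Complex.real_smul, mul_comm]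
  rw [e, e, integral_fourierU_mul, integral_fIntegral_mul hf u.integrable]
  simp_rw [fourierS_apply]

end Fourier

/-! ### Conjugation of positions and momenta by Fourier transform and chirp -/

section Intertwining

open FourierTransform LineDeriv

variable {m : ℕ}

theorem pOp_eq (i : Fin m) (f : 𝓢(Fin m → ℝ, ℂ)) :
    pOp i f = (-(2 * Real.pi * I) : ℂ) • ∂_{(Pi.single i 1 : Fin m → ℝ)} f := rfl

theorem inner_dilation_single (i : Fin m) (v : EuclideanSpace ℝ (Fin m)) :
    inner ℝ v (dilation m (Pi.single i 1)) = (4 * Real.pi ^ 2)⁻¹ * v i := by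
  rw [dilation_apply, EuclideanSpace.inner_eq_star_dotProduct]
  simp

theorem smulLeftCLM_inner_apply (w v : EuclideanSpace ℝ (Fin m))
    (f : 𝓢(EuclideanSpace ℝ (Fin m), ℂ)) :
    SchwartzMap.smulLeftCLM ℂ (inner ℝ · w) f v = inner ℝ v w • f v :=
  SchwartzMap.smulLeftCLM_apply_apply (by fun_prop) f v

theorem fourierS_qOp (i : Fin m) (f : 𝓢(Fin m → ℝ, ℂ)) :
    fourierS m (qOp i f) = pOp i (fourierS m f) := by
  rw [pOp_eq, fourierS_eq, fourierS_eq, lineDerivOp_smul]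
  have h1 : ∀ g : 𝓢(EuclideanSpace ℝ (Fin m), ℂ), ∂_{(Pi.single i 1 : Fin m → ℝ)} (compS (dilation m) g) =
      compS (dilation m) (∂_{dilation m (Pi.single i 1)} g) := fun g =>
    SchwartzMap.lineDerivOp_compCLMOfContinuousLinearEquiv ℂ _ _ g
  rw [h1, SchwartzMap.lineDerivOp_fourierInv_eq, smul_comm]
  congr 1
  rw [← map_smul, ← fourierInv_smul]
  congr 2
  ext v
  rw [_root_.smul_apply, _root_.smul_apply, smulLeftCLM_inner_apply, inner_dilation_single,
    compS_apply, compS_apply, qOp_apply]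
  have hpi : (Real.pi : ℂ) ≠ 0 := by exact_mod_cast Real.pi_ne_zero
  simp only [smul_eq_mul, Complex.real_smul]
  push_cast
  have : (EuclideanSpace.equiv (Fin m) ℝ) v i = v i := rfl
  rw [this]
  field_simp
  linear_combination (4 * (v i : ℂ) * f ((EuclideanSpace.equiv (Fin m) ℝ) v)) * I_sq

theorem fourierS_pOp (i : Fin m) (f : 𝓢(Fin m → ℝ, ℂ)) :
    fourierS m (pOp i f) = -qOp i (fourierS m f) := by
  rw [pOp_eq, map_smul, fourierS_eq, fourierS_eq]
  have h1 : compS (EuclideanSpace.equiv (Fin m) ℝ) (∂_{(Pi.single i 1 : Fin m → ℝ)} f) =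
      ∂_{(EuclideanSpace.equiv (Fin m) ℝ).symm (Pi.single i 1)} (compS (EuclideanSpace.equiv (Fin m) ℝ) f) := by
    refine Eq.symm ((SchwartzMap.lineDerivOp_compCLMOfContinuousLinearEquiv ℂ _ _ f).trans ?_)
    rw [ContinuousLinearEquiv.apply_symm_apply]
    rfl
  rw [h1, SchwartzMap.fourierInv_lineDerivOp_eq]
  ext x
  rw [_root_.neg_apply, qOp_apply]
  simp only [_root_.smul_apply, compS_apply, smulLeftCLM_inner_apply, smul_eq_mul, Complex.real_smul]
  have : inner ℝ (dilation m x) ((EuclideanSpace.equiv (Fin m) ℝ).symm (Pi.single i 1)) =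
      (4 * Real.pi ^ 2)⁻¹ * x i := by
    rw [dilation_apply, EuclideanSpace.inner_eq_star_dotProduct]
    change (Pi.single i (1 : ℝ) : Fin m → ℝ) ⬝ᵥ _ = _
    simp
  rw [this]
  have hpi : (Real.pi : ℂ) ≠ 0 := by exact_mod_cast Real.pi_ne_zero
  push_cast
  field_simp
  rw [I_sq]
  ring

/-- The chirp `exp(i t² / 4π)`. -/
def chirp (t : ℝ) : ℂ := cexp (I * (t : ℂ) ^ 2 / (4 * Real.pi))

theorem norm_cexp_eq_one {z : ℂ} (hz : z.re = 0) : ‖cexp z‖ = 1 := by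
  rw [Complex.norm_exp, hz, Real.exp_zero]

theorem norm_chirp (t : ℝ) : ‖chirp t‖ = 1 := by
  rw [chirp, show I * (t : ℂ) ^ 2 / (4 * Real.pi) = ((t ^ 2 / (4 * Real.pi) : ℝ) : ℂ) * I by
    push_cast; ring]
  exact Complex.norm_exp_ofReal_mul_I _

theorem continuous_chirp : Continuous chirp := by
  unfold chirp
  fun_prop

theorem hasTemperateGrowth_cexp_mul_I :
    Function.HasTemperateGrowth (fun t : ℝ => cexp (t * I)) := by
  have hd : ∀ n : ℕ, iteratedDeriv n (fun t : ℝ => cexp (t * I)) = fun t : ℝ => I ^ n * cexp (t * I) := by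
    intro n
    induction n with
    | zero => simp
    | succ n ih =>
      rw [iteratedDeriv_succ, ih]
      funext t
      have h1 : HasDerivAt (fun t : ℝ => cexp (t * I)) (cexp (t * I) * (1 * I)) t :=
        ((Complex.ofRealCLM.hasDerivAt (x := t)).mul_const I).cexp
      rw [(h1.const_mul (I ^ n)).deriv]
      ring
  refine ⟨(Complex.ofRealCLM.contDiff.mul contDiff_const).cexp, fun n => ⟨0, 1, fun t => ?_⟩⟩
  rw [norm_iteratedFDeriv_eq_norm_iteratedDeriv, hd, norm_mul, norm_pow, Complex.norm_I, one_pow,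
    Complex.norm_exp_ofReal_mul_I]
  simp

theorem hasTemperateGrowth_chirp (c : ℝ) (i : Fin m) :
    Function.HasTemperateGrowth (fun x : Fin m → ℝ => cexp ((c * x i ^ 2 : ℝ) * I)) := by
  have h : Function.HasTemperateGrowth (fun x : Fin m → ℝ => x i) :=
    (ContinuousLinearMap.proj (R := ℝ) (φ := fun _ : Fin m => ℝ) i).hasTemperateGrowth
  exact hasTemperateGrowth_cexp_mul_I.comp ((Function.HasTemperateGrowth.const c).mul (h.pow 2))

theorem chirp_eq (t : ℝ) : chirp t = cexp (((4 * Real.pi)⁻¹ * t ^ 2 : ℝ) * I) := by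
  rw [chirp]
  congr 1
  push_cast
  ring

theorem chirp_inv_eq (t : ℝ) : (chirp t)⁻¹ = cexp ((-(4 * Real.pi)⁻¹ * t ^ 2 : ℝ) * I) := by
  rw [chirp_eq, ← Complex.exp_neg]
  congr 1
  push_cast
  ring

theorem chirp_ne_zero (t : ℝ) : chirp t ≠ 0 := Complex.exp_ne_zero _

theorem hasTemperateGrowth_chirp_coord (i : Fin m) :
    Function.HasTemperateGrowth (fun x : Fin m → ℝ => chirp (x i)) := by
  simp_rw [chirp_eq]
  exact hasTemperateGrowth_chirp _ i

theorem hasTemperateGrowth_chirp_inv_coord (i : Fin m) :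
    Function.HasTemperateGrowth (fun x : Fin m → ℝ => (chirp (x i))⁻¹) := by
  simp_rw [chirp_inv_eq]
  exact hasTemperateGrowth_chirp _ i

/-- Multiplication by the chirp in the `i`-th variable on the Schwartz space. -/
def chirpS (i : Fin m) : 𝓢(Fin m → ℝ, ℂ) ≃ₗ[ℂ] 𝓢(Fin m → ℝ, ℂ) :=
  LinearEquiv.ofLinearMap (SchwartzMap.smulLeftCLM ℂ fun x : Fin m → ℝ => chirp (x i)).toLinearMap
    (SchwartzMap.smulLeftCLM ℂ fun x : Fin m → ℝ => (chirp (x i))⁻¹).toLinearMap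
    (by
      ext f x
      simp [SchwartzMap.smulLeftCLM_apply_apply (hasTemperateGrowth_chirp_coord i),
        SchwartzMap.smulLeftCLM_apply_apply (hasTemperateGrowth_chirp_inv_coord i),
        chirp_ne_zero])
    (by
      ext f x
      simp [SchwartzMap.smulLeftCLM_apply_apply (hasTemperateGrowth_chirp_coord i),
        SchwartzMap.smulLeftCLM_apply_apply (hasTemperateGrowth_chirp_inv_coord i),
        chirp_ne_zero])

theorem chirpS_apply (i : Fin m) (f : 𝓢(Fin m → ℝ, ℂ)) (x : Fin m → ℝ) :
    chirpS i f x = chirp (x i) * f x :=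
  SchwartzMap.smulLeftCLM_apply_apply (hasTemperateGrowth_chirp_coord i) f x

theorem chirpS_qOp (i j : Fin m) (f : 𝓢(Fin m → ℝ, ℂ)) :
    chirpS i (qOp j f) = qOp j (chirpS i f) := by
  ext x
  rw [chirpS_apply, qOp_apply, qOp_apply, chirpS_apply]
  ring

theorem hasDerivAt_chirp (t : ℝ) : HasDerivAt chirp (I * t / (2 * Real.pi) * chirp t) t := by
  have h : HasDerivAt (fun t : ℝ => I * (t : ℂ) ^ 2 / (4 * Real.pi)) (I * t / (2 * Real.pi)) t := by
    have := (((Complex.ofRealCLM.hasDerivAt (x := t)).pow 2).const_mul I).div_const (4 * Real.pi : ℂ)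
    refine this.congr_deriv ?_
    simp only [Complex.ofRealCLM_apply, Complex.ofReal_one]
    push_cast
    ring
  exact h.cexp.congr_deriv (mul_comm _ _)

/-- The product rule: `-2πi` times the logarithmic derivative `ix/2π` of the chirp is `x`, so
conjugation by `K` sends `p` to `p - q`. -/
theorem pOp_chirpS (i j : Fin m) (f : 𝓢(Fin m → ℝ, ℂ)) :
    pOp j (chirpS i f) = chirpS i (pOp j f) + if i = j then chirpS i (qOp j f) else 0 := by
  ext x
  rw [_root_.add_apply, pOp_apply, chirpS_apply, pOp_apply]
  have h1 : HasLineDerivAt ℝ f (lineDeriv ℝ f x (Pi.single j 1)) x (Pi.single j 1) :=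
    (f.differentiable x).lineDifferentiableAt.hasLineDerivAt
  have h2 : HasDerivAt (fun t : ℝ => chirp ((x + t • (Pi.single j 1 : Fin m → ℝ)) i))
      (if i = j then I * x i / (2 * Real.pi) * chirp (x i) else 0) 0 := by
    by_cases hij : i = j
    · subst hij
      have := (hasDerivAt_chirp (x i + id 0)).scomp (0 : ℝ) ((hasDerivAt_id (0 : ℝ)).const_add (x i))
      simpa [Function.comp_def] using this
    · simpa [hij] using hasDerivAt_const (0 : ℝ) (chirp (x i))
  have h3 : HasLineDerivAt ℝ (fun y => chirp (y i) * f y) _ x (Pi.single j 1) := h2.mul h1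
  have h4 : (chirpS i f : (Fin m → ℝ) → ℂ) = fun y => chirp (y i) * f y :=
    funext (chirpS_apply i f)
  rw [h4, h3.lineDeriv]
  have hpi : (Real.pi : ℂ) ≠ 0 := by exact_mod_cast Real.pi_ne_zero
  by_cases hij : i = j
  · subst hij
    simp only [if_true, chirpS_apply, qOp_apply, zero_smul, add_zero]
    field_simp
    linear_combination (-(x i * f x * chirp (x i)) : ℂ) * I_sq
  · simp [hij]
    ring

end Intertwining

/-! ### Gaussians -/

section Gaussian

/-- The Gaussian `exp(-σx²/4π + tx)`. -/
def gaussFun (σ t : ℂ) (x : ℝ) : ℂ := cexp (-(σ / (4 * Real.pi)) * (x : ℂ) ^ 2 + t * x + 0)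

theorem re_div_four_pi_pos {σ : ℂ} (hσ : 0 < σ.re) : 0 < (σ / (4 * Real.pi)).re := by
  rw [show (4 * Real.pi : ℂ) = ((4 * Real.pi : ℝ) : ℂ) by push_cast; ring, Complex.div_ofReal_re]
  positivity

theorem integrable_gaussFun {σ : ℂ} (hσ : 0 < σ.re) (t : ℂ) : Integrable (gaussFun σ t) :=
  integrable_cexp_quadratic (re_div_four_pi_pos hσ) t 0

theorem continuous_gaussFun (σ t : ℂ) : Continuous (gaussFun σ t) := by
  unfold gaussFun
  fun_prop

theorem norm_gaussFun_sq (σ t : ℂ) (x : ℝ) :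
    ‖gaussFun σ t x‖ ^ 2 = ‖gaussFun (2 * σ) (2 * t) x‖ := by
  rw [← norm_pow, gaussFun, gaussFun, ← Complex.exp_nat_mul]
  congr 2
  push_cast
  ring

theorem memLp_gaussFun {σ : ℂ} (hσ : 0 < σ.re) (t : ℂ) :
    MemLp (fun x : Fin 1 → ℝ => gaussFun σ t (x 0)) 2 := by
  have h : MemLp (gaussFun σ t) 2 := by
    rw [memLp_two_iff_integrable_sq_norm (continuous_gaussFun σ t).aestronglyMeasurable]
    simp_rw [norm_gaussFun_sq]
    exact (integrable_gaussFun (by simpa using hσ) _).norm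
  exact h.comp_measurePreserving (volume_preserving_funUnique (Fin 1) ℝ)

/-- The Gaussian as an element of `L²`. -/
def gaussLp (σ t : ℂ) : L2 1 :=
  open Classical in if hσ : 0 < σ.re then (memLp_gaussFun hσ t).toLp else 0

theorem gaussLp_ae {σ : ℂ} (hσ : 0 < σ.re) (t : ℂ) :
    ∀ᵐ x, gaussLp σ t x = gaussFun σ t (x 0) := by
  rw [gaussLp, dif_pos hσ]
  exact (memLp_gaussFun hσ t).coeFn_toLp

theorem integral_fin_one {E : Type*} [NormedAddCommGroup E] [NormedSpace ℝ E] (g : ℝ → E) :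
    ∫ x : Fin 1 → ℝ, g (x 0) = ∫ x, g x :=
  (volume_preserving_funUnique (Fin 1) ℝ).integral_comp' g

theorem integrable_fin_one {g : ℝ → ℂ} (hg : Integrable g) :
    Integrable fun x : Fin 1 → ℝ => g (x 0) :=
  (volume_preserving_funUnique (Fin 1) ℝ).integrable_comp_of_integrable hg

theorem integrable_gaussLp {σ : ℂ} (hσ : 0 < σ.re) (t : ℂ) : Integrable (gaussLp σ t) :=
  (integrable_congr (gaussLp_ae hσ t)).2 (integrable_fin_one (integrable_gaussFun hσ t))

/-- The factor `σ^{-1/2}`. -/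
def rootInv (σ : ℂ) : ℂ := ((2 * Real.pi : ℝ) : ℂ)⁻¹ * (Real.pi / (σ / (4 * Real.pi))) ^ (1 / 2 : ℂ)

theorem fIntegral_one (f : (Fin 1 → ℝ) → ℂ) (x : Fin 1 → ℝ) : fIntegral f x =
    ((2 * Real.pi : ℝ) : ℂ)⁻¹ * ∫ y, f y * cexp (I * x 0 * y 0 / (2 * Real.pi)) := by
  simp only [fIntegral, fKernel, pow_one, dotProduct, Finset.univ_unique, Fin.default_eq_zero,
    Finset.sum_singleton]
  push_cast
  simp_rw [mul_assoc]

theorem fourierU_gaussLp {σ : ℂ} (hσ : 0 < σ.re) (t : ℂ) :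
    fourierU 1 (gaussLp σ t) =
      (rootInv σ * cexp (Real.pi * t ^ 2 / σ)) • gaussLp (1 / σ) (I * t / σ) := by
  have hσ' : 0 < (1 / σ).re := by
    rw [one_div, Complex.inv_re]
    exact div_pos hσ (Complex.normSq_pos.2 fun h => by simp [h] at hσ)
  have h0 : σ ≠ 0 := fun h => by simp [h] at hσ
  have hpi : (Real.pi : ℂ) ≠ 0 := by exact_mod_cast Real.pi_ne_zero
  apply Lp.ext
  filter_upwards [fourierU_ae (integrable_gaussLp hσ t), gaussLp_ae hσ' (I * t / σ),
    Lp.coeFn_smul (rootInv σ * cexp (Real.pi * t ^ 2 / σ)) (gaussLp (1 / σ) (I * t / σ))]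
    with x h1 h2 h3
  rw [h1, h3, Pi.smul_apply, h2, smul_eq_mul, fIntegral_one]
  have h4 : ∫ y, gaussLp σ t y * cexp (I * x 0 * y 0 / (2 * Real.pi)) =
      ∫ y : ℝ, cexp (-(σ / (4 * Real.pi)) * (y : ℂ) ^ 2 + (t + I * x 0 / (2 * Real.pi)) * y + 0) := by
    rw [← integral_fin_one]
    refine integral_congr_ae ?_
    filter_upwards [gaussLp_ae hσ t] with y hy
    rw [hy, gaussFun, ← Complex.exp_add]
    congr 1
    ring
  -- Completing the square in the Gaussian integral; the root in `rootInv` is the principal branch.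
  rw [h4, integral_cexp_quadratic (by rw [Complex.neg_re]; exact neg_lt_zero.2 (re_div_four_pi_pos hσ)), neg_neg,
    rootInv, gaussFun]
  simp only [mul_assoc]
  rw [← Complex.exp_add]
  congr 3
  field_simp
  ring_nf
  rw [I_sq]
  ring

/-- Multiplication by the chirp. -/
def chirpU : L2 1 ≃ₗᵢ[ℂ] L2 1 :=
  mulU volume (fun x => chirp (x 0)) (continuous_chirp.measurable.comp (measurable_pi_apply 0))
    fun _ => norm_chirp _

/-- The chirp is a Gaussian of purely imaginary width, so it only shifts `σ` by `-i`. -/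
theorem chirpU_gaussLp {σ : ℂ} (hσ : 0 < σ.re) (t : ℂ) :
    chirpU (gaussLp σ t) = gaussLp (σ - I) t := by
  have hσ' : 0 < (σ - I).re := by simpa using hσ
  apply Lp.ext
  filter_upwards [mulU_ae (μ := volume) (φ := fun x : Fin 1 → ℝ => chirp (x 0))
    (continuous_chirp.measurable.comp (measurable_pi_apply 0)) (fun _ => norm_chirp _)
    (gaussLp σ t), gaussLp_ae hσ t, gaussLp_ae hσ' t] with x h1 h2 h3
  rw [chirpU, h1, h2, h3, chirp, gaussFun, gaussFun, ← Complex.exp_add]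
  congr 1
  ring

theorem norm_gaussFun_one_zero_le (x : ℝ) : ‖gaussFun 1 0 x‖ ≤ 1 := by
  rw [gaussFun, Complex.norm_exp, Real.exp_le_one_iff, show (-(1 / (4 * Real.pi)) * (x : ℂ) ^ 2 +
    0 * (x : ℂ) + 0 : ℂ) = ((-(1 / (4 * Real.pi)) * x ^ 2 : ℝ) : ℂ) by push_cast; ring,
    Complex.ofReal_re, neg_mul, neg_nonpos]
  positivity

theorem gaussFun_mul_cexp (b x : ℝ) :
    gaussFun 1 0 x * cexp (-(b * I * x)) = starRingEnd ℂ (gaussFun 1 (b * I) x) := by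
  rw [gaussFun, gaussFun, ← Complex.exp_conj, ← Complex.exp_add]
  congr 1
  simp only [map_add, map_mul, map_neg, map_pow, map_div₀, map_one, Complex.conj_ofReal, map_zero,
    Complex.conj_I, map_ofNat]
  ring

/-- Multiplication by the Gaussian. -/
def gaussMul : L2 1 →L[ℂ] L2 1 :=
  mulLp volume (fun x => gaussFun 1 0 (x 0)) 1
    ((continuous_gaussFun 1 0).measurable.comp (measurable_pi_apply 0))
    fun _ => norm_gaussFun_one_zero_le _

theorem gaussMul_ae (f : L2 1) : ∀ᵐ x, gaussMul f x = gaussFun 1 0 (x 0) * f x :=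
  mulLp_ae (φ := fun x : Fin 1 → ℝ => gaussFun 1 0 (x 0))
    ((continuous_gaussFun 1 0).measurable.comp (measurable_pi_apply 0))
    (fun _ => norm_gaussFun_one_zero_le _) f

theorem re_one_pos : (0 : ℝ) < (1 : ℂ).re := by simp

theorem integrable_gaussMul (f : L2 1) : Integrable (gaussMul f) :=
  (integrable_congr (gaussMul_ae f)).2 ((memLp_gaussFun re_one_pos 0).integrable_mul (Lp.memLp f))

theorem fIntegral_gaussMul (f : L2 1) (x : Fin 1 → ℝ) : fIntegral (gaussMul f) x =
    ((2 * Real.pi : ℝ) : ℂ)⁻¹ * inner ℂ (gaussLp 1 ((-(x 0 / (2 * Real.pi)) : ℝ) * I)) f := by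
  rw [fIntegral_one, L2.inner_def]
  congr 1
  refine integral_congr_ae ?_
  filter_upwards [gaussMul_ae f, gaussLp_ae re_one_pos ((-(x 0 / (2 * Real.pi)) : ℝ) * I)]
    with y hy hy'
  rw [hy, hy', RCLike.inner_apply, ← gaussFun_mul_cexp, mul_right_comm, mul_comm]
  congr 3
  push_cast
  ring

/-- These inner products are, up to a constant, the values of the Fourier transform of `f` times a
Gaussian. That product is integrable and the Gaussian has no zeros. -/
theorem eq_zero_of_inner_gaussLp {f : L2 1} (h : ∀ b : ℝ, inner ℂ (gaussLp 1 (b * I)) f = 0) :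
    f = 0 := by
  have hu0 : gaussMul f = 0 := by
    have : fourierU 1 (gaussMul f) = 0 := by
      apply Lp.ext
      filter_upwards [fourierU_ae (integrable_gaussMul f),
        Lp.coeFn_zero ℂ 2 (volume : Measure (Fin 1 → ℝ))] with x a b
      rw [a, b, fIntegral_gaussMul, h, mul_zero, Pi.zero_apply]
    simpa using this
  apply Lp.ext
  filter_upwards [gaussMul_ae f, Lp.coeFn_zero ℂ 2 (volume : Measure (Fin 1 → ℝ))] with x a b
  rw [hu0, b, Pi.zero_apply] at a
  rw [b, Pi.zero_apply]
  exact (mul_eq_zero.1 a.symm).resolve_left (Complex.exp_ne_zero _)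

theorem ext_gaussLp {B D : L2 1 →L[ℂ] L2 1}
    (h : ∀ b : ℝ, B (gaussLp 1 (b * I)) = D (gaussLp 1 (b * I))) : B = D := by
  let S : Submodule ℂ (L2 1) := LinearMap.ker (B - D).toLinearMap
  have hc : IsClosed (S : Set (L2 1)) := (B - D).isClosed_ker
  have hS : S = ⊤ := by
    have : CompleteSpace S := hc.completeSpace_coe
    rw [← Submodule.orthogonal_eq_bot_iff, Submodule.eq_bot_iff]
    intro f hf
    refine eq_zero_of_inner_gaussLp fun b => (Submodule.mem_orthogonal _ _).1 hf _ ?_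
    exact sub_eq_zero.2 (h b)
  ext1 f
  have hf : f ∈ S := hS ▸ trivial
  exact sub_eq_zero.1 hf

theorem ext_gaussLpU {V W : L2 1 ≃ₗᵢ[ℂ] L2 1}
    (h : ∀ b : ℝ, V (gaussLp 1 (b * I)) = W (gaussLp 1 (b * I))) : V = W :=
  opU_injective (ext_gaussLp h)

end Gaussian

/-! ### The rotation -/

section Rotation

/-- The phase `exp(-iπ/12)`. -/
def rho : ℂ := cexp (-(I * Real.pi / 12))

theorem norm_rho : ‖rho‖ = 1 := by
  rw [rho, show -(I * Real.pi / 12) = ((-(Real.pi / 12) : ℝ) : ℂ) * I by push_cast; ring]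
  exact Complex.norm_exp_ofReal_mul_I _

/-- The unitary operator `R`. -/
def rotU : L2 1 ≃ₗᵢ[ℂ] L2 1 := scalarU volume rho norm_rho * (chirpU * fourierU 1)

theorem chirpU_ae (f : L2 1) : ∀ᵐ x, chirpU f x = chirp (x 0) * f x :=
  mulU_ae (φ := fun x : Fin 1 → ℝ => chirp (x 0))
    (continuous_chirp.measurable.comp (measurable_pi_apply 0)) (fun _ => norm_chirp _) f

theorem isRotation_rotU : IsRotation (opU rotU) := fun f hf => by
  filter_upwards [fourierU_ae hf, chirpU_ae (fourierU 1 f),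
    Lp.coeFn_smul rho (chirpU (fourierU 1 f))] with x h1 h2 h3
  rw [opU_apply, rotU, unitary_mul_apply, unitary_mul_apply, scalarU_apply, h3, Pi.smul_apply, h2,
    h1, smul_eq_mul, fIntegral_one, integral_div, sub_eq_add_neg, Complex.exp_add, ← chirp, ← rho]
  push_cast
  ring

/-- The Gaussians are integrable and span a dense subspace, so the integral formula determines the
bounded operator. -/
theorem IsRotation.unique {B D : L2 1 →L[ℂ] L2 1} (hB : IsRotation B) (hD : IsRotation D) :
    B = D :=
  ext_gaussLp fun b => by
    apply Lp.ext
    filter_upwards [hB _ (integrable_gaussLp re_one_pos (b * I)),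
      hD _ (integrable_gaussLp re_one_pos (b * I))] with x h1 h2
    rw [h1, h2]

theorem rotOp_eq : rotOp = opU rotU :=
  IsRotation.unique (Classical.epsilon_spec (p := IsRotation) ⟨_, isRotation_rotU⟩) isRotation_rotU

theorem rootInv_one : rootInv 1 = 1 := by
  have h : (Real.pi : ℂ) / (1 / (4 * Real.pi)) = ((((2 * Real.pi) ^ 2 : ℝ)) : ℂ) := by
    push_cast
    have hpi : (Real.pi : ℂ) ≠ 0 := by exact_mod_cast Real.pi_ne_zero
    field_simp
    norm_num
  rw [rootInv, h, show (1 / 2 : ℂ) = ((1 / 2 : ℝ) : ℂ) by push_cast; rfl,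
    ← Complex.ofReal_cpow (by positivity), ← Real.sqrt_eq_rpow, Real.sqrt_sq (by positivity),
    inv_mul_cancel₀]
  have : (2 * Real.pi : ℝ) ≠ 0 := by positivity
  exact_mod_cast this

theorem one_add_I_eq : 1 + I = ((Real.sqrt 2 : ℝ) : ℂ) * cexp ((Real.pi / 4 : ℝ) * I) := by
  rw [Complex.exp_mul_I, ← Complex.ofReal_cos, ← Complex.ofReal_sin, Real.cos_pi_div_four,
    Real.sin_pi_div_four]
  have h : ((Real.sqrt 2 : ℝ) : ℂ) * ((Real.sqrt 2 : ℝ) : ℂ) = 2 := by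
    rw [← Complex.ofReal_mul, Real.mul_self_sqrt (by norm_num)]
    norm_num
  push_cast
  linear_combination (-(1 + I) / 2) * h

theorem cpow_half {r : ℝ} (hr : 0 < r) :
    ((r : ℂ) * cexp ((Real.pi / 4 : ℝ) * I)) ^ (1 / 2 : ℂ) =
      ((Real.sqrt r : ℝ) : ℂ) * cexp ((Real.pi / 8 : ℝ) * I) := by
  have h0 : (r : ℂ) * cexp ((Real.pi / 4 : ℝ) * I) ≠ 0 :=
    mul_ne_zero (by exact_mod_cast hr.ne') (Complex.exp_ne_zero _)
  have hp := Real.pi_pos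
  rw [Complex.cpow_def_of_ne_zero h0, Complex.log_ofReal_mul hr (Complex.exp_ne_zero _),
    Complex.log_exp (by simp; linarith) (by simp; linarith), add_mul, Complex.exp_add,
    Real.sqrt_eq_rpow, Complex.ofReal_cpow hr.le, Complex.cpow_def_of_ne_zero (by exact_mod_cast hr.ne'),
    ← Complex.ofReal_log hr.le]
  push_cast
  congr 2
  ring

/-- Formally this is `(-i)^{-1/2}`, since `(1 - i)²/2 = -i`. Principal roots are not multiplicative
in general, hence the evaluation in polar form: each root contributes the argument `π/8`. -/
theorem rootInv_mul_rootInv : rootInv (1 - I) * rootInv ((1 - I) / 2) = cexp ((Real.pi / 4 : ℝ) * I) := by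
  have hpi : (Real.pi : ℂ) ≠ 0 := by exact_mod_cast Real.pi_ne_zero
  have hI : (1 - I) ≠ 0 := fun h => by simpa using congrArg Complex.re h
  have hp := Real.pi_pos
  have e1 : (Real.pi : ℂ) / ((1 - I) / (4 * Real.pi)) =
      ((2 * Real.pi ^ 2 * Real.sqrt 2 : ℝ) : ℂ) * cexp ((Real.pi / 4 : ℝ) * I) := by
    push_cast
    have := one_add_I_eq
    push_cast at this
    rw [mul_assoc, ← this]
    field_simp
    ring_nf
    rw [I_sq]
    ring
  have e2 : (Real.pi : ℂ) / ((1 - I) / 2 / (4 * Real.pi)) =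
      ((4 * Real.pi ^ 2 * Real.sqrt 2 : ℝ) : ℂ) * cexp ((Real.pi / 4 : ℝ) * I) := by
    push_cast
    have := one_add_I_eq
    push_cast at this
    rw [mul_assoc, ← this]
    field_simp
    ring_nf
    rw [I_sq]
    ring
  rw [rootInv, rootInv, e1, e2, cpow_half (by positivity), cpow_half (by positivity)]
  have e3 : Real.sqrt (2 * Real.pi ^ 2 * Real.sqrt 2) * Real.sqrt (4 * Real.pi ^ 2 * Real.sqrt 2) =
      (2 * Real.pi) ^ 2 := by
    rw [← Real.sqrt_mul (by positivity), Real.sqrt_eq_iff_mul_self_eq (by positivity) (by positivity)]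
    have := Real.mul_self_sqrt (show (0 : ℝ) ≤ 2 by norm_num)
    linear_combination (8 * Real.pi ^ 4) * this
  have e4 : cexp ((Real.pi / 8 : ℝ) * I) * cexp ((Real.pi / 8 : ℝ) * I) =
      cexp ((Real.pi / 4 : ℝ) * I) := by
    rw [← Complex.exp_add]
    congr 1
    push_cast
    ring
  rw [← e4]
  clear e1 e2
  generalize Real.sqrt (2 * Real.pi ^ 2 * Real.sqrt 2) = u at e3 ⊢
  generalize Real.sqrt (4 * Real.pi ^ 2 * Real.sqrt 2) = v at e3 ⊢
  have e5 := congrArg (fun t : ℝ => (t : ℂ)) e3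
  push_cast at e5 ⊢
  field_simp
  linear_combination e5

/-- Up to scalars `R` sends the Gaussian with parameters `(σ, t)` to `(1/σ - i, it/σ)`. From `σ = 1`
the widths are `1`, `1 - i`, `(1 - i)/2`, `1`. -/
theorem rotU_pow_three : rotU ^ 3 = 1 := by
  refine ext_gaussLpU fun b => ?_
  have s1 : 0 < (1 / (1 : ℂ)).re := by simp
  have s2 : 0 < (1 / (1 : ℂ) - I).re := by simp
  have s3 : 0 < (1 / (1 / (1 : ℂ) - I)).re := by simp [Complex.inv_re, Complex.normSq_apply]
  have s4 : 0 < (1 / (1 / (1 : ℂ) - I) - I).re := by simp [Complex.inv_re, Complex.normSq_apply]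
  have s5 : 0 < (1 / (1 / (1 / (1 : ℂ) - I) - I)).re := by
    simp [Complex.inv_re, Complex.inv_im, Complex.normSq_apply]
    norm_num
  have hI : (1 - I) ≠ 0 := fun h => by simpa using congrArg Complex.re h
  have hI' : (1 + I) ≠ 0 := fun h => by simpa using congrArg Complex.re h
  have c1 : 1 / (1 / (1 : ℂ) - I) - I = (1 - I) / 2 := by
    field_simp
    ring_nf
    rw [I_sq]
    ring
  have c2 : 1 / (1 / (1 / (1 : ℂ) - I) - I) - I = 1 := by
    rw [c1]
    field_simp
    ring_nf
    rw [I_sq]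
    ring
  have step : ∀ {σ : ℂ} (_ : 0 < σ.re) (_ : 0 < (1 / σ).re) (t : ℂ), rotU (gaussLp σ t) =
      (rho * (rootInv σ * cexp (Real.pi * t ^ 2 / σ))) • gaussLp (1 / σ - I) (I * t / σ) := by
    intro σ h1 h2 t
    rw [rotU, unitary_mul_apply, unitary_mul_apply, fourierU_gaussLp h1, map_smul,
      chirpU_gaussLp h2, map_smul, scalarU_apply, smul_smul, mul_comm]
  rw [pow_three, unitary_mul_apply, unitary_mul_apply, step re_one_pos s1, map_smul, map_smul,
    step s2 s3, map_smul, step s4 s5, c2, smul_smul, smul_smul]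
  -- The linear parameter returns as well, since `i³ = -i` is the product of the three widths.
  have e1 : I * (I * (I * (b * I) / 1) / (1 / 1 - I)) / (1 / (1 / 1 - I) - I) = b * I := by
    rw [c1]
    field_simp
    ring_nf
    simp only [I_sq, I_pow_three]
    ring
  rw [e1]
  change _ = gaussLp 1 (b * I)
  convert one_smul ℂ (gaussLp 1 (b * I))
  rw [c1, rootInv_one]
  -- The phase `exp(-iπ/12)` in `R` is exactly what compensates the roots after three steps.
  have e2 : rho * rho * rho * cexp ((Real.pi / 4 : ℝ) * I) = 1 := by
    rw [rho, ← Complex.exp_add, ← Complex.exp_add, ← Complex.exp_add, ← Complex.exp_zero]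
    congr 1
    push_cast
    ring
  have e3 : cexp (Real.pi * (b * I) ^ 2 / 1) *
      cexp (Real.pi * (I * (b * I) / 1) ^ 2 / (1 / 1 - I)) *
      cexp (Real.pi * (I * (I * (b * I) / 1) / (1 / 1 - I)) ^ 2 / ((1 - I) / 2)) = 1 := by
    rw [← Complex.exp_add, ← Complex.exp_add]
    refine (congrArg cexp ?_).trans Complex.exp_zero
    have h5 : I ^ 5 = I := by rw [pow_succ, I_pow_four, one_mul]
    have h6 : I ^ 6 = -1 := by rw [pow_succ, h5, I_mul_I]
    field_simp
    ring_nf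
    simp only [I_sq, I_pow_three, I_pow_four, h5, h6]
    ring
  have e4 := rootInv_mul_rootInv
  rw [show (1 : ℂ) / 1 - I = 1 - I by rw [div_one]] at e3 ⊢
  rw [← e4] at e2
  have e5 := congrArg₂ (· * ·) e3 e2
  linear_combination e5

end Rotation

/-! ### Translations, modulations and the parity -/

section Translation

/-- The translation `f(x) ↦ f(x + a)`. -/
def shiftU (a : ℝ) : L2 1 ≃ₗᵢ[ℂ] L2 1 :=
  compU (MeasurableEquiv.addRight (fun _ => a)) (measurePreserving_add_right volume _)

theorem shiftU_ae (a : ℝ) (f : L2 1) : ∀ᵐ x, shiftU a f x = f (x + fun _ => a) := compU_ae _ _ f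

theorem norm_modFun (a t : ℝ) : ‖cexp (((-(a * t / (2 * Real.pi)) : ℝ) : ℂ) * I)‖ = 1 :=
  Complex.norm_exp_ofReal_mul_I _

/-- The modulation `f(x) ↦ exp(-i a x / 2π) f(x)`. -/
def modU (a : ℝ) : L2 1 ≃ₗᵢ[ℂ] L2 1 :=
  mulU volume (fun x => cexp (((-(a * x 0 / (2 * Real.pi)) : ℝ) : ℂ) * I)) (by fun_prop)
    fun _ => norm_modFun _ _

theorem modU_ae (a : ℝ) (f : L2 1) : ∀ᵐ x, modU a f x =
    cexp (((-(a * x 0 / (2 * Real.pi)) : ℝ) : ℂ) * I) * f x := mulU_ae _ _ f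

theorem shiftU_gaussLp (a : ℝ) {σ : ℂ} (hσ : 0 < σ.re) (t : ℂ) : shiftU a (gaussLp σ t) =
    cexp (-(σ * a ^ 2 / (4 * Real.pi)) + t * a) • gaussLp σ (t - σ * a / (2 * Real.pi)) := by
  apply Lp.ext
  filter_upwards [shiftU_ae a (gaussLp σ t),
    (measurePreserving_add_right volume (fun _ : Fin 1 => a)).quasiMeasurePreserving.ae
      (gaussLp_ae hσ t), gaussLp_ae hσ (t - σ * a / (2 * Real.pi)),
    Lp.coeFn_smul (cexp (-(σ * a ^ 2 / (4 * Real.pi)) + t * a))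
      (gaussLp σ (t - σ * a / (2 * Real.pi)))] with x h1 h2 h3 h4
  rw [h1, h2, h4, Pi.smul_apply, h3, smul_eq_mul, gaussFun, gaussFun, ← Complex.exp_add]
  congr 1
  rw [Pi.add_apply]
  push_cast
  ring

theorem modU_gaussLp (a : ℝ) {σ : ℂ} (hσ : 0 < σ.re) (t : ℂ) : modU a (gaussLp σ t) =
    gaussLp σ (t - I * a / (2 * Real.pi)) := by
  apply Lp.ext
  filter_upwards [modU_ae a (gaussLp σ t), gaussLp_ae hσ t, gaussLp_ae hσ (t - I * a / (2 * Real.pi))]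
    with x h1 h2 h3
  rw [h1, h2, h3, gaussFun, gaussFun, ← Complex.exp_add]
  congr 1
  push_cast
  ring

theorem fourierU_one_gaussLp (t : ℂ) : fourierU 1 (gaussLp 1 t) =
    cexp (Real.pi * t ^ 2) • gaussLp 1 (I * t) := by
  rw [fourierU_gaussLp re_one_pos, rootInv_one, one_mul, div_one, div_one, div_one]

/-- Compared on Gaussians, where translation and modulation only change the linear parameter and a
scalar. -/
theorem fourierU_mul_shiftU (a : ℝ) : fourierU 1 * shiftU a = modU a * fourierU 1 := by
  refine ext_gaussLpU fun b => ?_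
  have hpi : (Real.pi : ℂ) ≠ 0 := by exact_mod_cast Real.pi_ne_zero
  rw [unitary_mul_apply, unitary_mul_apply, shiftU_gaussLp a re_one_pos, map_smul,
    fourierU_one_gaussLp, fourierU_one_gaussLp, map_smul, modU_gaussLp a re_one_pos, smul_smul,
    ← Complex.exp_add]
  congr 2
  · field_simp
    ring
  · field_simp

theorem fourierU_mul_modU (a : ℝ) : fourierU 1 * modU a = shiftU (-a) * fourierU 1 := by
  refine ext_gaussLpU fun b => ?_
  have hpi : (Real.pi : ℂ) ≠ 0 := by exact_mod_cast Real.pi_ne_zero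
  rw [unitary_mul_apply, unitary_mul_apply, modU_gaussLp a re_one_pos,
    fourierU_one_gaussLp, fourierU_one_gaussLp, map_smul, shiftU_gaussLp _ re_one_pos, smul_smul,
    ← Complex.exp_add]
  congr 2
  · push_cast
    field_simp
    ring_nf
    simp only [I_sq]
    ring
  · push_cast
    field_simp
    ring_nf
    simp only [I_sq]
    ring

theorem measurePreserving_negEquiv (m : ℕ) :
    MeasurePreserving (MeasurableEquiv.neg (Fin m → ℝ)) volume volume :=
  Measure.measurePreserving_neg volume

/-- The parity `f(x) ↦ f(-x)`. -/
def parityU (m : ℕ) : L2 m ≃ₗᵢ[ℂ] L2 m :=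
  compU (MeasurableEquiv.neg _) (measurePreserving_negEquiv m)

theorem parityU_ae {m : ℕ} (f : L2 m) : ∀ᵐ x, parityU m f x = f (-x) := compU_ae _ _ f

theorem parityU_gaussLp {σ : ℂ} (hσ : 0 < σ.re) (t : ℂ) :
    parityU 1 (gaussLp σ t) = gaussLp σ (-t) := by
  apply Lp.ext
  filter_upwards [parityU_ae (gaussLp σ t),
    (Measure.measurePreserving_neg (volume : Measure (Fin 1 → ℝ))).quasiMeasurePreserving.ae
      (gaussLp_ae hσ t), gaussLp_ae hσ (-t)] with x h1 h2 h3
  rw [h1, h2, h3, gaussFun, gaussFun, Pi.neg_apply]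
  congr 1
  push_cast
  ring

theorem fourierU_sq : fourierU 1 * fourierU 1 = parityU 1 := by
  refine ext_gaussLpU fun b => ?_
  rw [unitary_mul_apply, fourierU_one_gaussLp, map_smul, fourierU_one_gaussLp,
    parityU_gaussLp re_one_pos, smul_smul, ← Complex.exp_add]
  convert one_smul ℂ (gaussLp 1 (-(b * I))) using 2
  · rw [← Complex.exp_zero]
    congr 1
    ring_nf
    simp only [I_sq, I_pow_four]
    ring
  · rw [← mul_assoc, I_mul_I, neg_one_mul]

end Translation

/-! ### Fibred operators in two variables -/

section Fibred

/-- `V` acts on the first variable as `w (x₂)`, for each value of the second variable `x₂`. -/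
def IsFibred (w : ℝ → L2 1 ≃ₗᵢ[ℂ] L2 1) (V : L2 2 ≃ₗᵢ[ℂ] L2 2) : Prop :=
  ∀ f : L2 2, ∀ᵐ x : Fin 2 → ℝ, ∀ᵐ y : Fin 1 → ℝ,
    V f ![y 0, x 1] = w (x 1) (sliceLp ![0] f x) y

theorem IsFibred.unique {w : ℝ → L2 1 ≃ₗᵢ[ℂ] L2 1} {V V' : L2 2 ≃ₗᵢ[ℂ] L2 2} (h : IsFibred w V)
    (h' : IsFibred w V') : V = V' := by
  ext1 f
  apply Lp_eq_of_ae_ae_extend (injective_vec1 (0 : Fin 2))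
  filter_upwards [h f, h' f] with x h1 h2
  filter_upwards [h1, h2] with y h3 h4
  rw [extend_vec_zero, h3, h4]

theorem IsFibred.mul {w w' : ℝ → L2 1 ≃ₗᵢ[ℂ] L2 1} {V V' : L2 2 ≃ₗᵢ[ℂ] L2 2} (h : IsFibred w V)
    (h' : IsFibred w' V') : IsFibred (fun t => w t * w' t) (V * V') := fun f => by
  filter_upwards [h (V' f), h' f] with x h1 h2
  have h3 : sliceLp ![0] (V' f) x = w' (x 1) (sliceLp ![0] f x) := by
    refine sliceLp_eq_of_ae ?_
    simp_rw [extend_vec_zero]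
    exact h2
  rw [h3] at h1
  exact h1

theorem isFibred_actFst (V : L2 1 ≃ₗᵢ[ℂ] L2 1) : IsFibred (fun _ => V) (actFst V) := fun f => by
  filter_upwards [isActingOn_actOn (injective_vec1 (0 : Fin 2)) (opU V) f] with x hx
  simp_rw [extend_vec_zero] at hx
  exact hx

theorem sliceLp_zero_ae (f : L2 2) : ∀ᵐ x : Fin 2 → ℝ, ∀ᵐ y : Fin 1 → ℝ,
    sliceLp ![0] f x y = f ![y 0, x 1] := by
  filter_upwards [sliceLp_ae (injective_vec1 (0 : Fin 2)) f] with x hx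
  simp_rw [extend_vec_zero] at hx
  exact hx

theorem ae_ae_vec {P : (Fin 2 → ℝ) → Prop} (h : ∀ᵐ x, P x) :
    ∀ᵐ x : Fin 2 → ℝ, ∀ᵐ y : Fin 1 → ℝ, P ![y 0, x 1] := by
  filter_upwards [ae_ae_extend (injective_vec1 (0 : Fin 2)) h] with x hx
  simp_rw [extend_vec_zero] at hx
  exact hx

/-- The shear `(x₁, x₂) ↦ (x₁ + x₂, x₂)`. -/
def shearEquiv : (Fin 2 → ℝ) ≃ᵐ (Fin 2 → ℝ) where
  toFun x := ![x 0 + x 1, x 1]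
  invFun x := ![x 0 - x 1, x 1]
  left_inv x := by ext l; fin_cases l <;> simp
  right_inv x := by ext l; fin_cases l <;> simp
  measurable_toFun := by
    refine measurable_pi_lambda _ fun l => ?_
    fin_cases l <;> simp <;> fun_prop
  measurable_invFun := by
    refine measurable_pi_lambda _ fun l => ?_
    fin_cases l <;> simp <;> fun_prop

theorem measurePreserving_shear : MeasurePreserving shearEquiv volume volume := by
  let t : Matrix.TransvectionStruct (Fin 2) ℝ := { i := 0, j := 1, hij := by decide, c := 1 }
  have h : (shearEquiv : (Fin 2 → ℝ) → Fin 2 → ℝ) = Matrix.toLin' t.toMatrix := by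
    funext x l
    fin_cases l <;> simp [t, shearEquiv, Matrix.TransvectionStruct.toMatrix, Matrix.transvection,
      Matrix.single_mulVec]
  rw [h]
  exact Real.volume_preserving_transvectionStruct t

/-- The operator `S f(x₁, x₂) = f(x₁ + x₂, x₂)`. -/
def shearU : L2 2 ≃ₗᵢ[ℂ] L2 2 := compU shearEquiv measurePreserving_shear

theorem shearU_ae (f : L2 2) : ∀ᵐ x, shearU f x = f ![x 0 + x 1, x 1] := compU_ae _ _ f

theorem shearU_inv_ae (f : L2 2) : ∀ᵐ x, shearU⁻¹ f x = f ![x 0 - x 1, x 1] := compU_symm_ae _ _ f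

theorem isFibred_shear_aux {c : ℝ} {V : L2 2 ≃ₗᵢ[ℂ] L2 2}
    (hV : ∀ f : L2 2, ∀ᵐ x, V f x = f ![x 0 + c * x 1, x 1]) :
    IsFibred (fun t => shiftU (c * t)) V := fun f => by
  filter_upwards [ae_ae_vec (hV f), sliceLp_zero_ae f] with x h1 h2
  filter_upwards [h1, shiftU_ae (c * x 1) (sliceLp ![0] f x),
    (measurePreserving_add_right volume (fun _ : Fin 1 => c * x 1)).quasiMeasurePreserving.ae h2]
    with y h3 h4 h5
  rw [h3, h4, h5]
  rfl

theorem isFibred_shearU : IsFibred shiftU shearU := by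
  have := isFibred_shear_aux (c := 1) fun f => by simpa using shearU_ae f
  simpa using this

theorem isFibred_shearU_inv : IsFibred (fun t => shiftU (-t)) shearU⁻¹ := by
  have := isFibred_shear_aux (c := -1) fun f => by simpa [sub_eq_add_neg] using shearU_inv_ae f
  simp only [neg_one_mul] at this
  exact this

/-- Multiplication by `exp(-i x₁ x₂ / 2π)`. -/
def crossU : L2 2 ≃ₗᵢ[ℂ] L2 2 :=
  mulU volume (fun x => cexp (((-(x 1 * x 0 / (2 * Real.pi)) : ℝ) : ℂ) * I)) (by fun_prop)
    fun _ => norm_modFun _ _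

theorem crossU_ae (f : L2 2) : ∀ᵐ x, crossU f x =
    cexp (((-(x 1 * x 0 / (2 * Real.pi)) : ℝ) : ℂ) * I) * f x := mulU_ae _ _ f

theorem isFibred_crossU : IsFibred modU crossU := fun f => by
  filter_upwards [ae_ae_vec (crossU_ae f), sliceLp_zero_ae f] with x h1 h2
  filter_upwards [h1, modU_ae (x 1) (sliceLp ![0] f x), h2] with y h3 h4 h5
  rw [h3, h4, h5]
  rfl

/-- The Fourier transform in the first variable. -/
def fourierFst : L2 2 ≃ₗᵢ[ℂ] L2 2 := actFst (fourierU 1)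

/-- The Fourier transform in the second variable. -/
def fourierSnd : L2 2 ≃ₗᵢ[ℂ] L2 2 := actSnd (fourierU 1)

/-- The shear is translation of `x₁` by `x₂` and `C` is modulation by `x₂`, so this is the
one-variable relation on each fibre. -/
theorem fourierFst_mul_shearU : fourierFst * shearU = crossU * fourierFst := by
  refine ((isFibred_actFst _).mul isFibred_shearU).unique ?_
  simp_rw [fourierU_mul_shiftU]
  exact isFibred_crossU.mul (isFibred_actFst _)

theorem fourierFst_mul_crossU : fourierFst * crossU = shearU⁻¹ * fourierFst := by
  refine ((isFibred_actFst _).mul isFibred_crossU).unique ?_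
  simp_rw [fourierU_mul_modU]
  exact isFibred_shearU_inv.mul (isFibred_actFst _)

end Fibred

/-! ### Substitutions and multiplications in two variables -/

section TwoVariables

theorem measurePreserving_trans {X : Type*} [MeasurableSpace X] {μ : Measure X} {e e' : X ≃ᵐ X}
    (he : MeasurePreserving e μ μ) (he' : MeasurePreserving e' μ μ) :
    MeasurePreserving (e.trans e') μ μ :=
  he'.comp he

theorem compU_mul {X : Type*} [MeasurableSpace X] {μ : Measure X} {e e' : X ≃ᵐ X}
    (he : MeasurePreserving e μ μ) (he' : MeasurePreserving e' μ μ) :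
    compU e he * compU e' he' = compU (e.trans e') (measurePreserving_trans he he') := by
  ext1 f
  apply Lp.ext
  filter_upwards [compU_ae e he (compU e' he' f), he.quasiMeasurePreserving.ae (compU_ae e' he' f),
    compU_ae (e.trans e') (measurePreserving_trans he he') f] with x h1 h2 h3
  exact h1.trans (h2.trans h3.symm)

theorem compU_congr {X : Type*} [MeasurableSpace X] {μ : Measure X} {e e' : X ≃ᵐ X}
    (he : MeasurePreserving e μ μ) (h : e = e') : compU e he = compU e' (h ▸ he) := by
  subst h; rfl

theorem compU_mul_mulU {X : Type*} [MeasurableSpace X] {μ : Measure X} {e : X ≃ᵐ X}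
    (he : MeasurePreserving e μ μ) {φ : X → ℂ} (hm : Measurable φ) (h1 : ∀ x, ‖φ x‖ = 1) :
    compU e he * mulU μ φ hm h1 =
      mulU μ (fun x => φ (e x)) (hm.comp e.measurable) (fun _ => h1 _) * compU e he := by
  ext1 f
  apply Lp.ext
  filter_upwards [compU_ae e he (mulU μ φ hm h1 f), he.quasiMeasurePreserving.ae (mulU_ae hm h1 f),
    mulU_ae (hm.comp e.measurable) (fun _ => h1 _) (compU e he f), compU_ae e he f] with x a b c d
  exact (a.trans b).trans (c.trans (congrArg _ d)).symm

/-- The reflection `(x₁, x₂) ↦ (x₁, -x₂)`. -/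
def reflEquiv : (Fin 2 → ℝ) ≃ᵐ (Fin 2 → ℝ) where
  toFun x := ![x 0, -x 1]
  invFun x := ![x 0, -x 1]
  left_inv x := by ext l; fin_cases l <;> simp
  right_inv x := by ext l; fin_cases l <;> simp
  measurable_toFun := by
    refine measurable_pi_lambda _ fun l => ?_
    fin_cases l <;> simp <;> fun_prop
  measurable_invFun := by
    refine measurable_pi_lambda _ fun l => ?_
    fin_cases l <;> simp <;> fun_prop

theorem measurePreserving_refl : MeasurePreserving reflEquiv volume volume := by
  have h := volume_preserving_pi (f := (![id, Neg.neg] : Fin 2 → ℝ → ℝ)) fun i => by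
    fin_cases i
    · exact MeasurePreserving.id volume
    · exact Measure.measurePreserving_neg volume
  have e : (reflEquiv : (Fin 2 → ℝ) → Fin 2 → ℝ) =
      fun x i => (![id, Neg.neg] : Fin 2 → ℝ → ℝ) i (x i) := by
    funext x l
    fin_cases l <;> rfl
  rw [e]
  exact h

theorem ae_comp_coord {m : ℕ} (i : Fin m) {P : (Fin 1 → ℝ) → Prop} (h : ∀ᵐ y, P y) :
    ∀ᵐ x : Fin m → ℝ, P fun _ => x i :=
  (((volume_preserving_funUnique (Fin 1) ℝ).symm _).quasiMeasurePreserving.comp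
    (Measure.quasiMeasurePreserving_eval (fun _ => volume) i)).ae h

theorem measurePreserving_permEquiv {m : ℕ} (σ : Equiv.Perm (Fin m)) :
    MeasurePreserving (permEquiv σ) volume volume :=
  measurePreserving_comp_perm σ

theorem swapU_eq : swapU = compU (permEquiv (Equiv.swap 0 1)) (measurePreserving_permEquiv _) :=
  rfl

theorem actSnd_parityU : actSnd (parityU 1) = compU reflEquiv measurePreserving_refl := by
  refine ext_tensU fun f g _ _ => ?_
  rw [actSnd_tens]
  apply Lp.ext
  filter_upwards [tens_ae f (parityU 1 g), compU_ae reflEquiv measurePreserving_refl (tens f g),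
    measurePreserving_refl.quasiMeasurePreserving.ae (tens_ae f g),
    ae_comp_coord 1 (parityU_ae g)] with x h1 h2 h3 h4
  rw [h1, h2, h3, h4]
  rfl

theorem actFst_mul_actSnd_parityU :
    actFst (parityU 1) * actSnd (parityU 1) = parityU 2 := by
  refine ext_tensU fun f g _ _ => ?_
  rw [unitary_mul_apply, actSnd_tens, actFst_tens]
  apply Lp.ext
  filter_upwards [tens_ae (parityU 1 f) (parityU 1 g), parityU_ae (tens f g),
    (Measure.measurePreserving_neg (volume : Measure (Fin 2 → ℝ))).quasiMeasurePreserving.ae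
      (tens_ae f g), ae_comp_coord 0 (parityU_ae f), ae_comp_coord 1 (parityU_ae g)]
    with x h1 h2 h3 h4 h5
  rw [h1, h2, h3, h4, h5]
  rfl

theorem fourierFst_mul_fourierSnd_eq : fourierFst * fourierSnd = fourierU 2 := by
  refine ext_tensU fun f g hf hg => ?_
  rw [unitary_mul_apply, fourierSnd, actSnd_tens, fourierFst, actFst_tens]
  apply Lp.ext
  have hi : Integrable (tens f g) :=
    (integrable_congr (tens_ae f g)).2 (measurePreserving_finTwo.integrable_comp_of_integrable
      (hf.mul_prod hg))
  filter_upwards [tens_ae (fourierU 1 f) (fourierU 1 g), fourierU_ae hi,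
    ae_comp_coord 0 (fourierU_ae hf), ae_comp_coord 1 (fourierU_ae hg)] with x h1 h2 h3 h4
  -- Fubini: the kernel factors over the two variables, and so does `(2π)⁻²`.
  rw [h1, h2, h3, h4, fIntegral, fIntegral, fIntegral, mul_mul_mul_comm, ← integral_prod_mul]
  erw [← measurePreserving_finTwo.integral_comp']
  congr 1
  · rw [pow_one, ← mul_inv, sq]
  · refine (integral_congr_ae ?_).symm
    filter_upwards [tens_ae f g] with y hy
    change _ = f (fun _ => y 0) * fKernel (fun _ => x 0) (fun _ => y 0) *
      (g (fun _ => y 1) * fKernel (fun _ => x 1) (fun _ => y 1))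
    rw [hy, mul_mul_mul_comm]
    congr 1
    rw [fKernel, fKernel, fKernel, ← Complex.exp_add]
    congr 1
    simp only [dotProduct, Fin.sum_univ_two, Finset.univ_unique, Fin.default_eq_zero,
      Finset.sum_singleton]
    push_cast
    ring

theorem swapU_mul_mulU {φ : (Fin 2 → ℝ) → ℂ} (hm : Measurable φ) (h1 : ∀ x, ‖φ x‖ = 1)
    (hs : ∀ x : Fin 2 → ℝ, φ ![x 1, x 0] = φ x) :
    swapU * mulU volume φ hm h1 = mulU volume φ hm h1 * swapU := by
  rw [swapU_eq, compU_mul_mulU]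
  congr 1
  refine mulU_congr _ _ (funext fun x => ?_)
  rw [← hs x]
  congr 1
  funext l
  fin_cases l <;> rfl

theorem swapU_mul_crossU : swapU * crossU = crossU * swapU :=
  swapU_mul_mulU _ _ fun x => by simp [mul_comm]

/-- The expression of a quarter turn as three alternating shears, corrected by a reflection to the
exchange of variables. -/
theorem shear_swap_identity :
    shearU * (swapU * shearU⁻¹ * swapU) * shearU * actSnd (parityU 1) = swapU := by
  have h : shearU⁻¹ = compU shearEquiv.symm (measurePreserving_shear.symm _) := rfl
  rw [actSnd_parityU, h, swapU_eq, shearU, compU_mul, compU_mul, compU_mul, compU_mul,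
    compU_mul]
  refine compU_congr _ (MeasurableEquiv.ext (funext fun x => funext fun l => ?_))
  fin_cases l <;> simp [shearEquiv, reflEquiv, permEquiv] <;> rfl

theorem reflection_mul_shearU_inv :
    actSnd (parityU 1) * shearU⁻¹ = shearU * actSnd (parityU 1) := by
  have h : shearU⁻¹ = compU shearEquiv.symm (measurePreserving_shear.symm _) := rfl
  rw [actSnd_parityU, h, shearU, compU_mul, compU_mul]
  refine compU_congr _ (MeasurableEquiv.ext (funext fun x => funext fun l => ?_))
  fin_cases l <;> simp [shearEquiv, reflEquiv]

end TwoVariables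

/-! ### Lifts to the Schwartz space -/

section Lifts

variable {m : ℕ}

/-- The unitary operator `V` restricts to the automorphism `v` of the Schwartz space. -/
def Lifts (V : L2 m ≃ₗᵢ[ℂ] L2 m) (v : 𝓢(Fin m → ℝ, ℂ) ≃ₗ[ℂ] 𝓢(Fin m → ℝ, ℂ)) : Prop :=
  ∀ f : 𝓢(Fin m → ℝ, ℂ), V (f.toLp 2) = (v f).toLp 2

theorem Lifts.mul {V W : L2 m ≃ₗᵢ[ℂ] L2 m} {v w : 𝓢(Fin m → ℝ, ℂ) ≃ₗ[ℂ] 𝓢(Fin m → ℝ, ℂ)}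
    (hV : Lifts V v) (hW : Lifts W w) : Lifts (V * W) (v * w) := fun f => by
  rw [unitary_mul_apply, hW, hV]
  rfl

theorem Lifts.inv {V : L2 m ≃ₗᵢ[ℂ] L2 m} {v : 𝓢(Fin m → ℝ, ℂ) ≃ₗ[ℂ] 𝓢(Fin m → ℝ, ℂ)}
    (hV : Lifts V v) : Lifts V⁻¹ v⁻¹ := fun f => by
  have h := hV (v⁻¹ f)
  have h1 : v (v⁻¹ f) = f := v.apply_symm_apply f
  rw [h1] at h
  rw [← h]
  exact V.symm_apply_apply _

theorem Lifts.pow {V : L2 m ≃ₗᵢ[ℂ] L2 m} {v : 𝓢(Fin m → ℝ, ℂ) ≃ₗ[ℂ] 𝓢(Fin m → ℝ, ℂ)}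
    (hV : Lifts V v) (n : ℕ) : Lifts (V ^ n) (v ^ n) := by
  induction n with
  | zero => intro f; rfl
  | succ n ih => rw [pow_succ, pow_succ]; exact ih.mul hV

theorem lifts_fourierU : Lifts (fourierU m) (fourierS m) := fourierU_toLp

/-- Multiplication by the chirp in the second of two variables. -/
def chirpSnd : L2 2 ≃ₗᵢ[ℂ] L2 2 := actSnd chirpU

/-- Multiplication by the chirp in the first of two variables. -/
def chirpFst : L2 2 ≃ₗᵢ[ℂ] L2 2 := actFst chirpU

theorem chirpFst_eq : chirpFst = mulU volume (fun x : Fin 2 → ℝ => chirp (x 0))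
    (continuous_chirp.measurable.comp (measurable_pi_apply 0)) (fun _ => norm_chirp _) :=
  actU_mulU (injective_vec1 (0 : Fin 2)) (φ := fun x : Fin 1 → ℝ => chirp (x 0)) _ _

theorem chirpSnd_eq : chirpSnd = mulU volume (fun x : Fin 2 → ℝ => chirp (x 1))
    (continuous_chirp.measurable.comp (measurable_pi_apply 1)) (fun _ => norm_chirp _) :=
  actU_mulU (injective_vec1 (1 : Fin 2)) (φ := fun x : Fin 1 → ℝ => chirp (x 0)) _ _

theorem lifts_chirpSnd : Lifts chirpSnd (chirpS 1) := fun f => by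
  apply Lp.ext
  rw [chirpSnd_eq]
  filter_upwards [mulU_ae (μ := volume) (φ := fun x : Fin 2 → ℝ => chirp (x 1))
    (continuous_chirp.measurable.comp (measurable_pi_apply 1)) (fun _ => norm_chirp _) (f.toLp 2),
    f.coeFn_toLp 2, (chirpS 1 f).coeFn_toLp 2] with x h1 h2 h3
  rw [h1, h2, h3, chirpS_apply]

/-- The operator `K₂ G` on `L²(ℝ²)`. -/
def metaU : L2 2 ≃ₗᵢ[ℂ] L2 2 := chirpSnd * fourierU 2

/-- The operator `K₂ G` on the Schwartz space of `ℝ²`. -/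
def metaS : 𝓢(Fin 2 → ℝ, ℂ) ≃ₗ[ℂ] 𝓢(Fin 2 → ℝ, ℂ) := chirpS 1 * fourierS 2

theorem lifts_metaU : Lifts metaU metaS := lifts_chirpSnd.mul lifts_fourierU

theorem metaS_qOp_zero (f : 𝓢(Fin 2 → ℝ, ℂ)) : metaS (qOp 0 f) = pOp 0 (metaS f) := by
  change chirpS 1 (fourierS 2 (qOp 0 f)) = pOp 0 (chirpS 1 (fourierS 2 f))
  rw [fourierS_qOp, pOp_chirpS, if_neg (by decide), add_zero]

theorem metaS_pOp (i : Fin 2) (f : 𝓢(Fin 2 → ℝ, ℂ)) : metaS (pOp i f) = -qOp i (metaS f) := by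
  change chirpS 1 (fourierS 2 (pOp i f)) = -qOp i (chirpS 1 (fourierS 2 f))
  rw [fourierS_pOp, map_neg, chirpS_qOp]

theorem metaS_qOp_one (f : 𝓢(Fin 2 → ℝ, ℂ)) :
    metaS (qOp 1 f) = pOp 1 (metaS f) - qOp 1 (metaS f) := by
  change chirpS 1 (fourierS 2 (qOp 1 f)) = pOp 1 (chirpS 1 (fourierS 2 f)) -
    qOp 1 (chirpS 1 (fourierS 2 f))
  rw [fourierS_qOp, pOp_chirpS, if_pos rfl, chirpS_qOp, add_sub_cancel_right]

/-- In the first variable `metaS` acts by `q ↦ p ↦ -q`, of order four; in the second by `q ↦ p - q ↦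
-p ↦ q`, of order three. Three steps thus turn `p₁` into `q₁` and leave `q₂` fixed. -/
theorem metaS_pow_three (f : 𝓢(Fin 2 → ℝ, ℂ)) :
    (metaS ^ 3) ((pOp 0 * qOp 1 : Module.End ℂ 𝓢(Fin 2 → ℝ, ℂ)) f) = qOp 0 (qOp 1 ((metaS ^ 3) f)) := by
  change metaS (metaS (metaS (pOp 0 (qOp 1 f)))) = qOp 0 (qOp 1 (metaS (metaS (metaS f))))
  simp only [metaS_pOp, metaS_qOp_zero, metaS_qOp_one, map_neg, map_sub, neg_neg]
  simp

/-- Four steps are the identity on the first variable and one step on the second. -/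
theorem metaS_pow_four (f : 𝓢(Fin 2 → ℝ, ℂ)) :
    (metaS ^ 4) ((qOp 0 + qOp 1 : Module.End ℂ 𝓢(Fin 2 → ℝ, ℂ)) f) = (qOp 0 + pOp 1 - qOp 1 : Module.End ℂ 𝓢(Fin 2 → ℝ, ℂ)) ((metaS ^ 4) f) := by
  change metaS (metaS (metaS (metaS (qOp 0 f + qOp 1 f)))) =
    qOp 0 (metaS (metaS (metaS (metaS f)))) + pOp 1 (metaS (metaS (metaS (metaS f)))) -
      qOp 1 (metaS (metaS (metaS (metaS f))))
  simp only [metaS_pOp, metaS_qOp_zero, metaS_qOp_one, map_neg, map_sub, map_add, neg_neg]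
  abel

theorem isMulBy_conj (V : L2 m ≃ₗᵢ[ℂ] L2 m) {h : (Fin m → ℝ) → ℝ} {φ : ℝ → ℂ}
    (hm : Measurable fun x => φ (h x)) (h1 : ∀ x, ‖φ (h x)‖ = 1) :
    IsMulBy V h φ (opU (V⁻¹ * mulU volume (fun x => φ (h x)) hm h1 * V)) := fun f => by
  have e : V (opU (V⁻¹ * mulU volume (fun x => φ (h x)) hm h1 * V) f) =
      mulU volume (fun x => φ (h x)) hm h1 (V f) := V.apply_symm_apply _
  rw [e]
  exact mulU_ae hm h1 (V f)

theorem functionOf_pq {φ : ℝ → ℂ} (hφ : Measurable φ) (h1 : ∀ s, ‖φ s‖ = 1) :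
    functionOf φ (pOp 0 * qOp 1) = opU ((metaU ^ 3)⁻¹ *
      mulU volume (fun x : Fin 2 → ℝ => φ (x 0 * x 1)) (hφ.comp (by fun_prop)) (fun _ => h1 _) *
        metaU ^ 3) := by
  refine functionOf_eq hφ (isFunctionOf_of_lift (metaU ^ 3) (metaS ^ 3) (lifts_metaU.pow 3)
    (h := fun x => x 0 * x 1) (by fun_prop) (fun f x => ?_)
    (isMulBy_conj (metaU ^ 3) (h := fun x => x 0 * x 1) _ _))
  rw [metaS_pow_three, qOp_apply, qOp_apply]
  push_cast
  ring

theorem functionOf_qpq {φ : ℝ → ℂ} (hφ : Measurable φ) (h1 : ∀ s, ‖φ s‖ = 1) :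
    functionOf φ (qOp 0 + pOp 1 - qOp 1) = opU (metaU ^ 4 *
      mulU volume (fun x : Fin 2 → ℝ => φ (x 0 + x 1)) (hφ.comp (by fun_prop)) (fun _ => h1 _) *
        (metaU ^ 4)⁻¹) := by
  have hB := isMulBy_conj (metaU ^ 4)⁻¹ (h := fun x : Fin 2 → ℝ => x 0 + x 1) (φ := φ)
    (hφ.comp (by fun_prop)) (fun _ => h1 _)
  rw [inv_inv] at hB
  refine functionOf_eq hφ (isFunctionOf_of_lift (metaU ^ 4)⁻¹ (metaS ^ 4)⁻¹ (lifts_metaU.pow 4).inv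
    (h := fun x => x 0 + x 1) (by fun_prop) (fun f x => ?_) hB)
  have e : ∀ g, (metaS ^ 4) ((metaS ^ 4)⁻¹ g) = g := (metaS ^ 4).apply_symm_apply
  have h2 : (metaS ^ 4)⁻¹ ((qOp 0 + pOp 1 - qOp 1 : Module.End ℂ 𝓢(Fin 2 → ℝ, ℂ)) f) = (qOp 0 + qOp 1 : Module.End ℂ 𝓢(Fin 2 → ℝ, ℂ)) ((metaS ^ 4)⁻¹ f) := by
    apply (metaS ^ 4).injective
    rw [metaS_pow_four, e, e]
  have h3 : ∀ g : 𝓢(Fin 2 → ℝ, ℂ), (qOp 0 + qOp 1 : Module.End ℂ 𝓢(Fin 2 → ℝ, ℂ)) g x =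
    qOp 0 g x + qOp 1 g x := fun _ => rfl
  rw [h2, h3, qOp_apply, qOp_apply]
  push_cast
  ring

end Lifts

/-! ### Relations between unitary operators in two variables -/

section Relations

theorem asc {M : Type*} [Semigroup M] {a b c d : M} (h : a * b = c * d) (x : M) :
    a * (b * x) = c * (d * x) := by
  rw [← mul_assoc, h, mul_assoc]

theorem inv_mul_of_mul_eq {M : Type*} [Group M] {a b c d : M} (h : a * b = c * d) :
    c⁻¹ * a = d * b⁻¹ := by
  rw [inv_mul_eq_iff_eq_mul, ← mul_assoc, ← h, mul_inv_cancel_right]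

/-- The operator `S' f(x₁, x₂) = f(x₁, x₁ + x₂)`. -/
def shearU' : L2 2 ≃ₗᵢ[ℂ] L2 2 := swapU * shearU * swapU

theorem swapU_mul_fourierFst : swapU * fourierFst = fourierSnd * swapU := by
  rw [fourierSnd, ← swapU_actFst, mul_assoc, swapU_mul_self, mul_one, fourierFst]

theorem swapU_mul_fourierSnd : swapU * fourierSnd = fourierFst * swapU := by
  rw [fourierFst, ← swapU_actSnd, mul_assoc, swapU_mul_self, mul_one, fourierSnd]

theorem swapU_mul_shearU : swapU * shearU = shearU' * swapU := by
  rw [shearU', mul_assoc, swapU_mul_self, mul_one]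

theorem shearU'_inv : shearU'⁻¹ = swapU * shearU⁻¹ * swapU := by
  rw [shearU', mul_inv_rev, mul_inv_rev, swapU_inv, mul_assoc]

theorem fourierFst_mul_fourierSnd : fourierFst * fourierSnd = fourierSnd * fourierFst :=
  actFst_actSnd_comm _ _

theorem fourierSnd_mul_shearU' : fourierSnd * shearU' = crossU * fourierSnd := by
  have h := congrArg (fun V => swapU * V * swapU) fourierFst_mul_shearU
  simp only [mul_assoc] at h
  rw [asc swapU_mul_fourierFst, asc swapU_mul_shearU, swapU_mul_self, mul_one,
    asc swapU_mul_crossU, asc swapU_mul_fourierFst, swapU_mul_self, mul_one] at h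
  exact h

theorem fourierSnd_mul_crossU : fourierSnd * crossU = shearU'⁻¹ * fourierSnd := by
  have h := congrArg (fun V => swapU * V * swapU) fourierFst_mul_crossU
  simp only [mul_assoc] at h
  rw [asc swapU_mul_fourierFst, asc swapU_mul_crossU, swapU_mul_self, mul_one] at h
  rw [h, shearU'_inv]
  simp only [mul_assoc]
  rw [swapU_mul_fourierSnd]

theorem fourierSnd_sq : fourierSnd * fourierSnd = actSnd (parityU 1) := by
  rw [fourierSnd, ← map_mul, fourierU_sq]

theorem fourierFst_sq : fourierFst * fourierFst = actFst (parityU 1) := by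
  rw [fourierFst, ← map_mul, fourierU_sq]

theorem fourierU_two_sq : fourierU 2 * fourierU 2 = parityU 2 := by
  rw [← fourierFst_mul_fourierSnd_eq, ← actFst_mul_actSnd_parityU, ← fourierFst_sq,
    ← fourierSnd_sq, mul_assoc, mul_assoc, asc fourierFst_mul_fourierSnd.symm]

/-- `C G C G C = G P`. -/
theorem crossU_braid :
    crossU * fourierU 2 * crossU * fourierU 2 * crossU = fourierU 2 * swapU := by
  -- With `G = F₁F₂`, each `C` is placed beside a partial Fourier transform that converts it into a
  -- shear.
  have h1 : crossU * fourierU 2 * crossU * fourierU 2 * crossU =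
      (crossU * fourierFst) * (fourierSnd * crossU) * fourierSnd * (fourierFst * crossU) := by
    rw [← fourierFst_mul_fourierSnd_eq]
    simp only [mul_assoc]
    rw [asc fourierFst_mul_fourierSnd crossU]
  rw [h1, ← fourierFst_mul_shearU, fourierSnd_mul_crossU, fourierFst_mul_crossU]
  simp only [mul_assoc]
  rw [← mul_assoc fourierSnd fourierSnd, fourierSnd_sq, asc reflection_mul_shearU_inv]
  -- All that is left between the two factors `F₁` is three shears and a reflection, that is, the
  -- exchange `P`; then `F₁ P F₁ = F₁ F₂ P`.
  have h2 := shear_swap_identity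
  rw [← shearU'_inv] at h2
  simp only [mul_assoc] at h2
  have h3 := asc (a := shearU * shearU'⁻¹) (b := shearU * actSnd (parityU 1)) (c := swapU) (d := 1)
    (by rw [mul_one, ← h2, mul_assoc]) fourierFst
  simp only [mul_assoc] at h3
  rw [h3, one_mul, swapU_mul_fourierFst, ← fourierFst_mul_fourierSnd_eq, mul_assoc]

theorem shear_conj (φ : ℝ → ℂ) (hφ : Measurable φ) (h1 : ∀ s, ‖φ s‖ = 1) :
    shearU * mulU volume (fun x : Fin 2 → ℝ => φ (x 0)) (hφ.comp (by fun_prop)) (fun _ => h1 _) =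
      mulU volume (fun x : Fin 2 → ℝ => φ (x 0 + x 1)) (hφ.comp (by fun_prop)) (fun _ => h1 _) *
        shearU := by
  rw [shearU, compU_mul_mulU]
  rfl

/-- Multiplication by a function of `x₁ + x₂`. -/
def sumU (φ : ℝ → ℂ) (hφ : Measurable φ) (h1 : ∀ s, ‖φ s‖ = 1) : L2 2 ≃ₗᵢ[ℂ] L2 2 :=
  mulU volume (fun x : Fin 2 → ℝ => φ (x 0 + x 1)) (hφ.comp (by fun_prop)) (fun _ => h1 _)

variable {φ : ℝ → ℂ} (hφ : Measurable φ) (h1 : ∀ s, ‖φ s‖ = 1)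

theorem swapU_mul_sumU : swapU * sumU φ hφ h1 = sumU φ hφ h1 * swapU :=
  swapU_mul_mulU _ _ fun x => by simp [add_comm]

theorem fourierU_mul_shearU : fourierU 2 * shearU = shearU'⁻¹ * fourierU 2 := by
  rw [← fourierFst_mul_fourierSnd_eq, fourierFst_mul_fourierSnd, mul_assoc, fourierFst_mul_shearU,
    asc fourierSnd_mul_crossU]

/-- Multiplication by a function of `x₁`, on `L²(ℝ)`. -/
def coordU (φ : ℝ → ℂ) (hφ : Measurable φ) (h1 : ∀ s, ‖φ s‖ = 1) : L2 1 ≃ₗᵢ[ℂ] L2 1 :=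
  mulU volume (fun x : Fin 1 → ℝ => φ (x 0)) (hφ.comp (by fun_prop)) (fun _ => h1 _)

theorem actFst_coordU : actFst (coordU φ hφ h1) =
    mulU volume (fun x : Fin 2 → ℝ => φ (x 0)) (hφ.comp (by fun_prop)) (fun _ => h1 _) :=
  actU_mulU (injective_vec1 (0 : Fin 2)) (φ := fun x : Fin 1 → ℝ => φ (x 0)) _ _

/-- A function of `x₁ + x₂`, conjugated with the Fourier transform. -/
theorem fourierU_mul_sumU : fourierU 2 * sumU φ hφ h1 =
    shearU'⁻¹ * actFst (fourierU 1 * coordU φ hφ h1 * (fourierU 1)⁻¹) * shearU' * fourierU 2 := by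
  -- The shear reduces a function of `x₁ + x₂` to one of `x₁`, and under `G` the shear becomes the
  -- inverse of the opposite one. The result acts only along the diagonal direction.
  have e1 : sumU φ hφ h1 = shearU * actFst (coordU φ hφ h1) * shearU⁻¹ := by
    rw [actFst_coordU, shear_conj φ hφ h1, mul_inv_cancel_right, sumU]
  have e3 : fourierU 2 * shearU⁻¹ = shearU' * fourierU 2 := by
    rw [← inv_mul_of_mul_eq fourierU_mul_shearU, inv_inv]
  have e4 : fourierU 2 * actFst (coordU φ hφ h1) =
      actFst (fourierU 1 * coordU φ hφ h1 * (fourierU 1)⁻¹) * fourierU 2 := by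
    rw [← fourierFst_mul_fourierSnd_eq, map_mul, map_mul, map_inv, ← fourierFst, mul_assoc,
      fourierSnd, ← actFst_actSnd_comm]
    group
  rw [e1, mul_assoc, asc fourierU_mul_shearU, asc e4, e3]
  simp only [mul_assoc]

/-- Multiplication by `exp(i (x₁ - x₂)² / 4π)`. -/
def diffU : L2 2 ≃ₗᵢ[ℂ] L2 2 := crossU * (chirpFst * chirpSnd)

theorem diffU_eq : diffU = mulU volume (fun x : Fin 2 → ℝ => chirp (x 1 - x 0))
    (continuous_chirp.measurable.comp (by fun_prop)) (fun _ => norm_chirp _) := by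
  rw [diffU, chirpFst_eq, chirpSnd_eq, crossU, mulU_mul, mulU_mul]
  refine mulU_congr _ _ (funext fun x => ?_)
  simp only [chirp, ← Complex.exp_add]
  congr 1
  push_cast
  ring

theorem shearU'_eq : ∃ (e : (Fin 2 → ℝ) ≃ᵐ (Fin 2 → ℝ)) (he : MeasurePreserving e volume volume),
    shearU' = compU e he ∧ ∀ x, e x = ![x 0, x 1 + x 0] := by
  refine ⟨_, _, by rw [shearU', swapU_eq, shearU, compU_mul, compU_mul], fun x => ?_⟩
  funext l
  fin_cases l <;> simp [shearEquiv, permEquiv]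

theorem shearU'_mul_diffU : shearU' * diffU = chirpSnd * shearU' := by
  obtain ⟨e, he, h, hx⟩ := shearU'_eq
  rw [h, diffU_eq, chirpSnd_eq, compU_mul_mulU]
  congr 1
  refine mulU_congr _ _ (funext fun x => ?_)
  rw [hx]
  simp

/-- After the substitution `S'` one operator acts on the first variable and the other, a function of
`x₂ - x₁`, on the second. -/
theorem diffU_comm (X : L2 1 ≃ₗᵢ[ℂ] L2 1) :
    diffU * (shearU'⁻¹ * actFst X * shearU') = shearU'⁻¹ * actFst X * shearU' * diffU := by
  have h : diffU * shearU'⁻¹ = shearU'⁻¹ * chirpSnd :=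
    (inv_mul_of_mul_eq shearU'_mul_diffU.symm).symm
  simp only [mul_assoc]
  rw [asc h, shearU'_mul_diffU, chirpSnd, asc (actFst_actSnd_comm X chirpU).symm]

end Relations

/-! ### The two identities -/

section Identities

/-- The phase `exp(-iπ/12)` as an operator. -/
def phaseU : L2 2 ≃ₗᵢ[ℂ] L2 2 := scalarU volume rho norm_rho

theorem phaseU_comm (V : L2 2 ≃ₗᵢ[ℂ] L2 2) : phaseU * V = V * phaseU := scalarU_comm _ V

theorem phaseU_sq_comm (V : L2 2 ≃ₗᵢ[ℂ] L2 2) : phaseU * phaseU * V = V * (phaseU * phaseU) :=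
  Commute.mul_left (phaseU_comm V) (phaseU_comm V)

/-- The rotation in the first variable. -/
def rotFst : L2 2 ≃ₗᵢ[ℂ] L2 2 := actFst rotU

/-- The rotation in the second variable. -/
def rotSnd : L2 2 ≃ₗᵢ[ℂ] L2 2 := actSnd rotU

theorem rotFst_eq : rotFst = phaseU * (chirpFst * fourierFst) := by
  rw [rotFst, rotU, map_mul, map_mul, chirpFst, fourierFst, phaseU]
  congr 1
  exact actU_scalarU _ _

theorem rotSnd_eq : rotSnd = phaseU * (chirpSnd * fourierSnd) := by
  rw [rotSnd, rotU, map_mul, map_mul, chirpSnd, fourierSnd, phaseU]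
  congr 1
  exact actU_scalarU _ _

theorem rotFst_pow : rotFst * (rotFst * rotFst) = 1 := by
  rw [rotFst, ← map_mul, ← map_mul, ← pow_three, rotU_pow_three, map_one]

theorem rotSnd_pow : rotSnd * (rotSnd * rotSnd) = 1 := by
  rw [rotSnd, ← map_mul, ← map_mul, ← pow_three, rotU_pow_three, map_one]

theorem rotFst_mul_rotSnd : rotFst * rotSnd = rotSnd * rotFst := actFst_actSnd_comm _ _

theorem swapU_mul_rotFst : swapU * rotFst = rotSnd * swapU := by
  rw [rotSnd, ← swapU_actFst, mul_assoc, swapU_mul_self, mul_one, rotFst]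

theorem swapU_mul_rotSnd : swapU * rotSnd = rotFst * swapU := by
  rw [rotFst, ← swapU_actSnd, mul_assoc, swapU_mul_self, mul_one, rotSnd]

theorem chirpFst_mul_crossU : chirpFst * crossU = crossU * chirpFst := by
  rw [chirpFst_eq, crossU, mulU_comm]

theorem chirpSnd_mul_crossU : chirpSnd * crossU = crossU * chirpSnd := by
  rw [chirpSnd_eq, crossU, mulU_comm]

/-- `Q = R₁ R₂`. -/
def rotBoth : L2 2 ≃ₗᵢ[ℂ] L2 2 := rotFst * rotSnd

theorem rotBoth_eq : rotBoth = phaseU * phaseU * (chirpFst * chirpSnd * fourierU 2) := by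
  have h : fourierFst * chirpSnd = chirpSnd * fourierFst := actFst_actSnd_comm _ _
  rw [rotBoth, rotFst_eq, rotSnd_eq, ← fourierFst_mul_fourierSnd_eq, mul_assoc phaseU,
    ← mul_assoc _ phaseU, ← phaseU_comm]
  simp only [mul_assoc]
  rw [asc h]

/-- `F₁` turns the shear into `C`, which commutes with the chirp. The right side no longer
distinguishes the two variables. -/
theorem rotFst_mul_shearU_mul_rotSnd : rotFst * shearU * rotSnd = crossU * rotBoth := by
  rw [rotBoth, rotFst_eq]
  simp only [mul_assoc]
  rw [asc fourierFst_mul_shearU, asc chirpFst_mul_crossU, asc (phaseU_comm crossU)]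

theorem rotSnd_mul_shearU'_mul_rotFst : rotSnd * shearU' * rotFst = crossU * rotBoth := by
  rw [rotBoth, rotFst_mul_rotSnd, rotSnd_eq]
  simp only [mul_assoc]
  rw [asc fourierSnd_mul_shearU', asc chirpSnd_mul_crossU, asc (phaseU_comm crossU)]

theorem swapU_mul_rotBoth : swapU * rotBoth = rotBoth * swapU := by
  rw [rotBoth, ← mul_assoc, swapU_mul_rotFst, mul_assoc, swapU_mul_rotSnd, ← mul_assoc,
    rotFst_mul_rotSnd]

variable {φ : ℝ → ℂ} (hφ : Measurable φ) (h1 : ∀ s, ‖φ s‖ = 1)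

theorem parityU_mul_sumU : parityU 2 * sumU φ hφ h1 =
    sumU (fun s => φ (-s)) (hφ.comp measurable_neg) (fun _ => h1 _) * parityU 2 := by
  rw [parityU, sumU, compU_mul_mulU]
  congr 1
  refine mulU_congr _ _ (funext fun x => congrArg φ ?_)
  simp only [MeasurableEquiv.neg_apply, Pi.neg_apply]
  ring

/-- Up to phase and outer chirps `Q C Q` is `G D G`, where `D` multiplies by the chirp of `x₂ - x₁`.
The first `G` turns `Φ` into an operator along the diagonal, which commutes with `D`; the second
completes `G²`, the parity. The outer chirps commute with multiplications. -/
theorem rotBoth_crossU_rotBoth_mul_sumU : rotBoth * crossU * rotBoth * sumU φ hφ h1 =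
    sumU (fun s => φ (-s)) (hφ.comp measurable_neg) (fun _ => h1 _) *
      (rotBoth * crossU * rotBoth) := by
  set X := shearU'⁻¹ * actFst (fourierU 1 * coordU φ hφ h1 * (fourierU 1)⁻¹) * shearU'
  have e1 : fourierU 2 * sumU φ hφ h1 = X * fourierU 2 := fourierU_mul_sumU hφ h1
  have e2 : diffU * X = X * diffU := diffU_comm _
  clear_value X
  have e3 : fourierU 2 * X =
      sumU (fun s => φ (-s)) (hφ.comp measurable_neg) (fun _ => h1 _) * fourierU 2 := by
    have h := parityU_mul_sumU hφ h1
    rw [← fourierU_two_sq, mul_assoc, e1, ← mul_assoc, ← mul_assoc] at h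
    rwa [mul_left_inj] at h
  have e4 : rotBoth * crossU * rotBoth = phaseU * phaseU * (phaseU * phaseU) *
      (chirpFst * chirpSnd * fourierU 2 * diffU * fourierU 2) := by
    have c := fun V => (phaseU_sq_comm V).symm
    rw [rotBoth_eq, diffU]
    generalize phaseU * phaseU = z at *
    generalize chirpFst * chirpSnd = k at *
    simp only [mul_assoc]
    rw [asc (c crossU), asc (c (fourierU 2)), asc (c k)]
  have e5 : ∀ {χ : ℝ → ℂ} (hχ : Measurable χ) (h2 : ∀ s, ‖χ s‖ = 1),
      chirpFst * chirpSnd * sumU χ hχ h2 = sumU χ hχ h2 * (chirpFst * chirpSnd) := fun hχ h2 => by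
    rw [chirpFst_eq, chirpSnd_eq, sumU, mul_assoc, mulU_comm, ← mul_assoc, mulU_comm, mul_assoc,
      mulU_comm]
  have e6 : ∀ V : L2 2 ≃ₗᵢ[ℂ] L2 2, phaseU * phaseU * (phaseU * phaseU) * V =
      V * (phaseU * phaseU * (phaseU * phaseU)) := fun V =>
    Commute.mul_left (phaseU_sq_comm V) (phaseU_sq_comm V)
  rw [e4]
  generalize phaseU * phaseU * (phaseU * phaseU) = z at *
  have e7 := e5 (χ := fun s => φ (-s)) (hφ.comp measurable_neg) (fun s => h1 (-s))
  generalize chirpFst * chirpSnd = k at *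
  simp only [mul_assoc]
  rw [e1, asc e2, asc e3, asc e7, asc (e6 _)]

/-- Since `(x₁ + x₂)² = x₁² + x₂² + 2x₁x₂`, the inverse chirp of the sum cancels the chirps in the
second `Q` up to `C`. This leaves `C G C G C`, and the first pair of chirps rebuilds `Q`. -/
theorem rotBoth_braid {χ : ℝ → ℂ} (hχ : Measurable χ) (h2 : ∀ s, ‖χ s‖ = 1)
    (hc : ∀ s, χ s = (chirp s)⁻¹) : crossU * rotBoth * sumU χ hχ h2 * rotBoth * crossU =
      phaseU * phaseU * rotBoth * swapU := by
  have e1 : sumU χ hχ h2 * (chirpFst * chirpSnd) = crossU := by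
    rw [chirpFst_eq, chirpSnd_eq, sumU, crossU, mulU_mul, mulU_mul]
    refine mulU_congr _ _ (funext fun x => ?_)
    rw [hc, chirp, chirp, chirp, ← Complex.exp_neg, ← Complex.exp_add, ← Complex.exp_add]
    congr 1
    push_cast
    ring
  have e2 : crossU * (chirpFst * chirpSnd) = chirpFst * chirpSnd * crossU :=
    (Commute.mul_left (S := L2 2 ≃ₗᵢ[ℂ] L2 2) chirpFst_mul_crossU chirpSnd_mul_crossU).symm
  have e3 := crossU_braid
  have c := fun V => (phaseU_sq_comm V).symm
  rw [rotBoth_eq]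
  generalize phaseU * phaseU = z at *
  generalize chirpFst * chirpSnd = k at *
  simp only [mul_assoc] at e3 ⊢
  rw [asc (c crossU), asc (c (sumU χ hχ h2)), asc (c (fourierU 2)), asc (c k), asc (c crossU),
    asc e2, ← mul_assoc (sumU χ hχ h2) k, e1, e3]

theorem scalarU_sumU {c : ℂ} (hc : ‖c‖ = 1) {χ : ℝ → ℂ} (hχ : Measurable χ) (h2 : ∀ s, ‖χ s‖ = 1)
    (h : ∀ s, φ s * φ (-s) = c * χ s) : sumU φ hφ h1 *
      sumU (fun s => φ (-s)) (hφ.comp measurable_neg) (fun _ => h1 _) =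
        scalarU volume c hc * sumU χ hχ h2 := by
  rw [sumU, sumU, sumU, scalarU, mulU_mul, mulU_mul]
  exact mulU_congr _ _ (funext fun x => h _)

/-- The unitary operator `T`. -/
def transU (φ : ℝ → ℂ) (hφ : Measurable φ) (h1 : ∀ s, ‖φ s‖ = 1) : L2 2 ≃ₗᵢ[ℂ] L2 2 :=
  shearU * (rotSnd * sumU φ hφ h1 * rotSnd⁻¹)

theorem transU_eq : transU φ hφ h1 = rotFst⁻¹ * crossU * rotBoth * sumU φ hφ h1 * rotSnd⁻¹ := by
  have h : rotFst⁻¹ * crossU * rotBoth = shearU * rotSnd := by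
    rw [mul_assoc, ← rotFst_mul_shearU_mul_rotSnd, mul_assoc, inv_mul_cancel_left]
  rw [h, transU]
  simp only [mul_assoc]

theorem swap_transU : swapU * transU φ hφ h1 * swapU =
    rotSnd⁻¹ * crossU * rotBoth * sumU φ hφ h1 * rotFst⁻¹ := by
  have h : rotSnd⁻¹ * crossU * rotBoth = shearU' * rotFst := by
    rw [mul_assoc, ← rotSnd_mul_shearU'_mul_rotFst, mul_assoc, inv_mul_cancel_left]
  have h' : swapU * rotSnd⁻¹ = rotFst⁻¹ * swapU := (inv_mul_of_mul_eq swapU_mul_rotSnd.symm.symm).symm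
  rw [h, transU]
  simp only [mul_assoc]
  rw [asc swapU_mul_shearU, asc swapU_mul_rotSnd, asc (swapU_mul_sumU hφ h1), asc h',
    swapU_mul_self, mul_one]

/-- The relation between `T₁₂` and `T₂₁`. -/
theorem transU_inversion : transU φ hφ h1 =
    rotFst⁻¹ * rotSnd * (swapU * transU φ hφ h1 * swapU) * rotFst * rotSnd⁻¹ := by
  -- In these forms `T₁₂` and `T₂₁` share the middle factor `C Q Φ`.
  rw [swap_transU, transU_eq]
  group

/-- The relation between `T` and `R`. -/
theorem transU_symmetry {c : ℂ} (hc : ‖c‖ = 1) (h : ∀ s, φ s * φ (-s) = c * (chirp s)⁻¹) :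
    transU φ hφ h1 * rotFst * (swapU * transU φ hφ h1 * swapU) * rotFst⁻¹ =
      scalarU volume c hc * (phaseU * phaseU) * (rotFst * swapU) := by
  have hχ : Measurable fun s => (chirp s)⁻¹ := continuous_chirp.measurable.inv
  have h2 : ∀ s, ‖(chirp s)⁻¹‖ = 1 := fun s => by rw [norm_inv, norm_chirp, inv_one]
  have f1 : rotFst⁻¹ * rotFst⁻¹ = rotFst := by
    rw [← mul_inv_rev, inv_eq_iff_mul_eq_one, mul_assoc, rotFst_pow]
  have f2 : rotSnd⁻¹ * rotFst * rotSnd⁻¹ = rotBoth := by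
    have hs : rotSnd⁻¹ * rotSnd⁻¹ = rotSnd := by
      rw [← mul_inv_rev, inv_eq_iff_mul_eq_one, mul_assoc, rotSnd_pow]
    have hr : rotFst * rotSnd⁻¹ = rotSnd⁻¹ * rotFst :=
      (inv_mul_of_mul_eq rotFst_mul_rotSnd).symm
    rw [← hr, mul_assoc, hs, rotBoth]
  -- Here `Q³ = 1` gives `Q² = R₁⁻¹R₂⁻¹`, so `R₁⁻¹ Q P Q R₁ = R₁⁻² P = R₁ P`.
  have f3 : rotFst⁻¹ * (rotBoth * (swapU * (rotBoth * rotFst))) = rotFst * swapU := by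
    have g1 : rotBoth * rotBoth = rotFst⁻¹ * rotSnd⁻¹ := by
      rw [← mul_inv_rev, ← rotFst_mul_rotSnd, ← rotBoth, eq_inv_iff_mul_eq_one, mul_assoc, ← pow_three, rotBoth,
        Commute.mul_pow rotFst_mul_rotSnd, pow_three, pow_three, rotFst_pow, rotSnd_pow, mul_one]
    rw [asc swapU_mul_rotBoth, swapU_mul_rotFst, ← mul_assoc rotBoth, g1]
    rw [mul_assoc, inv_mul_cancel_left, ← mul_assoc, f1]
  have k1 := rotBoth_crossU_rotBoth_mul_sumU hφ h1
  have k2 := scalarU_sumU hφ h1 hc hχ h2 h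
  have k3 := rotBoth_braid hχ h2 fun _ => rfl
  have z1 := scalarU_comm (μ := (volume : Measure (Fin 2 → ℝ))) hc
  have z2 := phaseU_sq_comm
  rw [swap_transU, transU_eq]
  generalize phaseU * phaseU = z at *
  generalize scalarU (volume : Measure (Fin 2 → ℝ)) c hc = y at *
  generalize sumU (fun s => φ (-s)) (hφ.comp measurable_neg) (fun _ => h1 _) = Φ' at *
  generalize sumU (fun s => (chirp s)⁻¹) hχ h2 = E at *
  generalize sumU φ hφ h1 = Φ at *
  generalize rotBoth = Q at *
  -- The inner rotations combine to `Q`; then the second `Φ` is moved left past `Q C Q`, `Φ Φ'` is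
  -- replaced by `y E`, and the braid relation is applied.
  calc rotFst⁻¹ * crossU * Q * Φ * rotSnd⁻¹ * rotFst * (rotSnd⁻¹ * crossU * Q * Φ * rotFst⁻¹) *
        rotFst⁻¹
      = rotFst⁻¹ * crossU * Q * Φ * (rotSnd⁻¹ * rotFst * rotSnd⁻¹) * crossU * Q * Φ *
        (rotFst⁻¹ * rotFst⁻¹) := by simp only [mul_assoc]
    _ = rotFst⁻¹ * crossU * Q * Φ * (Q * crossU * Q * Φ) * rotFst := by
        rw [f1, f2]
        simp only [mul_assoc]
    _ = rotFst⁻¹ * crossU * Q * (Φ * Φ') * (Q * crossU * Q) * rotFst := by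
        rw [k1]
        simp only [mul_assoc]
    _ = rotFst⁻¹ * crossU * Q * y * (E * Q * crossU * Q) * rotFst := by
        rw [k2]
        simp only [mul_assoc]
    _ = y * (rotFst⁻¹ * (crossU * Q * E * Q * crossU) * Q * rotFst) := by
        rw [← z1]
        simp only [mul_assoc]
    _ = y * (z * (rotFst⁻¹ * (Q * (swapU * (Q * rotFst))))) := by
        rw [k3]
        simp only [mul_assoc]
        rw [asc (z2 rotFst⁻¹).symm]
    _ = y * z * (rotFst * swapU) := by rw [f3, mul_assoc]

end Identities

/-! ### The operators on `L²(ℝᵐ)` -/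

section Main

/-- Up to a phase `metaU` is a product of commuting operators, `R₂` of order three and `F₁` of order
four, so its powers isolate either one. -/
theorem metaU_eq : metaU = phaseU⁻¹ * (rotSnd * fourierFst) := by
  rw [metaU, rotSnd_eq, ← fourierFst_mul_fourierSnd_eq, fourierFst_mul_fourierSnd]
  simp only [mul_assoc, inv_mul_cancel_left]

theorem fourierFst_pow_four : fourierFst ^ 4 = 1 := by
  have h : parityU 1 * parityU 1 = 1 := by
    rw [parityU, compU_mul]
    ext1 f
    apply Lp.ext
    filter_upwards [compU_ae ((MeasurableEquiv.neg _).trans (MeasurableEquiv.neg _))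
      (measurePreserving_trans (measurePreserving_negEquiv 1) (measurePreserving_negEquiv 1)) f]
      with x hx
    rw [hx]
    simp
  rw [show 4 = 2 * 2 from rfl, pow_mul, pow_two, pow_two, fourierFst_sq, ← map_mul, h, map_one]

theorem rotSnd_mul_fourierFst : Commute rotSnd fourierFst := (actFst_actSnd_comm _ _).symm

theorem phaseU_inv_comm (V : L2 2 ≃ₗᵢ[ℂ] L2 2) : Commute phaseU⁻¹ V :=
  Commute.inv_left (phaseU_comm V)

theorem metaU_pow_three : metaU ^ 3 = phaseU⁻¹ ^ 3 * fourierFst ^ 3 := by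
  rw [metaU_eq, (phaseU_inv_comm _).mul_pow, rotSnd_mul_fourierFst.mul_pow, pow_three rotSnd,
    rotSnd_pow, one_mul]

theorem metaU_pow_four : metaU ^ 4 = phaseU⁻¹ ^ 4 * rotSnd := by
  rw [metaU_eq, (phaseU_inv_comm _).mul_pow, rotSnd_mul_fourierFst.mul_pow, fourierFst_pow_four,
    mul_one, pow_succ' rotSnd, pow_three rotSnd, rotSnd_pow, mul_one]

theorem conj_of_central {M : Type*} [Group M] {z : M} (hz : ∀ V, Commute z V) (x y : M) :
    (z * y) * x * (z * y)⁻¹ = y * x * y⁻¹ := by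
  rw [(hz y).eq, mul_inv_rev, mul_assoc y z x, (hz x).eq]
  group

theorem fourierFst_pow_three_mul_shearU :
    fourierFst ^ 3 * shearU = crossU⁻¹ * fourierFst ^ 3 := by
  have h : fourierFst * shearU⁻¹ = crossU⁻¹ * fourierFst :=
    (inv_mul_of_mul_eq fourierFst_mul_shearU).symm
  rw [pow_three]
  simp only [mul_assoc]
  rw [fourierFst_mul_shearU, asc fourierFst_mul_crossU, asc h]

theorem norm_cexp_div (s : ℝ) : ‖cexp (I / (2 * Real.pi) * s)‖ = 1 := by
  rw [show I / (2 * Real.pi) * s = ((s / (2 * Real.pi) : ℝ) : ℂ) * I by push_cast; ring]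
  exact Complex.norm_exp_ofReal_mul_I _

theorem functionOf_exp : functionOf (fun s => cexp (I / (2 * Real.pi) * s)) (pOp 0 * qOp 1) =
    opU shearU := by
  rw [functionOf_pq (by fun_prop) norm_cexp_div]
  congr 1
  have h1 : mulU volume (fun x : Fin 2 → ℝ => cexp (I / (2 * Real.pi) * (x 0 * x 1 : ℝ)))
      (by fun_prop) (fun _ => norm_cexp_div _) = crossU⁻¹ := by
    have h2 : (fun x : Fin 2 → ℝ => cexp (I / (2 * Real.pi) * (x 0 * x 1 : ℝ)) *
        cexp (((-(x 1 * x 0 / (2 * Real.pi)) : ℝ) : ℂ) * I)) = fun _ => 1 := funext fun x => by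
      rw [← Complex.exp_add, ← Complex.exp_zero]
      congr 1
      push_cast
      ring
    rw [eq_inv_iff_mul_eq_one, crossU, mulU_mul, mulU_congr _ _ h2]
    ext1 f
    exact (scalarU_apply norm_one f).trans (one_smul _ _)
  -- The phases are central and drop out of the conjugation, leaving `F₁⁻³ C⁻¹ F₁³`, which is the
  -- shear.
  rw [h1, metaU_pow_three]
  have h2 := conj_of_central (z := (phaseU⁻¹ ^ 3)⁻¹)
    (fun V => ((phaseU_inv_comm V).pow_left 3).inv_left) crossU⁻¹ (fourierFst ^ 3)⁻¹
  have h3 : (phaseU⁻¹ ^ 3)⁻¹ * (fourierFst ^ 3)⁻¹ = (phaseU⁻¹ ^ 3 * fourierFst ^ 3)⁻¹ := by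
    rw [mul_inv_rev]
    exact ((phaseU_inv_comm _).pow_left 3).inv_left
  rw [h3, inv_inv, inv_inv] at h2
  rw [h2, mul_assoc, ← fourierFst_pow_three_mul_shearU, inv_mul_cancel_left]

theorem functionOf_sum {φ : ℝ → ℂ} (hφ : Measurable φ) (h1 : ∀ s, ‖φ s‖ = 1) :
    functionOf φ (qOp 0 + pOp 1 - qOp 1) = opU (rotSnd * sumU φ hφ h1 * rotSnd⁻¹) := by
  rw [functionOf_qpq hφ h1, metaU_pow_four,
    conj_of_central fun V => (phaseU_inv_comm V).pow_left 4]
  rfl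

theorem opU_transU {φ : ℝ → ℂ} (hφ : Measurable φ) (h1 : ∀ s, ‖φ s‖ = 1) :
    functionOf (fun s => cexp (I / (2 * Real.pi) * s)) (pOp 0 * qOp 1) *
      functionOf φ (qOp 0 + pOp 1 - qOp 1) = opU (transU φ hφ h1) := by
  rw [functionOf_exp, functionOf_sum hφ h1, ← map_mul, transU]

variable {m : ℕ} {i j : Fin m}

theorem injective_vec2 (hij : i ≠ j) : Function.Injective ![i, j] := by
  intro a b h
  fin_cases a <;> fin_cases b <;> simp_all

theorem actU_vec2_actFst (hij : i ≠ j) (V : L2 1 ≃ₗᵢ[ℂ] L2 1) :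
    actU (injective_vec2 hij) (actFst V) = actU (injective_vec1 i) V := by
  rw [actFst, actU_actU]
  congr 1
  have : ![i, j] ∘ ![0] = ![i] := by funext l; fin_cases l; rfl
  simp only [this]

theorem actU_vec2_actSnd (hij : i ≠ j) (V : L2 1 ≃ₗᵢ[ℂ] L2 1) :
    actU (injective_vec2 hij) (actSnd V) = actU (injective_vec1 j) V := by
  rw [actSnd, actU_actU]
  congr 1
  have : ![i, j] ∘ ![1] = ![j] := by funext l; fin_cases l; rfl
  simp only [this]

theorem actU_vec2_swap (hij : i ≠ j) (V : L2 2 ≃ₗᵢ[ℂ] L2 2) :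
    actU (injective_vec2 hij) (swapU * V * swapU) = actU (injective_vec2 hij.symm) V := by
  have h : Function.Injective ![(1 : Fin 2), 0] := by decide
  rw [← actU_vec_one_zero h, actU_actU]
  congr 1
  have : ![i, j] ∘ ![1, 0] = ![j, i] := by funext l; fin_cases l <;> rfl
  simp only [this]

theorem opU_scalarU {c : ℂ} (hc : ‖c‖ = 1) (V : L2 m ≃ₗᵢ[ℂ] L2 m) :
    opU (scalarU volume c hc * V) = c • opU V := by
  ext1 f
  exact scalarU_apply hc (V f)

end Main

/-! ### The quantum dilogarithm -/

section QuantumDilogarithm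

open Filter Topology

theorem norm_sinh_sq (z : ℂ) : ‖sinh z‖ ^ 2 = Real.sinh z.re ^ 2 + Real.sin z.im ^ 2 := by
  have h : sinh z = ((Real.sinh z.re * Real.cos z.im : ℝ) : ℂ) +
      ((Real.cosh z.re * Real.sin z.im : ℝ) : ℂ) * I := by
    conv_lhs => rw [← Complex.re_add_im z]
    rw [Complex.sinh_add, Complex.sinh_mul_I, Complex.cosh_mul_I]
    push_cast
    ring
  rw [← Complex.normSq_eq_norm_sq, h, Complex.normSq_add_mul_I, mul_pow, mul_pow, Real.cosh_sq,
    Real.cos_sq']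
  ring

theorem abs_le_abs_sinh (u : ℝ) : |u| ≤ |Real.sinh u| := by
  rw [Real.abs_sinh]
  exact Real.self_le_sinh_iff.2 (abs_nonneg u)

theorem abs_re_le_norm_sinh (z : ℂ) : |z.re| ≤ ‖sinh z‖ := by
  refine (abs_le_abs_sinh _).trans (abs_le_of_sq_le_sq' ?_ (norm_nonneg _) |> fun h => abs_le.2 h)
  rw [norm_sinh_sq]
  nlinarith [sq_nonneg (Real.sin z.im)]

theorem sinh_ne_zero_of_im {z : ℂ} (h0 : z ≠ 0) (h1 : |z.im| < Real.pi) : sinh z ≠ 0 := fun h => by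
  have h2 := norm_sinh_sq z
  rw [h, norm_zero, zero_pow two_ne_zero] at h2
  have h3 : Real.sinh z.re = 0 := by nlinarith [sq_nonneg (Real.sinh z.re), sq_nonneg (Real.sin z.im)]
  have h4 : Real.sin z.im = 0 := by nlinarith [sq_nonneg (Real.sinh z.re), sq_nonneg (Real.sin z.im)]
  have h5 := abs_lt.1 h1
  exact h0 (Complex.ext (Real.sinh_eq_zero.1 h3)
    ((Real.sin_eq_zero_iff_of_lt_of_lt h5.1 h5.2).1 h4))

/-- The integrand of the quantum dilogarithm. -/
def dilogFun (a b x : ℝ) (z : ℂ) : ℂ := cexp (-I * x * z) / (sinh (a * z) * sinh (b * z) * z)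

/-- The point `t + ic` of the contour. -/
def contour (c t : ℝ) : ℂ := t + c * I

theorem contour_re (c t : ℝ) : (contour c t).re = t := by simp [contour]

theorem contour_im (c t : ℝ) : (contour c t).im = c := by simp [contour]

theorem contour_ne_zero {c : ℝ} (hc : 0 < c) (t : ℝ) : contour c t ≠ 0 := fun h => by
  have := congrArg Complex.im h
  rw [contour_im] at this
  exact hc.ne' this

theorem continuous_contour (c : ℝ) : Continuous (contour c) := by
  unfold contour
  fun_prop

theorem neg_contour (c t : ℝ) : -contour c t = contour (-c) (-t) := by
  simp only [contour]
  push_cast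
  ring

theorem conj_contour (c t : ℝ) : starRingEnd ℂ (contour c t) = -contour c (-t) := by
  apply Complex.ext <;> simp [contour]

/-- The height of the contour. -/
def height (lam : ℝ) : ℝ := min |lam| |lam|⁻¹ / 2

theorem height_pos {lam : ℝ} (hlam : lam ≠ 0) : 0 < height lam := by
  have := abs_pos.2 hlam
  rw [height]
  positivity

/-- Twice the height reaches at most the nearest nonzero zero of the hyperbolic sines, so the strip
`|Im z| < 2c` contains no singularity other than `0`. -/
theorem height_le {lam : ℝ} (hlam : lam ≠ 0) : |Real.pi * lam| * (2 * height lam) ≤ Real.pi := by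
  have h := abs_pos.2 hlam
  rw [abs_mul, abs_of_pos Real.pi_pos, height, mul_div_cancel₀ _ two_ne_zero, mul_assoc]
  refine mul_le_of_le_one_right Real.pi_pos.le ?_
  calc |lam| * min |lam| |lam|⁻¹ ≤ |lam| * |lam|⁻¹ := by gcongr; exact min_le_right _ _
    _ = 1 := mul_inv_cancel₀ h.ne'

theorem height_inv (lam : ℝ) : height lam⁻¹ = height lam := by
  rw [height, height, abs_inv, inv_inv, min_comm]

theorem height_le' {lam : ℝ} (hlam : lam ≠ 0) :
    |Real.pi * lam⁻¹| * (2 * height lam) ≤ Real.pi := by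
  rw [← height_inv]
  exact height_le (inv_ne_zero hlam)

theorem qdilog_eq (lam x : ℝ) : qdilog lam x = cexp (-(1 / 4) *
    ∫ t, dilogFun (Real.pi * lam) (Real.pi * lam⁻¹) x (contour (height lam) t)) := by
  simp only [qdilog, dilogFun, contour, height]
  push_cast
  rfl

theorem measurable_qdilog (lam : ℝ) : Measurable (qdilog lam) := by
  have h : StronglyMeasurable fun x => ∫ t,
      dilogFun (Real.pi * lam) (Real.pi * lam⁻¹) x (contour (height lam) t) := by
    refine StronglyMeasurable.integral_prod_right (Measurable.stronglyMeasurable ?_)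
    unfold Function.uncurry dilogFun contour
    fun_prop
  have := (h.measurable.const_mul (-(1 / 4))).cexp
  simp_rw [← qdilog_eq] at this
  exact this

theorem conj_dilogFun (a b x c t : ℝ) : starRingEnd ℂ (dilogFun a b x (contour c t)) =
    -dilogFun a b x (contour c (-t)) := by
  rw [dilogFun, dilogFun, map_div₀, map_mul, map_mul, ← Complex.exp_conj, ← Complex.sinh_conj,
    ← Complex.sinh_conj]
  simp only [map_mul, map_neg, Complex.conj_I, Complex.conj_ofReal, conj_contour, mul_neg,
    Complex.sinh_neg, neg_mul, neg_neg, div_neg]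

/-- Reflection in the imaginary axis maps the contour to itself and the integrand to minus its
conjugate, so the integral is purely imaginary. -/
theorem norm_qdilog (lam x : ℝ) : ‖qdilog lam x‖ = 1 := by
  rw [qdilog_eq]
  apply norm_cexp_eq_one
  set J := ∫ t, dilogFun (Real.pi * lam) (Real.pi * lam⁻¹) x (contour (height lam) t) with hJ
  have h : starRingEnd ℂ J = -J := by
    rw [hJ, ← integral_conj, ← integral_neg]
    simp_rw [conj_dilogFun]
    rw [integral_neg, integral_neg, integral_neg_eq_self fun t =>
      dilogFun (Real.pi * lam) (Real.pi * lam⁻¹) x (contour (height lam) t)]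
  have h2 : J.re = 0 := by
    have := congrArg Complex.re h
    rw [Complex.conj_re, Complex.neg_re] at this
    linarith
  simp [h2]

/-- On the contour `|sinh|² = sinh²(at) + sin²(ac)`. Quadratic growth of the two squared factors
already makes the integrand integrable, so exponential decay is not needed. -/
theorem mul_one_add_sq_le_norm_sinh_sq {a c : ℝ} (ha : a ≠ 0) (hc : 0 < c)
    (hac : |a| * (2 * c) ≤ Real.pi) :
    ∃ k > 0, ∀ t : ℝ, k * (1 + t ^ 2) ≤ ‖sinh (a * contour c t)‖ ^ 2 := by
  have hs : Real.sin (a * c) ≠ 0 := by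
    have h := abs_pos.2 ha
    have hp := Real.pi_pos
    have h1 : 0 < |a| * c := mul_pos h hc
    have h2 : |a * c| < Real.pi := by rw [abs_mul, abs_of_pos hc]; linarith
    have h3 := abs_lt.1 h2
    rw [Ne, Real.sin_eq_zero_iff_of_lt_of_lt h3.1 h3.2]
    exact mul_ne_zero ha hc.ne'
  refine ⟨min (a ^ 2) (Real.sin (a * c) ^ 2), lt_min (by positivity) (by positivity), fun t => ?_⟩
  have e : (a * contour c t : ℂ) = contour (a * c) (a * t) := by
    simp only [contour]
    push_cast
    ring
  rw [e, norm_sinh_sq, contour_re, contour_im]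
  have h1 := abs_le_abs_sinh (a * t)
  have h2 : (a * t) ^ 2 ≤ Real.sinh (a * t) ^ 2 := sq_le_sq.2 h1
  have h3 := min_le_left (a ^ 2) (Real.sin (a * c) ^ 2)
  have h4 := min_le_right (a ^ 2) (Real.sin (a * c) ^ 2)
  nlinarith [mul_le_mul_of_nonneg_right h3 (sq_nonneg t)]

theorem integrable_dilogFun {a b c : ℝ} (ha : a ≠ 0) (hb : b ≠ 0) (hc : 0 < c)
    (hac : |a| * (2 * c) ≤ Real.pi) (hbc : |b| * (2 * c) ≤ Real.pi) (x : ℝ) :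
    Integrable fun t => dilogFun a b x (contour c t) := by
  obtain ⟨k, hk, h1⟩ := mul_one_add_sq_le_norm_sinh_sq ha hc hac
  obtain ⟨l, hl, h2⟩ := mul_one_add_sq_le_norm_sinh_sq hb hc hbc
  have hm : Measurable fun t => dilogFun a b x (contour c t) := by
    unfold dilogFun contour
    fun_prop
  refine Integrable.mono' (g := fun t => Real.exp (x * c) / (Real.sqrt (k * l) * c) *
    (1 + t ^ 2)⁻¹) (integrable_inv_one_add_sq.const_mul _) hm.aestronglyMeasurable
    (Eventually.of_forall fun t => ?_)
  have e1 : ‖cexp (-I * x * contour c t)‖ = Real.exp (x * c) := by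
    rw [Complex.norm_exp]
    congr 1
    simp [contour]
  have e2 : c ≤ ‖contour c t‖ := by
    have := Complex.abs_im_le_norm (contour c t)
    rwa [contour_im, abs_of_pos hc] at this
  have e3 : Real.sqrt (k * l) * (1 + t ^ 2) ≤
      ‖sinh (a * contour c t)‖ * ‖sinh (b * contour c t)‖ := by
    refine abs_le_of_sq_le_sq' ?_ (by positivity) |>.2
    rw [mul_pow, Real.sq_sqrt (by positivity), mul_pow]
    calc k * l * (1 + t ^ 2) ^ 2 = (k * (1 + t ^ 2)) * (l * (1 + t ^ 2)) := by ring
      _ ≤ _ := mul_le_mul (h1 t) (h2 t) (by positivity) (by positivity)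
  rw [dilogFun, norm_div, norm_mul, norm_mul, e1, ← div_eq_mul_inv, div_div]
  have hkl : 0 < Real.sqrt (k * l) := Real.sqrt_pos.2 (mul_pos hk hl)
  refine div_le_div_of_nonneg_left (Real.exp_pos _).le (by positivity) ?_
  calc Real.sqrt (k * l) * c * (1 + t ^ 2) = Real.sqrt (k * l) * (1 + t ^ 2) * c := by ring
    _ ≤ _ := mul_le_mul e3 e2 hc.le (by positivity)

end QuantumDilogarithm

/-! ### The inversion formula for the quantum dilogarithm -/

section InversionFormula

open Filter Topology

theorem tendsto_of_norm_sub_le {f : ℂ → ℂ} {L : ℂ} {C : ℝ}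
    (h : ∀ᶠ z in 𝓝[≠] (0 : ℂ), ‖f z - L‖ ≤ C * ‖z‖) : Tendsto f (𝓝[≠] 0) (𝓝 L) := by
  rw [tendsto_iff_norm_sub_tendsto_zero]
  refine squeeze_zero' (Eventually.of_forall fun _ => norm_nonneg _) h ?_
  have h1 : Tendsto (fun z : ℂ => C * ‖z‖) (𝓝 0) (𝓝 (C * ‖(0 : ℂ)‖)) :=
    (continuous_const.mul continuous_norm).tendsto 0
  rw [norm_zero, mul_zero] at h1
  exact h1.mono_left nhdsWithin_le_nhds

theorem eventually_small (x : ℂ) :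
    ∀ᶠ z in 𝓝[≠] (0 : ℂ), z ≠ 0 ∧ ‖z‖ ≤ 1 ∧ ‖x * z‖ ≤ 1 := by
  have h1 : ∀ᶠ z in 𝓝[≠] (0 : ℂ), z ≠ 0 := eventually_mem_nhdsWithin
  have h2 : ∀ᶠ z in 𝓝 (0 : ℂ), ‖z‖ < 1 :=
    continuous_norm.continuousAt.eventually (gt_mem_nhds (by simp))
  have h3 : ∀ᶠ z in 𝓝 (0 : ℂ), ‖x * z‖ < 1 :=
    (continuous_const.mul continuous_id).norm.continuousAt.eventually (gt_mem_nhds (by simp))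
  filter_upwards [h1, nhdsWithin_le_nhds h2, nhdsWithin_le_nhds h3] with z a b c
  exact ⟨a, b.le, c.le⟩

theorem tendsto_cos_sub_one_div_sq (x : ℂ) :
    Tendsto (fun z => (cos (x * z) - 1) / z ^ 2) (𝓝[≠] 0) (𝓝 (-(x ^ 2 / 2))) := by
  refine tendsto_of_norm_sub_le (C := ‖x‖ ^ 4 * (5 / 96)) ?_
  filter_upwards [eventually_small x] with z ⟨h0, h1, h2⟩
  have e : (cos (x * z) - 1) / z ^ 2 - -(x ^ 2 / 2) =
      (cos (x * z) - (1 - (x * z) ^ 2 / 2)) / z ^ 2 := by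
    field_simp
    ring
  have hz := norm_pos_iff.2 h0
  rw [e, norm_div, norm_pow, div_le_iff₀ (by positivity)]
  refine (Complex.cos_bound h2).trans ?_
  rw [norm_mul]
  calc (‖x‖ * ‖z‖) ^ 4 * (5 / 96) = ‖x‖ ^ 4 * (5 / 96) * (‖z‖ * ‖z‖ ^ 2) * ‖z‖ := by ring
    _ ≤ ‖x‖ ^ 4 * (5 / 96) * (‖z‖ * ‖z‖ ^ 2) * 1 := by gcongr
    _ = _ := by ring

theorem norm_sinh_sub_le {w : ℂ} (h : ‖w‖ ≤ 1) : ‖sinh w - (w + w ^ 3 / 6)‖ ≤ ‖w‖ ^ 5 / 100 := by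
  have h1 := Complex.sin_bound (x := w * I) (by simpa using h)
  rw [Complex.sin_mul_I, norm_mul, Complex.norm_I, mul_one] at h1
  have e : sinh w * I - (w * I - (w * I) ^ 3 / 6) = (sinh w - (w + w ^ 3 / 6)) * I := by
    rw [mul_pow, Complex.I_pow_three]
    ring
  rwa [e, norm_mul, Complex.norm_I, mul_one] at h1

theorem tendsto_sinh_div_sub_div_sq (a : ℂ) :
    Tendsto (fun z => (sinh (a * z) / z - a) / z ^ 2) (𝓝[≠] 0) (𝓝 (a ^ 3 / 6)) := by
  refine tendsto_of_norm_sub_le (C := ‖a‖ ^ 5 / 100) ?_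
  filter_upwards [eventually_small a] with z ⟨h0, h1, h2⟩
  have e : (sinh (a * z) / z - a) / z ^ 2 - a ^ 3 / 6 =
      (sinh (a * z) - (a * z + (a * z) ^ 3 / 6)) / z ^ 3 := by
    field_simp
    ring
  have hz := norm_pos_iff.2 h0
  rw [e, norm_div, norm_pow, div_le_iff₀ (by positivity)]
  refine (norm_sinh_sub_le h2).trans ?_
  rw [norm_mul]
  calc (‖a‖ * ‖z‖) ^ 5 / 100 = ‖a‖ ^ 5 / 100 * (‖z‖ * ‖z‖ ^ 3) * ‖z‖ := by ring
    _ ≤ ‖a‖ ^ 5 / 100 * (‖z‖ * ‖z‖ ^ 3) * 1 := by gcongr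
    _ = _ := by ring

theorem tendsto_sinh_div (a : ℂ) : Tendsto (fun z => sinh (a * z) / z) (𝓝[≠] 0) (𝓝 a) := by
  have h1 : Tendsto (fun z : ℂ => z ^ 2) (𝓝[≠] 0) (𝓝 0) := by
    have := ((continuous_pow 2).tendsto (0 : ℂ)).mono_left (nhdsWithin_le_nhds (s := {0}ᶜ))
    simpa using this
  have h2 := ((tendsto_sinh_div_sub_div_sq a).mul h1).add_const a
  rw [mul_zero, zero_add] at h2
  refine h2.congr' ?_
  filter_upwards [eventually_mem_nhdsWithin] with z hz
  have hz : z ≠ 0 := hz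
  field_simp
  ring

/-- The sum of the values of the integrand at `x` and `-x`, an odd function. -/
def dilogSum (a b x : ℝ) (z : ℂ) : ℂ := dilogFun a b x z + dilogFun a b (-x) z

theorem dilogSum_eq (a b x : ℝ) (z : ℂ) :
    dilogSum a b x z = 2 * cos (x * z) / (sinh (a * z) * sinh (b * z) * z) := by
  rw [dilogSum, dilogFun, dilogFun, ← add_div, Complex.cos, mul_div_cancel₀ _ two_ne_zero, add_comm]
  have e1 : -I * ((-x : ℝ) : ℂ) * z = x * z * I := by
    push_cast
    ring
  have e2 : -I * (x : ℂ) * z = -(x * z) * I := by ring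
  rw [e1, e2]

theorem dilogSum_neg (a b x : ℝ) (z : ℂ) : dilogSum a b x (-z) = -dilogSum a b x z := by
  rw [dilogSum_eq, dilogSum_eq]
  simp only [mul_neg, Complex.sinh_neg, Complex.cos_neg, neg_mul, neg_neg, div_neg]

/-- The coefficient of `z⁻¹` in the Laurent expansion of `dilogSum a b x` at `0`. -/
def dilogResidue (a b x : ℝ) : ℂ := -((x ^ 2 + (a ^ 2 + b ^ 2) / 3) / (a * b))

/-- The regular part of `dilogSum a b x` at `0`. -/
def dilogRegular (a b x : ℝ) (z : ℂ) : ℂ :=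
  dilogSum a b x z - 2 / (a * b) * (z ^ 3)⁻¹ - dilogResidue a b x * z⁻¹

theorem dilogRegular_neg (a b x : ℝ) (z : ℂ) : dilogRegular a b x (-z) = -dilogRegular a b x z := by
  rw [dilogRegular, dilogRegular, dilogSum_neg, Odd.neg_pow (by decide : Odd 3), inv_neg, inv_neg]
  ring

theorem dilogRegular_zero (a b x : ℝ) : dilogRegular a b x 0 = 0 := by
  simp [dilogRegular, dilogSum_eq]

/-- Removing the polar part leaves `o(1/z)`. The product of the two quotients `sinh(az)/z`,
`sinh(bz)/z` is compared with `ab` one factor at a time, using the second order expansions. -/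
theorem tendsto_dilogRegular_mul {a b : ℝ} (ha : a ≠ 0) (hb : b ≠ 0) (x : ℝ) :
    Tendsto (fun z => dilogRegular a b x z * z) (𝓝[≠] 0) (𝓝 0) := by
  have ha' : (a : ℂ) ≠ 0 := ofReal_ne_zero.2 ha
  have hb' : (b : ℂ) ≠ 0 := ofReal_ne_zero.2 hb
  have h1 := tendsto_cos_sub_one_div_sq x
  have h2 := tendsto_sinh_div_sub_div_sq a
  have h3 := tendsto_sinh_div_sub_div_sq b
  have h4 := tendsto_sinh_div a
  have h5 := tendsto_sinh_div b
  have h6 := ((((h1.const_mul (2 * (a * b : ℂ))).sub (((h2.mul h5).add (h3.const_mul (a : ℂ))).const_mul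
    2)).div ((h4.mul h5).mul_const (a * b : ℂ)) (by positivity)).sub_const (dilogResidue a b x))
  have e : (2 * (a * b : ℂ) * -((x : ℂ) ^ 2 / 2) - 2 * ((a : ℂ) ^ 3 / 6 * b + a * ((b : ℂ) ^ 3 / 6))) /
      (a * b * (a * b)) - dilogResidue a b x = 0 := by
    rw [dilogResidue]
    field_simp
    ring
  rw [e] at h6
  refine h6.congr' ?_
  filter_upwards [eventually_mem_nhdsWithin, h4.eventually_ne ha', h5.eventually_ne hb'] with z hz ka kb
  have hz : z ≠ 0 := hz
  have ka' : sinh (a * z) ≠ 0 := fun h => ka (by rw [h, zero_div])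
  have kb' : sinh (b * z) ≠ 0 := fun h => kb (by rw [h, zero_div])
  simp only [Pi.div_apply]
  rw [dilogRegular, dilogSum_eq]
  field_simp
  ring

theorem sinh_mul_ne_zero {a c : ℝ} (ha : a ≠ 0) (hac : |a| * (2 * c) ≤ Real.pi) {z : ℂ}
    (hz : z ≠ 0) (h : |z.im| < 2 * c) : sinh (a * z) ≠ 0 := by
  refine sinh_ne_zero_of_im (mul_ne_zero (ofReal_ne_zero.2 ha) hz) ?_
  rw [Complex.im_ofReal_mul, abs_mul]
  exact (mul_lt_mul_of_pos_left h (abs_pos.2 ha)).trans_le hac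

theorem exists_differentiableOn_eq_dilogRegular {a b c : ℝ} (ha : a ≠ 0) (hb : b ≠ 0) (hc : 0 < c)
    (hac : |a| * (2 * c) ≤ Real.pi) (hbc : |b| * (2 * c) ≤ Real.pi) (x : ℝ) :
    ∃ F : ℂ → ℂ, DifferentiableOn ℂ F {z | |z.im| < 2 * c} ∧
      ∀ z, z ≠ 0 → F z = dilogRegular a b x z := by
  refine ⟨_, Complex.differentiableOn_update_limUnder_of_isLittleO (f := dilogRegular a b x) (c := 0)
    ?_ ?_ ?_, fun z hz => Function.update_of_ne hz _ _⟩
  · refine (isOpen_lt (by fun_prop) continuous_const).mem_nhds ?_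
    simp only [Set.mem_ofPred_eq, Complex.zero_im, abs_zero]
    linarith
  · intro z hz
    have hz0 : z ≠ 0 := hz.2
    have h1 := sinh_mul_ne_zero ha hac hz0 hz.1
    have h2 := sinh_mul_ne_zero hb hbc hz0 hz.1
    refine DifferentiableAt.differentiableWithinAt ?_
    unfold dilogRegular dilogSum dilogFun
    have h3 : sinh (a * z) * sinh (b * z) * z ≠ 0 := mul_ne_zero (mul_ne_zero h1 h2) hz0
    have h4 : z ^ 3 ≠ 0 := pow_ne_zero 3 hz0
    fun_prop (disch := assumption)
  · rw [dilogRegular_zero]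
    simp only [sub_zero]
    refine (Asymptotics.isLittleO_iff_tendsto' ?_).2 ?_
    · filter_upwards [eventually_mem_nhdsWithin] with z hz h
      exact absurd (inv_eq_zero.1 h) hz
    · simp only [div_inv_eq_mul]
      exact tendsto_dilogRegular_mul ha hb x

theorem norm_dilogFun_le {a b c x t y : ℝ} (ha : a ≠ 0) (hb : b ≠ 0) (ht : 0 < t) (hy : |y| ≤ c) :
    ‖dilogFun a b x (contour y t)‖ ≤ Real.exp (|x| * c) / (|a| * |b|) * (t ^ 3)⁻¹ := by
  have e1 : ‖cexp (-I * x * contour y t)‖ = Real.exp (x * y) := by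
    rw [Complex.norm_exp]
    congr 1
    simp [contour]
  have e2 : t ≤ ‖contour y t‖ := by
    have := Complex.abs_re_le_norm (contour y t)
    rwa [contour_re, abs_of_pos ht] at this
  have e3 : ∀ d : ℝ, |d| * t ≤ ‖sinh (d * contour y t)‖ := fun d => by
    have := abs_re_le_norm_sinh (d * contour y t)
    rwa [Complex.re_ofReal_mul, contour_re, abs_mul, abs_of_pos ht] at this
  have e4 : x * y ≤ |x| * c := (le_abs_self _).trans ((abs_mul x y).le.trans
    (mul_le_mul_of_nonneg_left hy (abs_nonneg x)))
  have ha' := abs_pos.2 ha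
  have hb' := abs_pos.2 hb
  rw [dilogFun, norm_div, norm_mul, norm_mul, e1, ← div_eq_mul_inv, div_div]
  refine div_le_div₀ (Real.exp_pos _).le (Real.exp_le_exp.2 e4) (by positivity) ?_
  calc |a| * |b| * t ^ 3 = |a| * t * (|b| * t) * t := by ring
    _ ≤ _ := mul_le_mul (mul_le_mul (e3 a) (e3 b) (by positivity) (by positivity)) e2 ht.le
      (by positivity)

theorem exists_tendsto_norm_dilogRegular_le {a b : ℝ} (ha : a ≠ 0) (hb : b ≠ 0) (c x : ℝ) :
    ∃ B : ℝ → ℝ, Tendsto B atTop (𝓝 0) ∧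
      ∀ t, 0 < t → ∀ y, |y| ≤ c → ‖dilogRegular a b x (contour y t)‖ ≤ B t := by
  refine ⟨fun t => (Real.exp (|x| * c) / (|a| * |b|) * (t ^ 3)⁻¹ +
    Real.exp (|x| * c) / (|a| * |b|) * (t ^ 3)⁻¹) + ‖(2 / (a * b) : ℂ)‖ * (t ^ 3)⁻¹ +
    ‖dilogResidue a b x‖ * t⁻¹, ?_, fun t ht y hy => ?_⟩
  · have h1 : Tendsto (fun t : ℝ => (t ^ 3)⁻¹) atTop (𝓝 0) :=
      (tendsto_pow_atTop three_ne_zero).inv_tendsto_atTop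
    have h2 : Tendsto (fun t : ℝ => t⁻¹) atTop (𝓝 0) := tendsto_inv_atTop_zero
    have h3 := h1.const_mul (Real.exp (|x| * c) / (|a| * |b|))
    have := ((h3.add h3).add (h1.const_mul ‖(2 / (a * b) : ℂ)‖)).add
      (h2.const_mul ‖dilogResidue a b x‖)
    simpa using this
  · have e2 : t ≤ ‖contour y t‖ := by
      have := Complex.abs_re_le_norm (contour y t)
      rwa [contour_re, abs_of_pos ht] at this
    have h1 := norm_dilogFun_le (x := x) ha hb ht hy
    have h2 := norm_dilogFun_le (x := -x) ha hb ht hy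
    rw [abs_neg] at h2
    refine (norm_sub_le _ _).trans (add_le_add ((norm_sub_le _ _).trans (add_le_add
      ((norm_add_le _ _).trans (add_le_add h1 h2)) ?_)) ?_)
    · rw [norm_mul, norm_inv, norm_pow]
      gcongr
    · rw [norm_mul, norm_inv]
      gcongr

/-- Cauchy's theorem on the rectangle symmetric about `0`: by oddness opposite sides contribute
equally, so the upper side equals one vertical side. -/
theorem integral_contour_eq_of_odd {F : ℂ → ℂ} {c : ℝ} (hc : 0 < c)
    (hF : DifferentiableOn ℂ F {z | |z.im| < 2 * c}) (hodd : ∀ z, z ≠ 0 → F (-z) = -F z)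
    {N : ℝ} (hN : 0 < N) :
    ∫ t in -N..N, F (contour c t) = I * ∫ y in -c..c, F (contour y N) := by
  have h := Complex.integral_boundary_rect_eq_zero_of_differentiableOn F (contour (-c) (-N))
    (contour c N) (hF.mono fun z hz => by
      have := hz.2
      simp only [contour_im, Set.mem_preimage] at this
      rw [Set.uIcc_of_le (by linarith)] at this
      rw [Set.mem_ofPred_eq]
      have := abs_le.2 this
      linarith)
  simp only [contour_re, contour_im, smul_eq_mul] at h
  change (((∫ t in -N..N, F (contour (-c) t)) - ∫ t in -N..N, F (contour c t)) +
    I * ∫ y in -c..c, F (contour y N)) - I * ∫ y in -c..c, F (contour y (-N)) = 0 at h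
  have h1 : ∫ t in -N..N, F (contour (-c) t) = -∫ t in -N..N, F (contour c t) := by
    rw [← intervalIntegral.integral_neg]
    have := intervalIntegral.integral_comp_neg (a := -N) (b := N) fun t => F (contour (-c) t)
    rw [neg_neg] at this
    rw [← this]
    refine intervalIntegral.integral_congr fun t _ => ?_
    simp only [← neg_contour]
    exact hodd _ (contour_ne_zero hc t)
  have h2 : ∫ y in -c..c, F (contour y (-N)) = -∫ y in -c..c, F (contour y N) := by
    rw [← intervalIntegral.integral_neg]
    have := intervalIntegral.integral_comp_neg (a := -c) (b := c) fun y => F (contour y (-N))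
    rw [neg_neg] at this
    rw [← this]
    refine intervalIntegral.integral_congr fun y _ => ?_
    simp only [← neg_contour]
    refine hodd _ fun h => hN.ne' ?_
    simpa [contour_re] using congrArg Complex.re h
  rw [h1, h2] at h
  linear_combination (-1 / 2) * h

theorem tendsto_integral_contour_of_odd {F : ℂ → ℂ} {c : ℝ} (hc : 0 < c)
    (hF : DifferentiableOn ℂ F {z | |z.im| < 2 * c}) (hodd : ∀ z, z ≠ 0 → F (-z) = -F z)
    {B : ℝ → ℝ} (hB : Tendsto B atTop (𝓝 0))
    (hFB : ∀ t, 0 < t → ∀ y, |y| ≤ c → ‖F (contour y t)‖ ≤ B t) :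
    Tendsto (fun N => ∫ t in -N..N, F (contour c t)) atTop (𝓝 0) := by
  refine squeeze_zero_norm' (a := fun N => B N * |c - -c|) ?_ (by simpa using hB.mul_const |c - -c|)
  filter_upwards [eventually_gt_atTop 0] with N hN
  rw [integral_contour_eq_of_odd hc hF hodd hN, norm_mul, Complex.norm_I, one_mul]
  refine intervalIntegral.norm_integral_le_of_norm_le_const fun y hy => hFB N hN y ?_
  rw [Set.uIoc_of_le (by linarith)] at hy
  exact abs_le.2 ⟨hy.1.le, hy.2⟩

theorem continuous_contour_inv {c : ℝ} (hc : 0 < c) : Continuous fun t => (contour c t)⁻¹ :=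
  (continuous_contour c).inv₀ (contour_ne_zero hc)

/-- The primitive is a branch of `log z` along the contour, whose argument is `π/2 - arctan(t/c)`.
-/
theorem integral_contour_inv {c : ℝ} (hc : 0 < c) (N : ℝ) :
    ∫ t in -N..N, (contour c t)⁻¹ = -(2 * I * Real.arctan (N / c)) := by
  have h : ∀ t : ℝ, HasDerivAt (fun t : ℝ => ((1 / 2 * Real.log (t ^ 2 + c ^ 2) : ℝ) : ℂ) -
      I * ((Real.arctan (t / c) : ℝ) : ℂ)) (contour c t)⁻¹ t := fun t => by
    have hp : t ^ 2 + c ^ 2 ≠ 0 := by positivity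
    have h1 : HasDerivAt (fun t : ℝ => 1 / 2 * Real.log (t ^ 2 + c ^ 2))
        (1 / 2 * (((2 : ℕ) * t ^ (2 - 1)) / (t ^ 2 + c ^ 2))) t :=
      (((hasDerivAt_pow 2 t).add_const _).log hp).const_mul _
    have h2 : HasDerivAt (fun t : ℝ => Real.arctan (t / c)) (1 / (1 + (t / c) ^ 2) * (1 / c)) t :=
      ((hasDerivAt_id t).div_const c).arctan
    refine (h1.ofReal_comp.sub (h2.ofReal_comp.const_mul I)).congr_deriv ?_
    have hz := contour_ne_zero hc t
    have e : ((t ^ 2 + c ^ 2 : ℝ) : ℂ) = contour c t * (t - c * I) := by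
      rw [contour]
      push_cast
      linear_combination (c : ℂ) ^ 2 * I_sq
    have hz' : (t - c * I : ℂ) ≠ 0 := fun h => by
      rw [h, mul_zero, ofReal_eq_zero] at e
      exact hp e
    have e2 : 1 / (1 + (t / c) ^ 2) * (1 / c) = c / (t ^ 2 + c ^ 2) := by
      field_simp
      ring
    rw [e2, ofReal_mul, ofReal_div, ofReal_div, ofReal_div, e]
    field_simp
    push_cast
    ring
  rw [intervalIntegral.integral_eq_sub_of_hasDerivAt (fun t _ => h t)
    ((continuous_contour_inv hc).intervalIntegrable _ _), neg_div, Real.arctan_neg, neg_sq]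
  push_cast
  ring

theorem tendsto_integral_contour_inv {c : ℝ} (hc : 0 < c) :
    Tendsto (fun N => ∫ t in -N..N, (contour c t)⁻¹) atTop (𝓝 (-(I * Real.pi))) := by
  simp_rw [integral_contour_inv hc]
  have h1 : Tendsto (fun N : ℝ => Real.arctan (N / c)) atTop (𝓝 (Real.pi / 2)) :=
    (Real.tendsto_arctan_atTop.mono_right nhdsWithin_le_nhds).comp (tendsto_id.atTop_div_const hc)
  have h2 := (((continuous_ofReal.tendsto _).comp h1).const_mul (2 * I)).neg
  have e : -(2 * I * ((Real.pi / 2 : ℝ) : ℂ)) = -(I * Real.pi) := by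
    push_cast
    ring
  rw [e] at h2
  exact h2

theorem tendsto_integral_contour_inv_cube {c : ℝ} (hc : 0 < c) :
    Tendsto (fun N => ∫ t in -N..N, (contour c t ^ 3)⁻¹) atTop (𝓝 0) := by
  have h : ∀ t : ℝ, HasDerivAt (fun t : ℝ => -(1 / 2) * (contour c t ^ 2)⁻¹)
      (contour c t ^ 3)⁻¹ t := fun t => by
    have hz := contour_ne_zero hc t
    have h0 : HasDerivAt (contour c) 1 t := (hasDerivAt_id t).ofReal_comp.add_const _
    refine (((h0.pow 2).inv (pow_ne_zero 2 hz)).const_mul (-(1 / 2) : ℂ)).congr_deriv ?_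
    simp only [Pi.pow_apply]
    field_simp
    ring
  have hcont : Continuous fun t => (contour c t ^ 3)⁻¹ :=
    ((continuous_contour c).pow 3).inv₀ fun t => pow_ne_zero 3 (contour_ne_zero hc t)
  simp_rw [intervalIntegral.integral_eq_sub_of_hasDerivAt (fun t _ => h t)
    (hcont.intervalIntegrable _ _)]
  have key : ∀ s : ℝ → ℝ, Tendsto (fun N => |s N|) atTop atTop →
      Tendsto (fun N => -(1 / 2) * (contour c (s N) ^ 2)⁻¹) atTop (𝓝 (-(1 / 2) * 0)) := fun s hs => by
    refine Tendsto.const_mul _ ?_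
    rw [tendsto_zero_iff_norm_tendsto_zero]
    simp_rw [norm_inv, norm_pow]
    refine Tendsto.inv_tendsto_atTop ((tendsto_pow_atTop two_ne_zero).comp
      (tendsto_atTop_mono (fun N => ?_) hs))
    have := Complex.abs_re_le_norm (contour c (s N))
    rwa [contour_re] at this
  have := (key (fun N => N) tendsto_abs_atTop_atTop).sub
    (key (fun N => -N) (by simpa using tendsto_abs_atTop_atTop))
  simpa using this

/-- The regular part and `z⁻³` contribute nothing, and `z⁻¹` contributes `-iπ`. -/
theorem integral_dilogSum {a b c : ℝ} (ha : a ≠ 0) (hb : b ≠ 0) (hc : 0 < c)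
    (hac : |a| * (2 * c) ≤ Real.pi) (hbc : |b| * (2 * c) ≤ Real.pi) (x : ℝ) :
    ∫ t, dilogSum a b x (contour c t) = -(I * Real.pi) * dilogResidue a b x := by
  have hint : Integrable fun t => dilogSum a b x (contour c t) :=
    (integrable_dilogFun ha hb hc hac hbc x).add (integrable_dilogFun ha hb hc hac hbc (-x))
  obtain ⟨F, hF, hFe⟩ := exists_differentiableOn_eq_dilogRegular ha hb hc hac hbc x
  obtain ⟨B, hB, hBe⟩ := exists_tendsto_norm_dilogRegular_le ha hb c x
  have h1 : Tendsto (fun N => ∫ t in -N..N, F (contour c t)) atTop (𝓝 0) := by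
    refine tendsto_integral_contour_of_odd hc hF (fun z hz => ?_) hB fun t ht y hy => ?_
    · rw [hFe z hz, hFe _ (neg_ne_zero.2 hz), dilogRegular_neg]
    · rw [hFe _ fun h => ht.ne' (by simpa [contour_re] using congrArg Complex.re h)]
      exact hBe t ht y hy
  have hcF : Continuous fun t => F (contour c t) :=
    hF.continuousOn.comp_continuous (continuous_contour c) fun t => by
      rw [Set.mem_ofPred_eq, contour_im, abs_of_pos hc]
      linarith
  have hc3 : Continuous fun t => (contour c t ^ 3)⁻¹ :=
    ((continuous_contour c).pow 3).inv₀ fun t => pow_ne_zero 3 (contour_ne_zero hc t)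
  have h2 := (h1.add ((tendsto_integral_contour_inv_cube hc).const_mul (2 / (a * b) : ℂ))).add
    ((tendsto_integral_contour_inv hc).const_mul (dilogResidue a b x))
  have h3 := intervalIntegral_tendsto_integral hint tendsto_neg_atTop_atBot tendsto_id
  -- The integral is absolutely convergent, so symmetric truncations compute it; the term in `z⁻¹`
  -- alone converges only in this sense.
  refine (tendsto_nhds_unique h3 (h2.congr fun N => ?_)).trans (by ring)
  have hc4 : Continuous fun t => F (contour c t) + 2 / (a * b : ℂ) * (contour c t ^ 3)⁻¹ :=
    hcF.add (hc3.const_mul _)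
  rw [← intervalIntegral.integral_const_mul, ← intervalIntegral.integral_const_mul,
    ← intervalIntegral.integral_add (hcF.intervalIntegrable _ _)
      ((hc3.const_mul _).intervalIntegrable _ _),
    ← intervalIntegral.integral_add (hc4.intervalIntegrable _ _)
      (((continuous_contour_inv hc).const_mul _).intervalIntegrable _ _)]
  refine intervalIntegral.integral_congr fun t _ => ?_
  simp only [hFe _ (contour_ne_zero hc t), dilogRegular]
  ring

theorem qdilog_mul_qdilog_neg {lam : ℝ} (hlam : lam ≠ 0) (x : ℝ) :
    qdilog lam x * qdilog lam (-x) =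
      cexp (-(I * Real.pi / 12) * (lam ^ 2 + (lam⁻¹) ^ 2) - I * x ^ 2 / (4 * Real.pi)) := by
  have ha : Real.pi * lam ≠ 0 := mul_ne_zero Real.pi_ne_zero hlam
  have hb : Real.pi * lam⁻¹ ≠ 0 := mul_ne_zero Real.pi_ne_zero (inv_ne_zero hlam)
  have hi := integrable_dilogFun ha hb (height_pos hlam) (height_le hlam) (height_le' hlam)
  rw [qdilog_eq, qdilog_eq, ← Complex.exp_add, ← mul_add, ← integral_add (hi x) (hi (-x))]
  congr 1
  rw [show (∫ t, dilogFun (Real.pi * lam) (Real.pi * lam⁻¹) x (contour (height lam) t) +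
      dilogFun (Real.pi * lam) (Real.pi * lam⁻¹) (-x) (contour (height lam) t)) = _ from
    integral_dilogSum ha hb (height_pos hlam) (height_le hlam) (height_le' hlam) x, dilogResidue]
  have hl : (lam : ℂ) ≠ 0 := ofReal_ne_zero.2 hlam
  have hp : (Real.pi : ℂ) ≠ 0 := ofReal_ne_zero.2 Real.pi_ne_zero
  push_cast
  field_simp
  ring

end InversionFormula

/-! ### Comparison of the scalar phases -/

section Phases

/-- The phase in the inversion formula for the quantum dilogarithm. -/
def inversionPhase (lam : ℝ) : ℂ := cexp (-(I * Real.pi / 12) * (lam ^ 2 + (lam⁻¹) ^ 2))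

theorem norm_inversionPhase (lam : ℝ) : ‖inversionPhase lam‖ = 1 := by
  rw [inversionPhase, show -(I * Real.pi / 12) * ((lam : ℂ) ^ 2 + ((lam⁻¹ : ℝ) : ℂ) ^ 2) =
    ((-(Real.pi / 12) * (lam ^ 2 + (lam⁻¹) ^ 2) : ℝ) : ℂ) * I by push_cast; ring]
  exact Complex.norm_exp_ofReal_mul_I _

theorem qdilog_inversion {lam : ℝ} (hlam : lam ≠ 0) (s : ℝ) :
    qdilog lam s * qdilog lam (-s) = inversionPhase lam * (chirp s)⁻¹ := by
  rw [qdilog_mul_qdilog_neg hlam, inversionPhase, chirp, ← Complex.exp_neg, ← Complex.exp_add,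
    sub_eq_add_neg]

theorem norm_zetaFactor (lam : ℝ) : ‖zetaFactor lam‖ = 1 := by
  rw [zetaFactor, show -(I * Real.pi / 12) * ((lam : ℂ) + ((lam⁻¹ : ℝ) : ℂ)) ^ 2 =
    ((-(Real.pi / 12) * (lam + lam⁻¹) ^ 2 : ℝ) : ℂ) * I by push_cast; ring]
  exact Complex.norm_exp_ofReal_mul_I _

/-- The two phases of `R` supply the cross term `2` that completes `λ² + λ⁻²` to `(λ + λ⁻¹)²`. -/
theorem phases_mul {lam : ℝ} (hlam : lam ≠ 0) :
    scalarU volume (inversionPhase lam) (norm_inversionPhase lam) * (phaseU * phaseU) =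
      scalarU volume (zetaFactor lam) (norm_zetaFactor lam) := by
  ext1 f
  rw [unitary_mul_apply, unitary_mul_apply, phaseU, scalarU_apply, scalarU_apply, scalarU_apply,
    scalarU_apply, smul_smul, smul_smul, rho, inversionPhase, zetaFactor, ← Complex.exp_add,
    ← Complex.exp_add]
  congr 2
  have : (lam : ℂ) ≠ 0 := by exact_mod_cast hlam
  push_cast
  field_simp
  ring

end Phases

end

/-! ### The main theorem -/

theorem mainTheorem3 (lam : ℝ) (hlam : lam ≠ 0) :
    (∀ x : ℝ, qdilog lam x * qdilog lam (-x) =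
      Complex.exp (-(Complex.I * Real.pi / 12) * (lam ^ 2 + (lam⁻¹) ^ 2)
        - Complex.I * x ^ 2 / (4 * Real.pi))) ∧
    rotOp ∈ unitary (L2 1 →L[ℂ] L2 1) ∧
    tOp lam ∈ unitary (L2 2 →L[ℂ] L2 2) ∧
    rotOp ^ 3 = 1 ∧
    ∀ (m : ℕ) (i j : Fin m), i ≠ j →
      actOn ![i] rotOp ∈ unitary (L2 m →L[ℂ] L2 m) ∧
      actOn ![i, j] (tOp lam) ∈ unitary (L2 m →L[ℂ] L2 m) ∧
      actOn ![i, j] (tOp lam) * actOn ![i] rotOp * actOn ![j, i] (tOp lam) *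
          Ring.inverse (actOn ![i] rotOp) =
        zetaFactor lam • (actOn ![i] rotOp * permOp (Equiv.swap i j)) ∧
      actOn ![i, j] (tOp lam) =
        Ring.inverse (actOn ![i] rotOp) * actOn ![j] rotOp * actOn ![j, i] (tOp lam) *
          actOn ![i] rotOp * Ring.inverse (actOn ![j] rotOp) := by
  have hm := measurable_qdilog lam
  have h1 := norm_qdilog lam
  have hT : tOp lam = opU (transU (qdilog lam) hm h1) := opU_transU hm h1
  refine ⟨qdilog_mul_qdilog_neg hlam, ?_, ?_, ?_, fun m i j hij => ?_⟩
  · rw [rotOp_eq]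
    exact opU_mem_unitary _
  · rw [hT]
    exact opU_mem_unitary _
  · rw [rotOp_eq, ← map_pow, rotU_pow_three, map_one]
  -- All operators are images of two-variable unitaries under the single homomorphism `actU
  -- (injective_vec2 hij)`, so the relations need only hold in two variables.
  · have ei : actOn ![i] rotOp = opU (actU (injective_vec2 hij) rotFst) := by
      rw [rotFst, actU_vec2_actFst hij, opU_actU, rotOp_eq]
    have ej : actOn ![j] rotOp = opU (actU (injective_vec2 hij) rotSnd) := by
      rw [rotSnd, actU_vec2_actSnd hij, opU_actU, rotOp_eq]
    have eij : actOn ![i, j] (tOp lam) =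
        opU (actU (injective_vec2 hij) (transU (qdilog lam) hm h1)) := by
      rw [opU_actU, hT]
    have eji : actOn ![j, i] (tOp lam) =
        opU (actU (injective_vec2 hij) (swapU * transU (qdilog lam) hm h1 * swapU)) := by
      rw [actU_vec2_swap hij, opU_actU, hT]
    have ep : permOp (Equiv.swap i j) = opU (actU (injective_vec2 hij) swapU) := by
      rw [swapU, actU_permU_swap, opU_permU]
    rw [ei, ej, eij, eji, ep, inverse_opU, inverse_opU]
    refine ⟨opU_mem_unitary _, opU_mem_unitary _, ?_, ?_⟩
    · simp only [← map_mul, ← map_inv]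
      rw [transU_symmetry hm h1 (norm_inversionPhase lam) (qdilog_inversion hlam),
        phases_mul hlam, map_mul, actU_scalarU, opU_scalarU]
    · simp only [← map_mul, ← map_inv]
      rw [← transU_inversion]
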